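/- Let $d\ge 1$, $T>0$, $\underline\alpha=(\alpha_1,\dots,\alpha_d)$ with $\alpha_i\in(0,2]\setminus\{1\}$, $\underline\delta=(\delta_1,\dots,\delta_d)$ with $|\delta_i|\le\min\{\alpha_i,2-\alpha_i\}$, and $\alpha_0=\min_i\alpha_i$. Let $$G_t(x)=\prod_{i=1}^d\frac1{2\pi}\int_{\mathbb R}\exp\Big(-\mathrm i z x_i-t|z|^{\alpha_i}e^{-\mathrm i\delta_i\frac{\pi}{2}\operatorname{sgn}z}\Big)\,dz$$ be the Green function on $\mathbb R^d$ of $\partial_t u=\mathcal D u$, where $\mathcal D=\sum_iD^{\alpha_i}_{\delta_i}$ and $D^{\alpha_i}_{\delta_i}$ acts on the $i$-th coordinate as the Fourier multiplier $-|z|^{\alpha_i}e^{-\mathrm i\delta_i\frac\pi2\operatorname{sgn}z}$. Let $\Gamma$ be a non-negative, non-negative definite tempered measure on $\mathbb R^d$ with (tempered) spectral measure $\mu=\mathcal F^{-1}\Gamma$, where $\mathcal F f(\xi)=\int e^{-\mathrm i\langle x,\xi\rangle}f(x)\,dx$. Let $\mathcal H$ be the completion of the real Schwartz space $\mathcal S(\mathbb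 R^d)$ for the inner product $\langle\varphi,\psi\rangle_{\mathcal H}=\int\mathcal F\varphi\,\overline{\mathcal F\psi}\,d\mu$, let $\mathcal H_T=L^2([0,T];\mathcal H)$, and for $N>0$ let $\mathcal H_T^N=\{h\in\mathcal H_T:\|h\|_{\mathcal H_T}\le N\}$ with the weak topology of $\mathcal H_T$. Assume: (C) $\sigma,b:\mathbb R\to\mathbb R$ are Lipschitz; ($H^{\underline\alpha}_\eta$) $\eta\in(0,1]$ and $\int_{\mathbb R^d}\big(1+\sum_i|\xi_i|^{\alpha_i}\big)^{-\eta}\mu(d\xi)<\infty$; (D) $b$ is differentiable and $b'$ is Lipschitz. Then there are a unique bounded measurable $u^0:[0,T]\times\mathbb R^d\to\mathbb R$ with $u^0(t,x)=\int_0^t[G_{t-s}*b(u^0(s,\cdot))](x)\,ds$ for all $(t,x)$, and, for each $h\in\mathcal H_T$, a unique bounded measurable solution $Z^h:[0,T]\times\mathbb R^d\to\mathbb R$ of the skeleton equation $$Z^h(t,x)=\int_0^t\big\langle G_{t-s}(x-\cdot)\,\sigma(u^0(s,\cdot)),h(s)\big\rangle_{\mathcal H}\,ds+\int_0^t\big[G_{t-s}*\big(b'(u^0(s,\cdot))Z^h(s,\cdot)\big)\big](x)\,ds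 .$$ Let $K\subset\mathbb R^d$ be compact, $0<\beta_1<(1-\eta)/2$ and $0<\beta_2<\alpha_0(1-\eta)/2$. Let $\mathcal E^\beta([0,T]\times K)$ be the space of functions $f:[0,T]\times K\to\mathbb R$ of finite norm $$\|f\|_{\beta,K}=\sup_{(t,x)}|f(t,x)|+\sup_{(t,x)\ne(s,y)}\frac{|f(t,x)-f(s,y)|}{|t-s|^{\beta_1}+|x-y|^{\beta_2}}$$ for which the supremum of these quotients over $0<|t-s|+|x-y|<\rho$ tends to $0$ as $\rho\to0^+$, with this norm. Then $Z^h|_{[0,T]\times K}\in\mathcal E^\beta([0,T]\times K)$ for every $h\in\mathcal H_T$ and, for every $N>0$, the map $h\mapsto Z^h|_{[0,T]\times K}$ from $\mathcal H_T^N$ with the weak topology to $\mathcal E^\beta([0,T]\times K)$ is continuous. Consequently the set $\{Z^h|_{[0,T]\times K}:h\in\mathcal H_T^N\}$ is compact in $\mathcal E^\beta([0,T]\times K)$. -/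

import Mathlib

open MeasureTheory Set Filter Topology
open scoped SchwartzMap FourierTransform NNReal ENNReal

noncomputable section

namespace FracHeat

/-- The space `ℝ^d` with its Euclidean norm. -/
abbrev Space (d : ℕ) : Type := EuclideanSpace ℝ (Fin d)

/-! ### The Green function -/

/-- The fundamental solution of the one-dimensional equation `∂ₜ u = D_δ^α u`:
`(1 / 2π) ∫ exp (- i z x - t |z|^α exp (- i δ (π / 2) sgn z)) dz`.
The integral is real, since `z ↦ -z` conjugates the integrand. -/
def greenOne (α δ t x : ℝ) : ℝ :=
  1 / (2 * Real.pi) *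
    (∫ z : ℝ, Complex.exp (-(Complex.I * z * x) -
      t * ((|z| ^ α : ℝ) : ℂ) *
        Complex.exp (-(Complex.I * δ * (Real.pi / 2) * (Real.sign z : ℂ))))).re

/-- The Green function of `∂ₜ u = ∑ᵢ D_{δᵢ}^{αᵢ} u` on `ℝ^d`. -/
def green {d : ℕ} (α δ : Fin d → ℝ) (t : ℝ) (x : Space d) : ℝ :=
  ∏ i, greenOne (α i) (δ i) t (x i)

/-! ### The Hilbert space of the spatial covariance -/

/-- The Fourier transform `ℱ f (ξ) = ∫ exp (- i ⟨x, ξ⟩) f x dx`. -/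
def fourierT {d : ℕ} (f : Space d → ℂ) (ξ : Space d) : ℂ :=
  ∫ x, Complex.exp (-(Complex.I * (inner ℝ x ξ : ℝ))) * f x

/-- `μ` is the spectral measure of `Γ`, that is `μ = ℱ⁻¹ Γ` as tempered distributions. -/
def IsSpectralMeasure {d : ℕ} (Γ μ : Measure (Space d)) : Prop :=
  ∀ φ : 𝓢(Space d, ℂ), ∫ x, φ x ∂Γ = ∫ ξ, fourierT φ ξ ∂μ

theorem fourierT_eq {d : ℕ} (f : Space d → ℂ) (ξ : Space d) :
    fourierT f ξ = 𝓕 f ((2 * Real.pi)⁻¹ • ξ) := by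
  rw [Real.fourier_eq', fourierT]
  congr 1
  ext x
  have h : (-2 * Real.pi * inner ℝ x ((2 * Real.pi)⁻¹ • ξ) : ℝ) = - inner ℝ x ξ := by
    rw [inner_smul_right]
    field_simp
  rw [h, smul_eq_mul]
  congr 2
  push_cast
  ring

/-- For a real Schwartz function `φ` the function `ℱ φ` is square integrable with respect to
every tempered measure. -/
theorem memLp_fourierT {d : ℕ} (μ : Measure (Space d)) [μ.HasTemperateGrowth]
    (φ : 𝓢(Space d, ℝ)) : MemLp (fourierT fun x => (φ x : ℂ)) 2 μ := by
  let e : Space d ≃L[ℝ] Space d :=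
    ContinuousLinearEquiv.smulLeft (Units.mk0 ((2 * Real.pi)⁻¹ : ℝ) (by positivity))
  let ψ : 𝓢(Space d, ℂ) :=
    SchwartzMap.compCLMOfContinuousLinearEquiv ℂ e
      (𝓕 (φ.postcompCLM (𝕜 := ℝ) Complex.ofRealCLM) : 𝓢(Space d, ℂ))
  have h : (fourierT fun x => (φ x : ℂ)) = ψ := by
    ext ξ
    rw [fourierT_eq]
    rfl
  rw [h]
  exact ψ.memLp 2 μ

/-- The map `φ ↦ ℱ φ` from the real Schwartz functions to `L²(μ; ℂ)`, seen as a real vector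
space. The pull-back of the inner product is `⟨φ, ψ⟩_ℋ = ∫ ℱ φ (ξ) conj (ℱ ψ (ξ)) μ(dξ)`. -/
def schwartzEmbed {d : ℕ} (μ : Measure (Space d)) [μ.HasTemperateGrowth] :
    𝓢(Space d, ℝ) →ₗ[ℝ] Lp ℂ 2 μ where
  toFun φ := (memLp_fourierT μ φ).toLp
  map_add' φ ψ := by
    rw [← MemLp.toLp_add]
    congr 1
    ext ξ
    have hi : ∀ χ : 𝓢(Space d, ℝ), Integrable fun x =>
        Complex.exp (-(Complex.I * (inner ℝ x ξ : ℝ))) * (χ x : ℂ) := by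
      intro χ
      refine χ.integrable.ofReal.bdd_mul (c := 1) (by fun_prop) (ae_of_all _ fun x => ?_)
      rw [Complex.norm_exp]
      simp
    simp only [fourierT, Pi.add_apply]
    rw [← integral_add (hi φ) (hi ψ)]
    congr 1
    ext x
    simp [mul_add]
  map_smul' c φ := by
    rw [RingHom.id_apply, ← MemLp.toLp_const_smul]
    congr 1
    ext ξ
    simp only [fourierT, Pi.smul_apply]
    rw [← integral_smul]
    congr 1
    ext x
    simp only [smul_apply, smul_eq_mul, Complex.ofReal_mul, Complex.real_smul]
    ring

/-- The Hilbert space `ℋ`: the completion of the real Schwartz functions for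
`⟨φ, ψ⟩_ℋ = ∫ ℱ φ (ξ) conj (ℱ ψ (ξ)) μ(dξ)`, realised as the closure of their image
under the isometric map `φ ↦ ℱ φ` into `L²(μ; ℂ)`. -/
def covSubspace {d : ℕ} (μ : Measure (Space d)) [μ.HasTemperateGrowth] :
    Submodule ℝ (Lp ℂ 2 μ) :=
  (LinearMap.range (schwartzEmbed μ)).topologicalClosure

/-- The type of the elements of `ℋ`, a real Hilbert space. -/
abbrev CovSpace {d : ℕ} (μ : Measure (Space d)) [μ.HasTemperateGrowth] : Type :=
  covSubspace μ

/-- The Hilbert space `ℋ_T = L²([0,T]; ℋ)`. -/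
abbrev ControlSpace {d : ℕ} (μ : Measure (Space d)) [μ.HasTemperateGrowth] (T : ℝ) : Type :=
  Lp (CovSpace μ) 2 (volume.restrict (Icc 0 T))

/-- `f` is an integrable function with `ℱ f ∈ L²(μ)`, so that it defines an element of `ℋ`. -/
def HasCovNorm {d : ℕ} (μ : Measure (Space d)) (f : Space d → ℝ) : Prop :=
  Integrable f ∧ MemLp (fourierT fun x => (f x : ℂ)) 2 μ

open Classical in
/-- The inner product `⟨f, k⟩_ℋ` of (the element of `ℋ` given by) a function `f`, for which
`HasCovNorm μ f` holds, with an element `k` of `ℋ`: the inner product of `ℱ f` and `k` in the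
real Hilbert space `L²(μ; ℂ)`. -/
def covPairing {d : ℕ} (μ : Measure (Space d)) [μ.HasTemperateGrowth]
    (f : Space d → ℝ) (k : CovSpace μ) : ℝ :=
  if hf : HasCovNorm μ f then inner ℝ hf.2.toLp (k : Lp ℂ 2 μ) else 0

/-! ### The deterministic equation and the skeleton equation -/

/-- `u` is a bounded measurable function on `[0,T] × ℝ^d`. -/
def BoundedMeasurable {d : ℕ} (T : ℝ) (u : ℝ → Space d → ℝ) : Prop :=
  Measurable (fun p : Icc (0 : ℝ) T × Space d => u p.1 p.2) ∧
    ∃ C, ∀ t ∈ Icc 0 T, ∀ x, |u t x| ≤ C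

/-- `∫₀ᵗ [G(t-s) ∗ v(s, ·)](x) ds`. -/
def duhamel {d : ℕ} (α δ : Fin d → ℝ) (v : ℝ → Space d → ℝ) (t : ℝ) (x : Space d) : ℝ :=
  ∫ s in (0 : ℝ)..t, ∫ y, green α δ (t - s) (x - y) * v s y

/-- `u` is the mild solution on `[0,T] × ℝ^d` of `∂ₜ u = D u + b(u)`, `u(0, ·) = 0`. -/
structure IsDeterministicSolution {d : ℕ} (α δ : Fin d → ℝ) (b : ℝ → ℝ) (T : ℝ)
    (u : ℝ → Space d → ℝ) : Prop where
  bounded : BoundedMeasurable T u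
  eq : ∀ t ∈ Icc 0 T, ∀ x, u t x = duhamel α δ (fun s y => b (u s y)) t x

/-- The function `y ↦ G(t-s, x-y) σ(u(s,y))`. -/
def kernelFun {d : ℕ} (α δ : Fin d → ℝ) (σ : ℝ → ℝ) (u : ℝ → Space d → ℝ)
    (t : ℝ) (x : Space d) (s : ℝ) (y : Space d) : ℝ :=
  green α δ (t - s) (x - y) * σ (u s y)

/-- `Z` solves on `[0,T] × ℝ^d` the skeleton equation driven by `h ∈ ℋ_T`:
`Z(t,x) = ∫₀ᵗ ⟨G(t-s, x-⋆) σ(u⁰(s,⋆)), h(s,⋆)⟩_ℋ ds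
  + ∫₀ᵗ [G(t-s) ∗ (b'(u⁰(s,⋆)) Z(s,⋆))](x) ds`,
where the terms of the first integral are well defined. -/
structure IsSkeletonSolution {d : ℕ} (α δ : Fin d → ℝ) (μ : Measure (Space d))
    [μ.HasTemperateGrowth] (σ b : ℝ → ℝ) (T : ℝ) (u₀ : ℝ → Space d → ℝ)
    (h : ControlSpace μ T) (Z : ℝ → Space d → ℝ) : Prop where
  bounded : BoundedMeasurable T Z
  covNorm : ∀ t ∈ Icc 0 T, ∀ x, ∀ᵐ s, s ∈ Ioo 0 t → HasCovNorm μ (kernelFun α δ σ u₀ t x s)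
  integrable : ∀ t ∈ Icc 0 T, ∀ x, IntervalIntegrable
    (fun s => covPairing μ (kernelFun α δ σ u₀ t x s) (h s)) volume 0 t
  eq : ∀ t ∈ Icc 0 T, ∀ x, Z t x =
    (∫ s in (0 : ℝ)..t, covPairing μ (kernelFun α δ σ u₀ t x s) (h s)) +
      duhamel α δ (fun s y => deriv b (u₀ s y) * Z s y) t x

/-! ### The Hölder space -/

section Holder

variable {d : ℕ} {T : ℝ} {K : Set (Space d)} {β₁ β₂ : ℝ}

/-- `|t - s|^β₁ + |x - y|^β₂`. -/
def holderGauge (β₁ β₂ : ℝ) (p q : Icc (0 : ℝ) T × K) : ℝ :=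
  |(p.1 : ℝ) - q.1| ^ β₁ + ‖(p.2 : Space d) - q.2‖ ^ β₂

/-- `|f(t,x) - f(s,y)| / (|t - s|^β₁ + |x - y|^β₂)`. -/
def holderQuot (β₁ β₂ : ℝ) (f : Icc (0 : ℝ) T × K → ℝ)
    (p q : Icc (0 : ℝ) T × K) : ℝ :=
  |f p - f q| / holderGauge β₁ β₂ p q

/-- The Hölder norm: the sum of the suprema of `|f|` and of the Hölder quotients over pairs of
distinct points. -/
def holderNorm (β₁ β₂ : ℝ) (f : Icc (0 : ℝ) T × K → ℝ) : ℝ :=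
  (⨆ p, |f p|) +
    ⨆ pq : {pq : (Icc (0 : ℝ) T × K) × (Icc (0 : ℝ) T × K) // pq.1 ≠ pq.2},
      holderQuot β₁ β₂ f pq.1.1 pq.1.2

/-- Membership in the separable Hölder space: the two suprema of the Hölder norm are finite,
and the Hölder quotients tend to `0` uniformly as `|t - s| + |x - y| → 0`. -/
structure IsLittleHolder (β₁ β₂ : ℝ) (f : Icc (0 : ℝ) T × K → ℝ) : Prop where
  bdd : ∃ C, ∀ p, |f p| ≤ C
  holder : ∃ C, ∀ p q, p ≠ q → holderQuot β₁ β₂ f p q ≤ C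
  little : ∀ ε > 0, ∃ ρ > 0, ∀ p q : Icc (0 : ℝ) T × K, p ≠ q →
    |(p.1 : ℝ) - q.1| + ‖(p.2 : Space d) - q.2‖ < ρ → holderQuot β₁ β₂ f p q ≤ ε

theorem holderGauge_nonneg (p q : Icc (0 : ℝ) T × K) : 0 ≤ holderGauge β₁ β₂ p q := by
  unfold holderGauge
  positivity

theorem holderQuot_nonneg (f : Icc (0 : ℝ) T × K → ℝ) (p q : Icc (0 : ℝ) T × K) :
    0 ≤ holderQuot β₁ β₂ f p q :=
  div_nonneg (abs_nonneg _) (holderGauge_nonneg p q)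

theorem holderQuot_add (f g : Icc (0 : ℝ) T × K → ℝ) (p q : Icc (0 : ℝ) T × K) :
    holderQuot β₁ β₂ (f + g) p q ≤ holderQuot β₁ β₂ f p q + holderQuot β₁ β₂ g p q := by
  unfold holderQuot
  rw [← add_div]
  refine div_le_div_of_nonneg_right ?_ (holderGauge_nonneg p q)
  have h : (f + g) p - (f + g) q = (f p - f q) + (g p - g q) := by
    simp only [Pi.add_apply]
    ring
  rw [h]
  exact abs_add_le _ _

theorem holderQuot_smul (c : ℝ) (f : Icc (0 : ℝ) T × K → ℝ) (p q : Icc (0 : ℝ) T × K) :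
    holderQuot β₁ β₂ (c • f) p q = |c| * holderQuot β₁ β₂ f p q := by
  unfold holderQuot
  rw [← mul_div_assoc, ← abs_mul, mul_sub]
  rfl

/-- The functions of the separable Hölder space form a vector space. -/
def holderSubmodule (T : ℝ) (K : Set (Space d)) (β₁ β₂ : ℝ) :
    Submodule ℝ (Icc (0 : ℝ) T × K → ℝ) where
  carrier := {f | IsLittleHolder β₁ β₂ f}
  zero_mem' := ⟨⟨0, by simp⟩, ⟨0, by simp [holderQuot]⟩,
    fun ε hε => ⟨1, one_pos, by simp [holderQuot, hε.le]⟩⟩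
  add_mem' := by
    rintro f g ⟨⟨A, hA⟩, ⟨B, hB⟩, hf⟩ ⟨⟨A', hA'⟩, ⟨B', hB'⟩, hg⟩
    refine ⟨⟨A + A', fun p => (abs_add_le _ _).trans (add_le_add (hA p) (hA' p))⟩,
      ⟨B + B', fun p q h => (holderQuot_add f g p q).trans (add_le_add (hB p q h) (hB' p q h))⟩,
      fun ε hε => ?_⟩
    obtain ⟨r, hr, h1⟩ := hf (ε / 2) (half_pos hε)
    obtain ⟨r', hr', h2⟩ := hg (ε / 2) (half_pos hε)
    refine ⟨min r r', lt_min hr hr', fun p q h hpq => ?_⟩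
    have e1 := h1 p q h (hpq.trans_le (min_le_left _ _))
    have e2 := h2 p q h (hpq.trans_le (min_le_right _ _))
    linarith [holderQuot_add (β₁ := β₁) (β₂ := β₂) f g p q]
  smul_mem' := by
    rintro c f ⟨⟨A, hA⟩, ⟨B, hB⟩, hf⟩
    refine ⟨⟨|c| * A, fun p => ?_⟩, ⟨|c| * B, fun p q h => ?_⟩, fun ε hε => ?_⟩
    · rw [Pi.smul_apply, smul_eq_mul, abs_mul]
      exact mul_le_mul_of_nonneg_left (hA p) (abs_nonneg c)
    · rw [holderQuot_smul]
      exact mul_le_mul_of_nonneg_left (hB p q h) (abs_nonneg c)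
    · obtain ⟨r, hr, h1⟩ := hf (ε / (|c| + 1)) (by positivity)
      refine ⟨r, hr, fun p q h hpq => ?_⟩
      rw [holderQuot_smul]
      have e := h1 p q h hpq
      rw [le_div_iff₀ (by positivity)] at e
      nlinarith [holderQuot_nonneg (β₁ := β₁) (β₂ := β₂) f p q]

/-- The separable Hölder space `E^β([0,T] × K)`, `β = (β₁, β₂)`. -/
def HolderSpace (T : ℝ) (K : Set (Space d)) (β₁ β₂ : ℝ) : Type :=
  holderSubmodule T K β₁ β₂

instance : AddCommGroup (HolderSpace T K β₁ β₂) :=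
  inferInstanceAs (AddCommGroup (holderSubmodule T K β₁ β₂))

instance : Module ℝ (HolderSpace T K β₁ β₂) :=
  inferInstanceAs (Module ℝ (holderSubmodule T K β₁ β₂))

/-- The function underlying an element of the Hölder space. -/
def HolderSpace.val (f : HolderSpace T K β₁ β₂) : Icc (0 : ℝ) T × K → ℝ := f.1

instance : Norm (HolderSpace T K β₁ β₂) := ⟨fun f => holderNorm β₁ β₂ f.val⟩

theorem HolderSpace.bdd_sup (f : HolderSpace T K β₁ β₂) :
    BddAbove (range fun p => |f.val p|) := by
  obtain ⟨C, hC⟩ := f.2.bdd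
  exact ⟨C, by rintro _ ⟨p, rfl⟩; exact hC p⟩

theorem HolderSpace.bdd_quot (f : HolderSpace T K β₁ β₂) :
    BddAbove (range fun pq : {pq : (Icc (0 : ℝ) T × K) × (Icc (0 : ℝ) T × K) //
      pq.1 ≠ pq.2} => holderQuot β₁ β₂ f.val pq.1.1 pq.1.2) := by
  obtain ⟨C, hC⟩ := f.2.holder
  exact ⟨C, by rintro _ ⟨pq, rfl⟩; exact hC _ _ pq.2⟩

theorem HolderSpace.normCore : NormedSpace.Core ℝ (HolderSpace T K β₁ β₂) where
  norm_nonneg f := add_nonneg (Real.iSup_nonneg fun _ => abs_nonneg _)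
    (Real.iSup_nonneg fun _ => holderQuot_nonneg _ _ _)
  norm_smul c f := by
    change holderNorm β₁ β₂ (c • f.val) = ‖c‖ * holderNorm β₁ β₂ f.val
    unfold holderNorm
    rw [mul_add, Real.mul_iSup_of_nonneg (norm_nonneg c), Real.mul_iSup_of_nonneg (norm_nonneg c)]
    congr 1
    · congr 1
      ext p
      simp [abs_mul]
    · congr 1
      ext pq
      rw [holderQuot_smul, Real.norm_eq_abs]
  norm_triangle f g := by
    change holderNorm β₁ β₂ (f.val + g.val) ≤ holderNorm β₁ β₂ f.val + holderNorm β₁ β₂ g.val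
    unfold holderNorm
    rw [add_add_add_comm]
    refine add_le_add ?_ ?_
    · refine Real.iSup_le (fun p => ?_) (add_nonneg (Real.iSup_nonneg fun _ => abs_nonneg _)
        (Real.iSup_nonneg fun _ => abs_nonneg _))
      exact (abs_add_le _ _).trans (add_le_add (le_ciSup f.bdd_sup p) (le_ciSup g.bdd_sup p))
    · refine Real.iSup_le (fun pq => ?_)
        (add_nonneg (Real.iSup_nonneg fun _ => holderQuot_nonneg _ _ _)
          (Real.iSup_nonneg fun _ => holderQuot_nonneg _ _ _))
      exact (holderQuot_add _ _ _ _).trans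
        (add_le_add (le_ciSup f.bdd_quot pq) (le_ciSup g.bdd_quot pq))
  norm_eq_zero_iff f := by
    constructor
    · intro h
      change holderNorm β₁ β₂ f.val = 0 at h
      unfold holderNorm at h
      have h2 : (0 : ℝ) ≤ ⨆ pq : {pq : (Icc (0 : ℝ) T × K) × (Icc (0 : ℝ) T × K) //
          pq.1 ≠ pq.2}, holderQuot β₁ β₂ f.val pq.1.1 pq.1.2 :=
        Real.iSup_nonneg fun _ => holderQuot_nonneg _ _ _
      apply Subtype.ext
      funext p
      have h1 : |f.val p| ≤ ⨆ p, |f.val p| := le_ciSup f.bdd_sup p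
      have h3 : |f.val p| ≤ 0 := by linarith
      exact abs_nonpos_iff.mp h3
    · rintro rfl
      change holderNorm β₁ β₂ (0 : Icc (0 : ℝ) T × K → ℝ) = 0
      simp [holderNorm, holderQuot]

instance : NormedAddCommGroup (HolderSpace T K β₁ β₂) :=
  NormedAddCommGroup.ofCore (𝕜 := ℝ) HolderSpace.normCore

end Holder

/-- The ball `ℋ_T^N` of `ℋ_T`, as a subset of `ℋ_T` with the weak topology. -/
def weakBall {d : ℕ} (μ : Measure (Space d)) [μ.HasTemperateGrowth] (T N : ℝ) :
    Set (WeakSpace ℝ (ControlSpace μ T)) :=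
  {w | ‖(toWeakSpace ℝ (ControlSpace μ T)).symm w‖ ≤ N}

end FracHeat

end

/-!
The Fourier multiplier `exp (-t Ψ)` of the semigroup equals `1` at frequency `0`, that is, the Green
function has total mass one. Therefore the deterministic solution does not depend on the space
variable: `u⁰(t, x) = f(t)`, where `f` solves the ordinary differential equation `f' = b(f)`,
`f(0) = 0`. Hence the skeleton equation has coefficients depending on time only, and variation of
constants together with the semigroup property `G_τ ∗ G_r = G_{τ+r}` gives its solution in closed
form (`isSkeletonSolution_exp_mul`):
`Z^h(t, x) = exp (A t) ∫₀ᵗ exp (-A s) σ(f s) ⟨G_{t-s}(x - ⋆), h(s)⟩ ds`, `A t = ∫₀ᵗ b'(f s) ds`.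
In particular `Z^h(t, x)` is a continuous linear functional of `h`.

Uniqueness for both equations is an iterated Volterra estimate (`eq_zero_of_abs_le_integral`) and
needs only that `G_t` is in `L¹`, with a norm independent of `t`. By self-similarity this reduces to
the one-dimensional Green function at time one. There the amplitude `exp (-c z ^ α)` on the
half-line is integrated by parts once, and a second time away from the origin, which gives
`1 / (i x)` plus a remainder of size `|x| ^ (-1 - ε)`; the leading term is purely imaginary and
disappears in the real part (`exists_integral_exp_mul_halfExp`, `integrable_greenOne_one`). No
positivity of the Green function is used.

The Hölder regularity is computed on the Fourier side. The function `G_τ(x - ⋆)` has Fourier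
transform `exp (-i ⟨x, ξ⟩) exp (-τ Ψ(ξ))`, and the real part of `Ψ` is comparable with
`S(ξ) = ∑ᵢ |ξᵢ| ^ αᵢ` because `|δᵢ| < 1`. At each frequency, the squared increments of the kernel,
integrated in time, are bounded by `|t - t'| ^ (1 - η) (1 + S) ^ (-η)` and
`|x - y| ^ (a (1 - η)) (1 + S) ^ (-η)`, `a = minᵢ αᵢ`; the assumption on `μ` makes these integrable
(`exists_lintegral_kerLp_time_le`, `exists_lintegral_kerLp_space_le`). By the Cauchy-Schwarz
inequality the functionals `h ↦ Z^h(t, x)` are Hölder continuous in `(t, x)`, in operator norm, with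
the exponents `(1 - η) / 2` and `a (1 - η) / 2` (`exists_functional`).

Finally, weak convergence in a ball makes these functionals converge at each point, hence uniformly
on the compact set `[0, T] × K` by equicontinuity. As `β₁` and `β₂` are strictly smaller than the
exponents above, interpolation turns uniform convergence into convergence in the Hölder space
(`exists_holderSpace_map`), and compactness of the image follows from weak compactness of balls in
a Hilbert space.
-/

noncomputable section

namespace FracHeat

/-! ### Oscillatory integrals on a half-line -/

theorem exists_rpow_mul_exp_neg_le {p κ : ℝ} (hp : 0 ≤ p) (hκ : 0 < κ) :
    ∃ C, 0 ≤ C ∧ ∀ u : ℝ, 0 ≤ u → u ^ p * Real.exp (-(κ * u)) ≤ C := by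
  set n := ⌈p⌉₊
  have hn : p ≤ (n : ℝ) := Nat.le_ceil p
  refine ⟨1 + n.factorial / κ ^ n, by positivity, fun u hu => ?_⟩
  have h1 : u ^ p ≤ 1 + u ^ n := by
    rcases le_total u 1 with h | h
    · have := Real.rpow_le_one hu h hp
      have := pow_nonneg hu n
      linarith
    · have := Real.rpow_le_rpow_of_exponent_le h hn
      rw [Real.rpow_natCast] at this
      linarith
  have h2 : (κ * u) ^ n / n.factorial ≤ Real.exp (κ * u) :=
    Real.pow_div_factorial_le_exp _ (by positivity) n
  have h3 : u ^ n ≤ n.factorial / κ ^ n * Real.exp (κ * u) := by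
    rw [div_le_iff₀ (by positivity), mul_pow] at h2
    rw [div_mul_eq_mul_div, le_div_iff₀ (by positivity)]
    linarith
  have h4 : 1 ≤ Real.exp (κ * u) := Real.one_le_exp (by positivity)
  rw [Real.exp_neg, ← div_eq_mul_inv, div_le_iff₀ (Real.exp_pos _), add_mul, one_mul]
  linarith

theorem norm_exp_neg_I_mul (z x : ℝ) : ‖Complex.exp (-(Complex.I * z * x))‖ = 1 := by
  rw [Complex.norm_exp]
  simp

theorem hasDerivAt_exp_neg_I_mul (x z : ℝ) :
    HasDerivAt (fun z : ℝ => Complex.exp (-(Complex.I * z * x)))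
      (Complex.exp (-(Complex.I * z * x)) * -(Complex.I * x)) z := by
  have h : HasDerivAt (fun z : ℝ => -(Complex.I * z * x)) (-(Complex.I * x)) z := by
    have := ((Complex.ofRealCLM.hasDerivAt (x := z)).const_mul Complex.I).mul_const (x : ℂ)
    simpa using this.fun_neg
  exact h.cexp

/-- Integration by parts against `exp (-i z x)` on a half-line, for an amplitude vanishing at
infinity. -/
theorem I_mul_integral_exp_mul {F F' : ℝ → ℂ} {a : ℝ} (x : ℝ)
    (hc : ContinuousWithinAt F (Ici a) a)
    (hF : ∀ z ∈ Ioi a, HasDerivAt F (F' z) z) (hi : IntegrableOn F (Ioi a))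
    (hi' : IntegrableOn F' (Ioi a)) (h0 : Tendsto F atTop (𝓝 0)) :
    Complex.I * x * ∫ z in Ioi a, Complex.exp (-(Complex.I * z * x)) * F z =
      Complex.exp (-(Complex.I * a * x)) * F a +
        ∫ z in Ioi a, Complex.exp (-(Complex.I * z * x)) * F' z := by
  have hb : ∀ {G : ℝ → ℂ}, IntegrableOn G (Ioi a) →
      IntegrableOn (fun z : ℝ => Complex.exp (-(Complex.I * z * x)) * G z) (Ioi a) := by
    intro G hG
    refine Integrable.bdd_mul (c := 1) hG (by fun_prop) (ae_of_all _ fun z => ?_)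
    rw [norm_exp_neg_I_mul]
  have key := integral_Ioi_of_hasDerivAt_of_tendsto (a := a) (m := (0 : ℂ))
    (f := fun z : ℝ => Complex.exp (-(Complex.I * z * x)) * F z)
    (f' := fun z : ℝ => Complex.exp (-(Complex.I * z * x)) * -(Complex.I * x) * F z +
      Complex.exp (-(Complex.I * z * x)) * F' z)
    ((hasDerivAt_exp_neg_I_mul x a).continuousAt.continuousWithinAt.mul hc)
    (fun z hz => (hasDerivAt_exp_neg_I_mul x z).mul (hF z hz))
    (by
      refine Integrable.add ?_ (hb hi')
      refine ((hb hi).const_mul (-(Complex.I * x))).congr (ae_of_all _ fun z => ?_)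
      ring)
    (by
      rw [tendsto_zero_iff_norm_tendsto_zero] at h0 ⊢
      refine h0.congr fun z => ?_
      rw [norm_mul, norm_exp_neg_I_mul, one_mul])
  rw [integral_add (((hb hi).const_mul (-(Complex.I * x))).congr
    (ae_of_all _ fun z => by ring)) (hb hi')] at key
  have e : ∫ z in Ioi a, Complex.exp (-(Complex.I * z * x)) * -(Complex.I * x) * F z =
      -(Complex.I * x) * ∫ z in Ioi a, Complex.exp (-(Complex.I * z * x)) * F z := by
    rw [← integral_const_mul]
    congr 1
    ext z
    ring
  rw [e] at key
  linear_combination -key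

/-- Decay of an oscillatory integral whose amplitude has a singularity `z ^ (ε - 1)` at the
origin. -/
theorem norm_integral_exp_mul_le {F F' : ℝ → ℂ} {C ε x : ℝ} (hε : 0 < ε) (hε1 : ε < 1)
    (hF : ∀ z ∈ Ioi (0 : ℝ), HasDerivAt F (F' z) z) (hm : ContinuousOn F' (Ioi 0))
    (hb : ∀ z ∈ Ioi (0 : ℝ), ‖F z‖ ≤ C * z ^ (ε - 1))
    (hb' : ∀ z ∈ Ioi (0 : ℝ), ‖F' z‖ ≤ C * z ^ (ε - 2))
    (hi : IntegrableOn F (Ioi 0)) (hx : x ≠ 0) :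
    ‖∫ z in Ioi (0 : ℝ), Complex.exp (-(Complex.I * z * x)) * F z‖ ≤
      C * (1 / ε + 1 + 1 / (1 - ε)) * |x| ^ (-ε) := by
  -- The two regimes meet where the phase has made about one turn.
  set a : ℝ := |x|⁻¹ with ha_def
  have hx' : 0 < |x| := abs_pos.mpr hx
  have ha : 0 < a := inv_pos.mpr hx'
  have hae : ∀ p : ℝ, a ^ p = |x| ^ (-p) := fun p => by
    rw [ha_def, Real.inv_rpow hx'.le, Real.rpow_neg hx'.le]
  set G : ℝ → ℂ := fun z => Complex.exp (-(Complex.I * z * x)) * F z with hG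
  have hGi : IntegrableOn G (Ioi 0) := by
    refine Integrable.bdd_mul (c := 1) hi (by fun_prop) (ae_of_all _ fun z => ?_)
    rw [norm_exp_neg_I_mul]
  have hsub : Ioi a ⊆ Ioi (0 : ℝ) := Ioi_subset_Ioi ha.le
  have hsplit : ∫ z in Ioi (0 : ℝ), G z = (∫ z in Ioc 0 a, G z) + ∫ z in Ioi a, G z := by
    rw [← setIntegral_union (by
      rw [Set.disjoint_left]
      intro z hz hz'
      exact absurd hz.2 (not_le.mpr hz')) measurableSet_Ioi
      (hGi.mono_set Ioc_subset_Ioi_self) (hGi.mono_set hsub), Ioc_union_Ioi_eq_Ioi ha.le]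
  have hC : 0 ≤ C := by
    have := (norm_nonneg _).trans (hb 1 (by simp))
    simpa using this
  have near : ‖∫ z in Ioc 0 a, G z‖ ≤ C * (1 / ε) * |x| ^ (-ε) := by
    have h1 : ‖∫ z in Ioc 0 a, G z‖ ≤ ∫ z in Ioc 0 a, C * z ^ (ε - 1) := by
      refine norm_integral_le_of_norm_le ?_ ?_
      · have := (intervalIntegral.intervalIntegrable_rpow' (a := 0) (b := a)
          (r := ε - 1) (by linarith)).const_mul C
        exact (intervalIntegrable_iff_integrableOn_Ioc_of_le ha.le).mp this
      · refine (ae_restrict_iff' measurableSet_Ioc).mpr (ae_of_all _ fun z hz => ?_)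
        rw [hG, norm_mul, norm_exp_neg_I_mul, one_mul]
        exact hb z hz.1
    refine h1.trans_eq ?_
    rw [← intervalIntegral.integral_of_le ha.le, intervalIntegral.integral_const_mul,
      integral_rpow (Or.inl (by linarith)), sub_add_cancel, Real.zero_rpow hε.ne', hae]
    ring
  have hF'i : IntegrableOn (fun z : ℝ => C * z ^ (ε - 2)) (Ioi a) :=
    (integrableOn_Ioi_rpow_of_lt (by linarith) ha).const_mul C
  have hF'i' : IntegrableOn F' (Ioi a) := by
    refine Integrable.mono' hF'i ((hm.mono hsub).aestronglyMeasurable measurableSet_Ioi) ?_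
    exact (ae_restrict_iff' measurableSet_Ioi).mpr (ae_of_all _ fun z hz => hb' z (hsub hz))
  have hF0 : Tendsto F atTop (𝓝 0) := by
    have h : Tendsto (fun z : ℝ => C * z ^ (-(1 - ε))) atTop (𝓝 (C * 0)) :=
      (tendsto_rpow_neg_atTop (by linarith)).const_mul C
    rw [mul_zero] at h
    refine squeeze_zero_norm' ?_ h
    filter_upwards [eventually_gt_atTop 0] with z hz
    rw [neg_sub]
    exact hb z hz
  have ibp := I_mul_integral_exp_mul x (hF a ha).continuousAt.continuousWithinAt
    (fun z hz => hF z (hsub hz)) (hi.mono_set hsub) hF'i' hF0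
  have far : ‖∫ z in Ioi a, G z‖ ≤ C * (1 + 1 / (1 - ε)) * |x| ^ (-ε) := by
    have h1 : |x| * ‖∫ z in Ioi a, G z‖ ≤ C * a ^ (ε - 1) + C * (a ^ (ε - 1) / (1 - ε)) := by
      have := congrArg norm ibp
      rw [norm_mul, norm_mul, Complex.norm_I, one_mul, Complex.norm_real, Real.norm_eq_abs] at this
      rw [this]
      refine (norm_add_le _ _).trans (add_le_add ?_ ?_)
      · rw [norm_mul, norm_exp_neg_I_mul, one_mul]
        exact hb a ha
      · have h2 : ‖∫ z in Ioi a, Complex.exp (-(Complex.I * z * x)) * F' z‖ ≤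
            ∫ z in Ioi a, C * z ^ (ε - 2) := by
          refine norm_integral_le_of_norm_le hF'i ?_
          refine (ae_restrict_iff' measurableSet_Ioi).mpr (ae_of_all _ fun z hz => ?_)
          rw [norm_mul, norm_exp_neg_I_mul, one_mul]
          exact hb' z (hsub hz)
        refine h2.trans_eq ?_
        rw [integral_const_mul, integral_Ioi_rpow_of_lt (by linarith) ha]
        have : ε - 2 + 1 = -(1 - ε) := by ring
        rw [this, neg_div_neg_eq, neg_sub]
    have h2 : a ^ (ε - 1) = |x| * |x| ^ (-ε) := by
      rw [hae, neg_sub, sub_eq_add_neg, Real.rpow_add hx', Real.rpow_one]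
    rw [h2] at h1
    refine le_of_mul_le_mul_left (h1.trans_eq ?_) hx'
    ring
  calc _ = ‖(∫ z in Ioc 0 a, G z) + ∫ z in Ioi a, G z‖ := by rw [← hsplit]
    _ ≤ _ := norm_add_le _ _
    _ ≤ _ := add_le_add near far
    _ = _ := by ring

/-! ### Stretched exponentials on a half-line -/

/-- The stretched exponential `exp (-c z ^ α)`, for `z ≥ 0`. -/
def halfExp (c : ℂ) (α z : ℝ) : ℂ := Complex.exp (-(c * ((z ^ α : ℝ) : ℂ)))

theorem norm_halfExp (c : ℂ) (α z : ℝ) :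
    ‖halfExp c α z‖ = Real.exp (-(c.re * z ^ α)) := by
  rw [halfExp, Complex.norm_exp]
  simp

theorem continuous_halfExp (c : ℂ) {α : ℝ} (hα : 0 < α) : Continuous (halfExp c α) := by
  have h : Continuous fun z : ℝ => z ^ α := Real.continuous_rpow_const hα.le
  unfold halfExp
  fun_prop

/-- The derivative of `halfExp`. -/
def halfExpD (c : ℂ) (α z : ℝ) : ℂ := -(c * ((α * z ^ (α - 1) : ℝ) : ℂ)) * halfExp c α z

/-- The second derivative of `halfExp`. -/
def halfExpDD (c : ℂ) (α z : ℝ) : ℂ :=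
  (-(c * ((α * ((α - 1) * z ^ (α - 1 - 1)) : ℝ) : ℂ)) +
    (c * ((α * z ^ (α - 1) : ℝ) : ℂ)) ^ 2) * halfExp c α z

theorem hasDerivAt_halfExp (c : ℂ) (α : ℝ) {z : ℝ} (hz : 0 < z) :
    HasDerivAt (halfExp c α) (halfExpD c α z) z := by
  have h : HasDerivAt (fun z : ℝ => -(c * ((z ^ α : ℝ) : ℂ)))
      (-(c * ((α * z ^ (α - 1) : ℝ) : ℂ))) z :=
    ((Real.hasDerivAt_rpow_const (Or.inl hz.ne')).ofReal_comp.const_mul c).neg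
  have := h.cexp
  rwa [mul_comm] at this

theorem hasDerivAt_halfExpD (c : ℂ) (α : ℝ) {z : ℝ} (hz : 0 < z) :
    HasDerivAt (halfExpD c α) (halfExpDD c α z) z := by
  have h : HasDerivAt (fun z : ℝ => -(c * ((α * z ^ (α - 1) : ℝ) : ℂ)))
      (-(c * ((α * ((α - 1) * z ^ (α - 1 - 1)) : ℝ) : ℂ))) z :=
    (((Real.hasDerivAt_rpow_const (p := α - 1) (Or.inl hz.ne')).const_mul
      α).ofReal_comp.const_mul c).neg
  refine (h.mul (hasDerivAt_halfExp c α hz)).congr_deriv ?_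
  simp only [halfExpD, halfExpDD]
  ring

theorem continuousOn_halfExpDD (c : ℂ) {α : ℝ} (hα : 0 < α) :
    ContinuousOn (halfExpDD c α) (Ioi 0) := by
  have h : ∀ p : ℝ, ContinuousOn (fun z : ℝ => z ^ p) (Ioi 0) := fun p z hz =>
    (Real.continuousAt_rpow_const z p (Or.inl (ne_of_gt hz))).continuousWithinAt
  have h0 := (continuous_halfExp c hα).continuousOn (s := Ioi 0)
  have h1 := h (α - 1)
  have h2 := h (α - 1 - 1)
  unfold halfExpDD
  fun_prop

theorem integrableOn_halfExp {c : ℂ} {α : ℝ} (hα : 0 < α) (hc : 0 < c.re) :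
    IntegrableOn (halfExp c α) (Ioi 0) := by
  have h := integrableOn_rpow_mul_exp_neg_mul_rpow (s := 0) (by norm_num) hα hc
  refine Integrable.mono' h (continuous_halfExp c hα).aestronglyMeasurable ?_
  refine ae_of_all _ fun z => ?_
  rw [norm_halfExp, Real.rpow_zero, one_mul, neg_mul]

theorem norm_halfExpD_eq (c : ℂ) {α z : ℝ} (hα : 0 < α) (hz : 0 < z) :
    ‖halfExpD c α z‖ = ‖c‖ * α * (z ^ (α - 1) * Real.exp (-(c.re * z ^ α))) := by
  rw [halfExpD, norm_mul, norm_neg, norm_mul, norm_halfExp, Complex.norm_real, Real.norm_eq_abs,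
    abs_of_pos (by positivity)]
  ring

theorem integrableOn_halfExpD {c : ℂ} {α : ℝ} (hα : 0 < α) (hc : 0 < c.re) :
    IntegrableOn (halfExpD c α) (Ioi 0) := by
  have h := (integrableOn_rpow_mul_exp_neg_mul_rpow (s := α - 1) (by linarith) hα hc).const_mul
    (‖c‖ * α)
  refine Integrable.mono' h ?_ ?_
  · refine ContinuousOn.aestronglyMeasurable (fun z hz => ?_) measurableSet_Ioi
    exact (hasDerivAt_halfExpD c α hz).continuousAt.continuousWithinAt
  · refine (ae_restrict_iff' measurableSet_Ioi).mpr (ae_of_all _ fun z hz => ?_)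
    rw [norm_halfExpD_eq c hα hz, neg_mul]

/-- A power `z ^ q` times the stretched exponential is dominated by any smaller power. -/
theorem exists_rpow_mul_exp_neg_rpow_le {α q r κ : ℝ} (hα : 0 < α) (hκ : 0 < κ) (hq : r ≤ q) :
    ∃ C, 0 ≤ C ∧ ∀ z : ℝ, 0 < z → z ^ q * Real.exp (-(κ * z ^ α)) ≤ C * z ^ r := by
  obtain ⟨C, hC, h⟩ := exists_rpow_mul_exp_neg_le (p := (q - r) / α) (κ := κ)
    (div_nonneg (by linarith) hα.le) hκ
  refine ⟨C, hC, fun z hz => ?_⟩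
  have h1 := h (z ^ α) (by positivity)
  rw [← Real.rpow_mul hz.le, mul_div_cancel₀ _ hα.ne'] at h1
  have h2 : z ^ q = z ^ (q - r) * z ^ r := by rw [← Real.rpow_add hz, sub_add_cancel]
  rw [h2]
  calc _ = z ^ (q - r) * Real.exp (-(κ * z ^ α)) * z ^ r := by ring
    _ ≤ _ := mul_le_mul_of_nonneg_right h1 (by positivity)

theorem exists_halfExpD_le {c : ℂ} {α ε : ℝ} (hα : 0 < α) (hc : 0 < c.re) (hε : ε ≤ α) :
    ∃ C, 0 ≤ C ∧ ∀ z ∈ Ioi (0 : ℝ), ‖halfExpD c α z‖ ≤ C * z ^ (ε - 1) ∧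
      ‖halfExpDD c α z‖ ≤ C * z ^ (ε - 2) := by
  obtain ⟨C₁, hC₁, h₁⟩ := exists_rpow_mul_exp_neg_rpow_le (q := α - 1) (r := ε - 1) hα hc
    (by linarith)
  obtain ⟨C₂, hC₂, h₂⟩ := exists_rpow_mul_exp_neg_rpow_le (q := α - 1 - 1) (r := ε - 2) hα hc
    (by linarith)
  obtain ⟨C₃, hC₃, h₃⟩ := exists_rpow_mul_exp_neg_rpow_le (q := (α - 1) + (α - 1)) (r := ε - 2)
    hα hc (by linarith)
  refine ⟨‖c‖ * α * C₁ + (‖c‖ * (α * |α - 1|) * C₂ + (‖c‖ * α) ^ 2 * C₃), by positivity,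
    fun z hz => ?_⟩
  have hz : 0 < z := hz
  have p1 : 0 ≤ ‖c‖ * α := by positivity
  have p2 : 0 ≤ ‖c‖ * (α * |α - 1|) := by positivity
  have p3 : 0 ≤ (‖c‖ * α) ^ 2 := by positivity
  constructor
  · rw [norm_halfExpD_eq c hα hz, add_mul]
    refine (mul_le_mul_of_nonneg_left (h₁ z hz) p1).trans ?_
    have : 0 ≤ (‖c‖ * (α * |α - 1|) * C₂ + (‖c‖ * α) ^ 2 * C₃) * z ^ (ε - 1) := by positivity
    linarith
  · have e : ‖halfExpDD c α z‖ ≤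
        (‖c‖ * (α * |α - 1|) * (z ^ (α - 1 - 1) * Real.exp (-(c.re * z ^ α))) +
          (‖c‖ * α) ^ 2 * (z ^ ((α - 1) + (α - 1)) * Real.exp (-(c.re * z ^ α)))) := by
      rw [halfExpDD, norm_mul, norm_halfExp]
      refine (mul_le_mul_of_nonneg_right (norm_add_le _ _) (Real.exp_pos _).le).trans_eq ?_
      rw [norm_neg, norm_mul, norm_pow, norm_mul, Complex.norm_real, Complex.norm_real,
        Real.norm_eq_abs, Real.norm_eq_abs, abs_mul, abs_mul, abs_mul,
        abs_of_pos (Real.rpow_pos_of_pos hz (α - 1 - 1)),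
        abs_of_pos (Real.rpow_pos_of_pos hz (α - 1)), abs_of_pos hα, Real.rpow_add hz]
      ring
    refine e.trans ((add_le_add (mul_le_mul_of_nonneg_left (h₂ z hz) p2)
      (mul_le_mul_of_nonneg_left (h₃ z hz) p3)).trans ?_)
    have : 0 ≤ ‖c‖ * α * C₁ * z ^ (ε - 2) := by positivity
    linarith

/-- The Fourier transform of the stretched exponential on the half-line is `1 / (i x)` up to an
integrable tail. -/
theorem exists_integral_exp_mul_halfExp {c : ℂ} {α : ℝ} (hα : 0 < α) (hc : 0 < c.re) :
    ∃ C ε : ℝ, 0 ≤ C ∧ 0 < ε ∧ ε < 1 ∧ ∀ x : ℝ, x ≠ 0 →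
      ‖Complex.I * x * (∫ z in Ioi (0 : ℝ), Complex.exp (-(Complex.I * z * x)) * halfExp c α z)
        - 1‖ ≤ C * |x| ^ (-ε) := by
  have hm : 0 < min α 1 := lt_min hα one_pos
  have hε : 0 < min α 1 / 2 := half_pos hm
  have hε1 : min α 1 / 2 < 1 := by
    have := min_le_right α 1
    linarith
  obtain ⟨C, hC, h⟩ := exists_halfExpD_le (c := c) (ε := min α 1 / 2) hα hc
    (by have := min_le_left α 1; linarith)
  refine ⟨C * (1 / (min α 1 / 2) + 1 + 1 / (1 - min α 1 / 2)), min α 1 / 2, ?_, hε, hε1,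
    fun x hx => ?_⟩
  · have := sub_pos.mpr hε1
    positivity
  have h0 : Tendsto (halfExp c α) atTop (𝓝 0) := by
    rw [tendsto_zero_iff_norm_tendsto_zero]
    simp_rw [norm_halfExp]
    exact Real.tendsto_exp_neg_atTop_nhds_zero.comp
      ((tendsto_rpow_atTop hα).const_mul_atTop hc)
  rw [I_mul_integral_exp_mul x (continuous_halfExp c hα).continuousAt.continuousWithinAt
    (fun z hz => hasDerivAt_halfExp c α hz) (integrableOn_halfExp hα hc)
    (integrableOn_halfExpD hα hc) h0]
  have e : Complex.exp (-(Complex.I * ((0 : ℝ) : ℂ) * x)) * halfExp c α 0 = 1 := by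
    simp [halfExp, Real.zero_rpow hα.ne']
  rw [e, add_sub_cancel_left]
  exact norm_integral_exp_mul_le hε hε1 (fun z hz => hasDerivAt_halfExpD c α hz)
    (continuousOn_halfExpDD c hα) (fun z hz => (h z hz).1) (fun z hz => (h z hz).2)
    (integrableOn_halfExpD hα hc) hx

/-! ### The one-dimensional symbol -/

/-- The symbol `|z| ^ α exp (-i δ (π / 2) sgn z)` of `-D_δ^α`. -/
def symbolOne (α δ z : ℝ) : ℂ :=
  ((|z| ^ α : ℝ) : ℂ) * Complex.exp (-(Complex.I * δ * (Real.pi / 2) * (Real.sign z : ℂ)))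

/-- The Fourier multiplier `exp (-t |z| ^ α exp (-i δ (π / 2) sgn z))` of the semigroup. -/
def multOne (α δ t z : ℝ) : ℂ := Complex.exp (-(t * symbolOne α δ z))

/-- The value of the symbol at `1`. -/
def symbolUnit (δ : ℝ) : ℂ := Complex.exp (-(Complex.I * δ * (Real.pi / 2)))

theorem symbolUnit_eq (δ : ℝ) :
    symbolUnit δ = Complex.exp (((-(δ * (Real.pi / 2)) : ℝ) : ℂ) * Complex.I) := by
  rw [symbolUnit]
  congr 1
  push_cast
  ring

theorem symbolUnit_re (δ : ℝ) : (symbolUnit δ).re = Real.cos (δ * (Real.pi / 2)) := by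
  rw [symbolUnit_eq, Complex.exp_ofReal_mul_I_re, Real.cos_neg]

theorem cos_pos_of_abs_lt_one {δ : ℝ} (hδ : |δ| < 1) : 0 < Real.cos (δ * (Real.pi / 2)) := by
  have hp := Real.pi_pos
  have h := abs_lt.mp hδ
  exact Real.cos_pos_of_mem_Ioo ⟨by nlinarith, by nlinarith⟩

theorem symbolOne_neg (α δ z : ℝ) :
    symbolOne α δ (-z) = starRingEnd ℂ (symbolOne α δ z) := by
  simp only [symbolOne, abs_neg, map_mul, Complex.conj_ofReal, ← Complex.exp_conj, map_neg,
    Complex.conj_I, map_div₀, Complex.conj_ofNat, Real.sign_neg, Complex.ofReal_neg]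
  congr 2
  ring

theorem symbolOne_of_nonneg {α : ℝ} (hα : 0 < α) (δ : ℝ) {z : ℝ} (hz : 0 ≤ z) :
    symbolOne α δ z = symbolUnit δ * ((z ^ α : ℝ) : ℂ) := by
  rcases hz.eq_or_lt with rfl | hz
  · simp [symbolOne, Real.zero_rpow hα.ne']
  · rw [symbolOne, Real.sign_of_pos hz, abs_of_pos hz, symbolUnit, Complex.ofReal_one, mul_one,
      mul_comm]

theorem symbolOne_of_nonpos {α : ℝ} (hα : 0 < α) (δ : ℝ) {z : ℝ} (hz : z ≤ 0) :
    symbolOne α δ z = starRingEnd ℂ (symbolUnit δ * (((-z) ^ α : ℝ) : ℂ)) := by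
  rw [← symbolOne_of_nonneg hα δ (neg_nonneg.mpr hz), ← symbolOne_neg, neg_neg]

theorem continuous_symbolOne {α : ℝ} (hα : 0 < α) (δ : ℝ) : Continuous (symbolOne α δ) := by
  have h : symbolOne α δ = fun z => symbolUnit δ * ((max z 0 ^ α : ℝ) : ℂ) +
      starRingEnd ℂ (symbolUnit δ) * ((max (-z) 0 ^ α : ℝ) : ℂ) := by
    ext z
    rcases le_total 0 z with hz | hz
    · rw [symbolOne_of_nonneg hα δ hz, max_eq_left hz, max_eq_right (neg_nonpos.mpr hz),
        Real.zero_rpow hα.ne']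
      simp
    · rw [symbolOne_of_nonpos hα δ hz, max_eq_right hz, max_eq_left (neg_nonneg.mpr hz),
        Real.zero_rpow hα.ne', map_mul, Complex.conj_ofReal]
      simp
  rw [h]
  have h1 : Continuous fun z : ℝ => max z 0 ^ α :=
    (Real.continuous_rpow_const hα.le).comp (by fun_prop)
  have h2 : Continuous fun z : ℝ => max (-z) 0 ^ α :=
    (Real.continuous_rpow_const hα.le).comp (by fun_prop)
  fun_prop

theorem norm_symbolOne (α δ z : ℝ) : ‖symbolOne α δ z‖ = |z| ^ α := by
  rw [symbolOne, norm_mul, Complex.norm_real, Real.norm_of_nonneg (by positivity),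
    Complex.norm_exp]
  simp

theorem symbolOne_re {α : ℝ} (hα : 0 < α) (δ z : ℝ) :
    (symbolOne α δ z).re = |z| ^ α * Real.cos (δ * (Real.pi / 2)) := by
  rcases le_total 0 z with hz | hz
  · rw [symbolOne_of_nonneg hα δ hz, abs_of_nonneg hz, Complex.re_mul_ofReal, symbolUnit_re,
      mul_comm]
  · rw [symbolOne_of_nonpos hα δ hz, abs_of_nonpos hz, Complex.conj_re, Complex.re_mul_ofReal,
      symbolUnit_re, mul_comm]

theorem symbolOne_mul {a : ℝ} (ha : 0 < a) (α δ z : ℝ) :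
    symbolOne α δ (a * z) = ((a ^ α : ℝ) : ℂ) * symbolOne α δ z := by
  have h : Real.sign (a * z) = Real.sign z := by
    rcases lt_trichotomy z 0 with hz | rfl | hz
    · rw [Real.sign_of_neg hz, Real.sign_of_neg (mul_neg_of_pos_of_neg ha hz)]
    · simp
    · rw [Real.sign_of_pos hz, Real.sign_of_pos (mul_pos ha hz)]
  rw [symbolOne, symbolOne, h, abs_mul, abs_of_pos ha, Real.mul_rpow ha.le (abs_nonneg z),
    Complex.ofReal_mul, mul_assoc]

theorem multOne_neg (α δ t z : ℝ) :
    multOne α δ t (-z) = starRingEnd ℂ (multOne α δ t z) := by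
  simp only [multOne, symbolOne_neg, ← Complex.exp_conj, map_neg, map_mul, Complex.conj_ofReal]

theorem continuous_multOne {α : ℝ} (hα : 0 < α) (δ t : ℝ) : Continuous (multOne α δ t) := by
  have := continuous_symbolOne hα δ
  unfold multOne
  fun_prop

theorem multOne_of_nonneg {α : ℝ} (hα : 0 < α) (δ t : ℝ) {z : ℝ} (hz : 0 ≤ z) :
    multOne α δ t z = halfExp (t * symbolUnit δ) α z := by
  rw [multOne, symbolOne_of_nonneg hα δ hz, halfExp, mul_assoc]

theorem re_mul_symbolUnit_pos {δ t : ℝ} (hδ : |δ| < 1) (ht : 0 < t) :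
    0 < ((t : ℂ) * symbolUnit δ).re := by
  rw [Complex.re_ofReal_mul, symbolUnit_re]
  exact mul_pos ht (cos_pos_of_abs_lt_one hδ)

/-- A function with `f (-z) = conj (f z)` is integrable if it is so on a half-line. -/
theorem integrable_of_conj_symm {f : ℝ → ℂ} (hf : ∀ z, f (-z) = starRingEnd ℂ (f z))
    (h : IntegrableOn f (Ioi 0)) : Integrable f := by
  have h' : IntegrableOn f (Iic 0) := by
    rw [← integrableOn_Ici_iff_integrableOn_Ioi] at h
    have hneg := (Measure.measurePreserving_neg (volume : Measure ℝ)).integrableOn_comp_preimage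
      (Homeomorph.neg ℝ).measurableEmbedding (f := f) (s := Iic 0)
    rw [← hneg]
    have e : (Neg.neg ⁻¹' Iic 0 : Set ℝ) = Ici 0 := by
      ext z
      simp
    rw [e]
    refine (h.norm).mono' ?_ (ae_of_all _ fun z => ?_)
    · have : (f ∘ fun z => -z) = fun z => starRingEnd ℂ (f z) := funext hf
      rw [this]
      exact Complex.continuous_conj.comp_aestronglyMeasurable h.aestronglyMeasurable
    · rw [Function.comp_apply, hf, RCLike.norm_conj]
  rw [← integrableOn_univ, ← Iic_union_Ioi (a := (0 : ℝ))]
  exact h'.union h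

/-- The integral over the line of a function with `f (-z) = conj (f z)`. -/
theorem integral_of_conj_symm {f : ℝ → ℂ} (hf : ∀ z, f (-z) = starRingEnd ℂ (f z))
    (h : Integrable f) : ∫ z, f z = ((2 * (∫ z in Ioi (0 : ℝ), f z).re : ℝ) : ℂ) := by
  have h1 : ∫ z, f z = (∫ z in Iic (0 : ℝ), f z) + ∫ z in Ioi (0 : ℝ), f z := by
    rw [← setIntegral_union (Iic_disjoint_Ioi le_rfl)
      measurableSet_Ioi h.integrableOn h.integrableOn, Iic_union_Ioi, setIntegral_univ]
  have h2 : ∫ z in Iic (0 : ℝ), f z = starRingEnd ℂ (∫ z in Ioi (0 : ℝ), f z) := by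
    rw [← integral_conj, ← neg_zero, ← integral_comp_neg_Ioi]
    simp only [neg_zero, hf]
  rw [h1, h2, add_comm, Complex.add_conj]

theorem integrable_multOne {α δ t : ℝ} (hα : 0 < α) (hδ : |δ| < 1) (ht : 0 < t) :
    Integrable (multOne α δ t) := by
  refine integrable_of_conj_symm (multOne_neg α δ t) ?_
  refine (integrableOn_halfExp hα (re_mul_symbolUnit_pos hδ ht)).congr_fun (fun z hz => ?_)
    measurableSet_Ioi
  rw [multOne_of_nonneg hα δ t (le_of_lt hz)]

/-! ### The one-dimensional Green function -/

theorem exp_mul_multOne_neg (α δ t x z : ℝ) :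
    Complex.exp (-(Complex.I * (-z : ℝ) * x)) * multOne α δ t (-z) =
      starRingEnd ℂ (Complex.exp (-(Complex.I * z * x)) * multOne α δ t z) := by
  rw [multOne_neg, map_mul, ← Complex.exp_conj]
  simp

theorem integrable_exp_mul_multOne {α δ t : ℝ} (hα : 0 < α) (hδ : |δ| < 1) (ht : 0 < t) (x : ℝ) :
    Integrable fun z : ℝ => Complex.exp (-(Complex.I * z * x)) * multOne α δ t z := by
  refine Integrable.bdd_mul (c := 1) (integrable_multOne hα hδ ht) (by fun_prop)
    (ae_of_all _ fun z => ?_)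
  rw [norm_exp_neg_I_mul]

theorem greenOne_eq (α δ t x : ℝ) :
    greenOne α δ t x = 1 / (2 * Real.pi) *
      (∫ z : ℝ, Complex.exp (-(Complex.I * z * x)) * multOne α δ t z).re := by
  rw [greenOne]
  congr 3
  ext z
  rw [multOne, symbolOne, ← Complex.exp_add]
  congr 1
  ring

theorem greenOne_eq_half {α δ t : ℝ} (hα : 0 < α) (hδ : |δ| < 1) (ht : 0 < t) (x : ℝ) :
    greenOne α δ t x = 1 / Real.pi *
      (∫ z in Ioi (0 : ℝ), Complex.exp (-(Complex.I * z * x)) *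
        halfExp (t * symbolUnit δ) α z).re := by
  rw [greenOne_eq, integral_of_conj_symm (exp_mul_multOne_neg α δ t x)
    (integrable_exp_mul_multOne hα hδ ht x), Complex.ofReal_re,
    setIntegral_congr_fun measurableSet_Ioi (fun z hz => by
      rw [multOne_of_nonneg hα δ t (le_of_lt hz)])]
  generalize (∫ z in Ioi (0 : ℝ), Complex.exp (-(Complex.I * z * x)) *
        halfExp (t * symbolUnit δ) α z).re = J
  field_simp

theorem ofReal_greenOne {α δ t : ℝ} (hα : 0 < α) (hδ : |δ| < 1) (ht : 0 < t) (x : ℝ) :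
    (greenOne α δ t x : ℂ) = 1 / (2 * Real.pi) *
      ∫ z : ℝ, Complex.exp (-(Complex.I * z * x)) * multOne α δ t z := by
  rw [greenOne_eq, integral_of_conj_symm (exp_mul_multOne_neg α δ t x)
    (integrable_exp_mul_multOne hα hδ ht x), Complex.ofReal_re]
  push_cast
  rfl

theorem ofReal_greenOne_eq_fourier {α δ t : ℝ} (hα : 0 < α) (hδ : |δ| < 1) (ht : 0 < t) (x : ℝ) :
    (greenOne α δ t x : ℂ) = 1 / (2 * Real.pi) * 𝓕 (multOne α δ t) ((2 * Real.pi)⁻¹ * x) := by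
  rw [ofReal_greenOne hα hδ ht, Real.fourier_eq']
  congr 2
  ext z
  rw [smul_eq_mul]
  congr 2
  have : (-2 * Real.pi * inner ℝ z ((2 * Real.pi)⁻¹ * x) : ℝ) = -(z * x) := by
    simp only [RCLike.inner_apply, conj_trivial]
    field_simp
  rw [this]
  push_cast
  ring

theorem continuous_greenOne {α δ t : ℝ} (hα : 0 < α) (hδ : |δ| < 1) (ht : 0 < t) :
    Continuous (greenOne α δ t) := by
  have hF : Continuous (𝓕 (multOne α δ t)) :=
    VectorFourier.fourierIntegral_continuous Real.continuous_fourierChar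
      (by exact continuous_inner) (integrable_multOne hα hδ ht)
  have : greenOne α δ t = fun x => (1 / (2 * Real.pi) *
      𝓕 (multOne α δ t) ((2 * Real.pi)⁻¹ * x) : ℂ).re := by
    ext x
    rw [← ofReal_greenOne_eq_fourier hα hδ ht, Complex.ofReal_re]
  rw [this]
  fun_prop

theorem measurable_greenOne (α δ : ℝ) :
    Measurable fun p : ℝ × ℝ => greenOne α δ p.1 p.2 := by
  unfold greenOne
  have hs : Measurable Real.sign := by
    have : Real.sign = fun r : ℝ => if r < 0 then -1 else if 0 < r then 1 else 0 := by
      ext r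
      rfl
    rw [this]
    exact Measurable.ite measurableSet_Iio measurable_const
      (Measurable.ite measurableSet_Ioi measurable_const measurable_const)
  have h : StronglyMeasurable (fun q : (ℝ × ℝ) × ℝ =>
      Complex.exp (-(Complex.I * q.2 * q.1.2) - q.1.1 * ((|q.2| ^ α : ℝ) : ℂ) *
        Complex.exp (-(Complex.I * δ * (Real.pi / 2) * (Real.sign q.2 : ℂ))))) := by
    refine Measurable.stronglyMeasurable ?_
    have : Measurable fun q : (ℝ × ℝ) × ℝ => Real.sign q.2 := hs.comp measurable_snd
    fun_prop
  have h2 := h.integral_prod_right' (ν := (volume : Measure ℝ))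
  exact (Complex.measurable_re.comp h2.measurable).const_mul _

/-- The Green function at time one is integrable: it decays faster than `1 / |x|`. -/
theorem integrable_greenOne_one {α δ : ℝ} (hα : 0 < α) (hδ : |δ| < 1) :
    Integrable (greenOne α δ 1) := by
  have hre := re_mul_symbolUnit_pos hδ one_pos
  obtain ⟨C, ε, hC, hε, hε1, h⟩ := exists_integral_exp_mul_halfExp hα hre
  set B : ℝ := ∫ z in Ioi (0 : ℝ), ‖halfExp ((1 : ℝ) * symbolUnit δ) α z‖ with hB
  have hB0 : 0 ≤ B := integral_nonneg fun z => norm_nonneg _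
  have b1 : ∀ x, |greenOne α δ 1 x| ≤ B := by
    intro x
    rw [greenOne_eq_half hα hδ one_pos, abs_mul, abs_of_pos (by positivity)]
    have h1 : ‖∫ z in Ioi (0 : ℝ), Complex.exp (-(Complex.I * z * x)) *
        halfExp ((1 : ℝ) * symbolUnit δ) α z‖ ≤ B := by
      refine (norm_integral_le_integral_norm _).trans_eq ?_
      simp_rw [norm_mul, norm_exp_neg_I_mul, one_mul, hB]
    have h2 : 1 / Real.pi ≤ 1 := by
      rw [div_le_one Real.pi_pos]
      linarith [Real.pi_gt_three]
    calc _ ≤ 1 * B := mul_le_mul h2 ((Complex.abs_re_le_norm _).trans h1) (abs_nonneg _)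
          zero_le_one
      _ = B := one_mul B
  have b2 : ∀ x : ℝ, x ≠ 0 → |greenOne α δ 1 x| ≤ C * |x| ^ (-(1 + ε)) := by
    intro x hx
    have hx' : 0 < |x| := abs_pos.mpr hx
    rw [greenOne_eq_half hα hδ one_pos, abs_mul, abs_of_pos (by positivity)]
    set J := ∫ z in Ioi (0 : ℝ), Complex.exp (-(Complex.I * z * x)) *
        halfExp ((1 : ℝ) * symbolUnit δ) α z with hJ
    -- The leading term `1 / (i x)` is purely imaginary and drops out of the real part.
    have h1 : |x| * |J.re| ≤ C * |x| ^ (-ε) := by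
      refine le_trans ?_ (h x hx)
      have : |(Complex.I * x * J - 1).im| = |x| * |J.re| := by
        simp [abs_mul]
      rw [← this]
      exact Complex.abs_im_le_norm _
    have h2 : 1 / Real.pi ≤ 1 := by
      rw [div_le_one Real.pi_pos]
      linarith [Real.pi_gt_three]
    have h3 : |x| ^ (-ε) = |x| * |x| ^ (-(1 + ε)) := by
      nth_rewrite 2 [← Real.rpow_one |x|]
      rw [← Real.rpow_add hx']
      congr 1
      ring
    rw [h3] at h1
    have h4 : |J.re| ≤ C * |x| ^ (-(1 + ε)) := by
      refine le_of_mul_le_mul_left (h1.trans_eq ?_) hx'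
      ring
    calc _ ≤ 1 * |J.re| := mul_le_mul_of_nonneg_right h2 (abs_nonneg _)
      _ ≤ _ := by rwa [one_mul]
  have hint : Integrable fun x : ℝ => (B + C) * 2 ^ (1 + ε) * (1 + ‖x‖) ^ (-(1 + ε)) := by
    refine (integrable_one_add_norm (μ := (volume : Measure ℝ)) ?_).const_mul _
    simp [hε]
  refine hint.mono' (continuous_greenOne hα hδ one_pos).aestronglyMeasurable
    (ae_of_all _ fun x => ?_)
  rw [Real.norm_eq_abs, Real.norm_eq_abs]
  have hpos : (0 : ℝ) < 1 + |x| := by positivity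
  have e1 : (2 : ℝ) ^ (1 + ε) * (1 + |x|) ^ (-(1 + ε)) = ((1 + |x|) / 2) ^ (-(1 + ε)) := by
    rw [Real.div_rpow hpos.le zero_le_two, Real.rpow_neg zero_le_two]
    field_simp
  rw [mul_assoc, e1]
  have hp : 0 < ((1 + |x|) / 2) ^ (-(1 + ε)) := by positivity
  rcases le_total |x| 1 with hx | hx
  · have h1 : 1 ≤ ((1 + |x|) / 2) ^ (-(1 + ε)) :=
      Real.one_le_rpow_of_pos_of_le_one_of_nonpos (by positivity) (by linarith) (by linarith)
    have h2 := b1 x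
    nlinarith
  · have hx0 : x ≠ 0 := by
      rintro rfl
      simp at hx
      linarith
    have h1 : |x| ^ (-(1 + ε)) ≤ ((1 + |x|) / 2) ^ (-(1 + ε)) :=
      Real.rpow_le_rpow_of_nonpos (by positivity) (by linarith) (by linarith)
    have h2 := b2 x hx0
    nlinarith

/-- Self-similarity of the Green function. -/
theorem greenOne_scaling {α : ℝ} (hα : 0 < α) (δ : ℝ) {t : ℝ} (ht : 0 < t) (x : ℝ) :
    greenOne α δ t x = t ^ (-(1 / α)) * greenOne α δ 1 (t ^ (-(1 / α)) * x) := by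
  set a : ℝ := t ^ (-(1 / α)) with ha_def
  have ha : 0 < a := by positivity
  have hta : t * a ^ α = 1 := by
    rw [ha_def, ← Real.rpow_mul ht.le, neg_mul, one_div_mul_cancel hα.ne', Real.rpow_neg ht.le,
      Real.rpow_one, mul_inv_cancel₀ ht.ne']
  have h := Measure.integral_comp_mul_left
    (fun z : ℝ => Complex.exp (-(Complex.I * z * x)) * multOne α δ t z) a
  have e : ∀ z : ℝ, Complex.exp (-(Complex.I * (a * z : ℝ) * x)) * multOne α δ t (a * z) =
      Complex.exp (-(Complex.I * z * (a * x : ℝ))) * multOne α δ 1 z := by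
    intro z
    rw [multOne, multOne, symbolOne_mul ha, ← mul_assoc, ← Complex.ofReal_mul, hta]
    congr 2
    push_cast
    ring
  simp_rw [e] at h
  rw [greenOne_eq, greenOne_eq, h, Complex.smul_re, smul_eq_mul, abs_of_pos (inv_pos.mpr ha)]
  generalize (∫ z : ℝ, Complex.exp (-(Complex.I * z * x)) * multOne α δ t z).re = J
  field_simp

theorem integrable_greenOne {α δ t : ℝ} (hα : 0 < α) (hδ : |δ| < 1) (ht : 0 < t) :
    Integrable (greenOne α δ t) := by
  have ha : t ^ (-(1 / α)) ≠ 0 := by positivity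
  have := ((integrable_greenOne_one hα hδ).comp_mul_left' ha).const_mul (t ^ (-(1 / α)))
  exact this.congr (ae_of_all _ fun x => (greenOne_scaling hα δ ht x).symm)

theorem integral_abs_greenOne {α : ℝ} (hα : 0 < α) (δ : ℝ) {t : ℝ} (ht : 0 < t) :
    ∫ x, |greenOne α δ t x| = ∫ x, |greenOne α δ 1 x| := by
  have ha : 0 < t ^ (-(1 / α)) := by positivity
  have h := Measure.integral_comp_mul_left (fun x : ℝ => |greenOne α δ 1 x|) (t ^ (-(1 / α)))
  simp_rw [greenOne_scaling hα δ ht, abs_mul, integral_const_mul, h, smul_eq_mul,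
    abs_of_pos ha, abs_of_pos (inv_pos.mpr ha)]
  rw [mul_inv_cancel_left₀ ha.ne']

/-- The Fourier transform of the one-dimensional Green function, by Fourier inversion. -/
theorem integral_exp_mul_greenOne {α δ t : ℝ} (hα : 0 < α) (hδ : |δ| < 1) (ht : 0 < t) (z : ℝ) :
    ∫ x : ℝ, Complex.exp (Complex.I * x * z) * greenOne α δ t x = multOne α δ t z := by
  have hp : (2 * Real.pi)⁻¹ ≠ 0 := by positivity
  have hg : ∀ y : ℝ, 𝓕 (multOne α δ t) y =
      ((2 * Real.pi : ℝ) : ℂ) * greenOne α δ t (2 * Real.pi * y) := by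
    intro y
    rw [ofReal_greenOne_eq_fourier hα hδ ht, inv_mul_cancel_left₀ (by positivity)]
    push_cast
    rw [← mul_assoc, mul_one_div_cancel
      (mul_ne_zero two_ne_zero (Complex.ofReal_ne_zero.mpr Real.pi_ne_zero)), one_mul]
  have hi : Integrable (𝓕 (multOne α δ t)) := by
    have h := ((integrable_greenOne hα hδ ht).comp_mul_left'
      (R := 2 * Real.pi) (by positivity)).ofReal (𝕜 := ℂ)
    exact (h.const_mul ((2 * Real.pi : ℝ) : ℂ)).congr (ae_of_all _ fun y => (hg y).symm)
  have hinv := congrFun ((continuous_multOne hα δ t).fourierInv_fourier_eq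
    (integrable_multOne hα hδ ht) hi) z
  rw [← hinv, Real.fourierInv_eq']
  have h := Measure.integral_comp_mul_left
    (fun x : ℝ => Complex.exp (Complex.I * x * z) * greenOne α δ t x) (2 * Real.pi)
  rw [abs_of_pos (by positivity)] at h
  have h2 : ∫ x : ℝ, Complex.exp (Complex.I * x * z) * greenOne α δ t x = (2 * Real.pi) •
      ∫ y : ℝ, Complex.exp (Complex.I * (2 * Real.pi * y : ℝ) * z) *
        greenOne α δ t (2 * Real.pi * y) := by
    rw [h, smul_smul, mul_inv_cancel₀ (by positivity), one_smul]
  rw [h2, ← integral_smul]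
  congr 1
  ext y
  rw [hg, smul_eq_mul, Complex.real_smul]
  have : (2 * Real.pi * inner ℝ y z : ℝ) = 2 * Real.pi * y * z := by
    simp only [RCLike.inner_apply, conj_trivial]
    ring
  rw [this]
  have e : Complex.I * ((2 * Real.pi * y : ℝ) : ℂ) * z =
      ((2 * Real.pi * y * z : ℝ) : ℂ) * Complex.I := by
    push_cast
    ring
  rw [e]
  ring

/-! ### The Green function in dimension `d` -/

section Green

variable {d : ℕ} {α δ : Fin d → ℝ}

/-- The conditions on `(α, δ)` under which the symbol has a positive real part comparable with
`∑ᵢ |ξᵢ| ^ αᵢ`. -/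
structure Admissible (α δ : Fin d → ℝ) : Prop where
  pos : ∀ i, 0 < α i
  le_two : ∀ i, α i ≤ 2
  skew : ∀ i, |δ i| < 1

/-- `∑ᵢ |ξᵢ| ^ αᵢ`. -/
def powSum (α : Fin d → ℝ) (ξ : Space d) : ℝ := ∑ i, |ξ i| ^ α i

/-- The symbol of `-∑ᵢ D_{δᵢ}^{αᵢ}`. -/
def symbol (α δ : Fin d → ℝ) (ξ : Space d) : ℂ := ∑ i, symbolOne (α i) (δ i) (ξ i)

/-- The Fourier multiplier of the semigroup generated by `∑ᵢ D_{δᵢ}^{αᵢ}`. -/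
def mult (α δ : Fin d → ℝ) (t : ℝ) (ξ : Space d) : ℂ := Complex.exp (-(t * symbol α δ ξ))

/-- The common `L¹` norm of the Green functions `G_t`, `t > 0`. -/
def greenMass (α δ : Fin d → ℝ) : ℝ := ∏ i, ∫ x, |greenOne (α i) (δ i) 1 x|

theorem powSum_nonneg (α : Fin d → ℝ) (ξ : Space d) : 0 ≤ powSum α ξ :=
  Finset.sum_nonneg fun _ _ => by positivity

theorem mult_eq_prod (α δ : Fin d → ℝ) (t : ℝ) (ξ : Space d) :
    mult α δ t ξ = ∏ i, multOne (α i) (δ i) t (ξ i) := by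
  simp only [mult, multOne, symbol, ← Complex.exp_sum, Finset.mul_sum, Finset.sum_neg_distrib]

theorem mult_add (α δ : Fin d → ℝ) (s t : ℝ) (ξ : Space d) :
    mult α δ (s + t) ξ = mult α δ s ξ * mult α δ t ξ := by
  rw [mult, mult, mult, ← Complex.exp_add]
  congr 1
  push_cast
  ring

theorem continuous_symbol (h : Admissible α δ) : Continuous (symbol α δ) := by
  unfold symbol
  refine continuous_finsetSum _ fun i _ => ?_
  exact (continuous_symbolOne (h.pos i) (δ i)).comp (by fun_prop)

theorem continuous_mult (h : Admissible α δ) {X : Type*} [TopologicalSpace X] {f : X → ℝ}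
    {g : X → Space d} (hf : Continuous f) (hg : Continuous g) :
    Continuous fun z => mult α δ (f z) (g z) := by
  have := (continuous_symbol h).comp hg
  simp only [Function.comp_def] at this
  unfold mult
  fun_prop

theorem norm_symbol_le (α δ : Fin d → ℝ) (ξ : Space d) : ‖symbol α δ ξ‖ ≤ powSum α ξ := by
  refine (norm_sum_le _ _).trans_eq ?_
  simp only [norm_symbolOne, powSum]

/-- Coercivity of the symbol. -/
theorem exists_le_symbol_re (h : Admissible α δ) :
    ∃ κ, 0 < κ ∧ ∀ ξ, κ * powSum α ξ ≤ (symbol α δ ξ).re := by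
  have hc : ∀ i, 0 < Real.cos (δ i * (Real.pi / 2)) := fun i => cos_pos_of_abs_lt_one (h.skew i)
  refine ⟨∏ i, Real.cos (δ i * (Real.pi / 2)), Finset.prod_pos fun i _ => hc i, fun ξ => ?_⟩
  rw [symbol, Complex.re_sum, powSum, Finset.mul_sum]
  refine Finset.sum_le_sum fun i _ => ?_
  rw [symbolOne_re (h.pos i), mul_comm]
  refine mul_le_mul_of_nonneg_left ?_ (by positivity)
  rw [← Finset.mul_prod_erase Finset.univ _ (Finset.mem_univ i)]
  exact mul_le_of_le_one_right (hc i).le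
    (Finset.prod_le_one (fun j _ => (hc j).le) fun j _ => Real.cos_le_one _)

theorem norm_mult (α δ : Fin d → ℝ) (t : ℝ) (ξ : Space d) :
    ‖mult α δ t ξ‖ = Real.exp (-(t * (symbol α δ ξ).re)) := by
  rw [mult, Complex.norm_exp, Complex.neg_re, Complex.re_ofReal_mul]

theorem symbol_re_nonneg (h : Admissible α δ) (ξ : Space d) : 0 ≤ (symbol α δ ξ).re := by
  obtain ⟨κ, hκ, h'⟩ := exists_le_symbol_re h
  exact (mul_nonneg hκ.le (powSum_nonneg α ξ)).trans (h' ξ)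

theorem norm_mult_anti (h : Admissible α δ) {s t : ℝ} (hst : s ≤ t) (ξ : Space d) :
    ‖mult α δ t ξ‖ ≤ ‖mult α δ s ξ‖ := by
  rw [norm_mult, norm_mult, Real.exp_le_exp, neg_le_neg_iff]
  exact mul_le_mul_of_nonneg_right hst (symbol_re_nonneg h ξ)

theorem measurable_green (α δ : Fin d → ℝ) {X : Type*} [MeasurableSpace X] {f : X → ℝ}
    {g : X → Space d} (hf : Measurable f) (hg : Measurable g) :
    Measurable fun z => green α δ (f z) (g z) := by
  unfold green
  refine Finset.measurable_prod _ fun i _ => ?_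
  exact (measurable_greenOne (α i) (δ i)).comp
    (hf.prodMk ((by fun_prop : Measurable fun x : Space d => x i).comp hg))

theorem integrable_green (h : Admissible α δ) {t : ℝ} (ht : 0 < t) :
    Integrable (green α δ t) := by
  rw [← (PiLp.volume_preserving_toLp (Fin d)).integrable_comp_emb
    (MeasurableEquiv.toLp 2 _).measurableEmbedding]
  exact Integrable.fintype_prod fun i => integrable_greenOne (h.pos i) (h.skew i) ht

theorem integral_abs_green (h : Admissible α δ) {t : ℝ} (ht : 0 < t) :
    ∫ x, |green α δ t x| = greenMass α δ := by
  rw [← (PiLp.volume_preserving_toLp (Fin d)).integral_comp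
    (MeasurableEquiv.toLp 2 _).measurableEmbedding]
  simp only [green, Finset.abs_prod]
  rw [integral_fintype_prod_volume_eq_prod (fun i x => |greenOne (α i) (δ i) t x|), greenMass]
  exact Finset.prod_congr rfl fun i _ => integral_abs_greenOne (h.pos i) (δ i) ht

theorem integral_exp_mul_green (h : Admissible α δ) {t : ℝ} (ht : 0 < t) (ξ : Space d) :
    ∫ x, Complex.exp (Complex.I * (inner ℝ x ξ : ℝ)) * (green α δ t x : ℂ) = mult α δ t ξ := by
  rw [← (PiLp.volume_preserving_toLp (Fin d)).integral_comp
    (MeasurableEquiv.toLp 2 _).measurableEmbedding]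
  have e : ∀ x : Fin d → ℝ, Complex.exp (Complex.I * (inner ℝ (WithLp.toLp 2 x) ξ : ℝ)) *
      (green α δ t (WithLp.toLp 2 x) : ℂ) =
      ∏ i, Complex.exp (Complex.I * x i * ξ i) * greenOne (α i) (δ i) t (x i) := by
    intro x
    rw [Finset.prod_mul_distrib, ← Complex.exp_sum, green]
    push_cast
    congr 2
    rw [PiLp.inner_apply]
    push_cast
    rw [Finset.mul_sum]
    refine Finset.sum_congr rfl fun i _ => ?_
    simp only [RCLike.inner_apply, conj_trivial]
    push_cast
    ring
  simp_rw [e]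
  rw [integral_fintype_prod_volume_eq_prod
    (fun i (x : ℝ) => Complex.exp (Complex.I * x * ξ i) * (greenOne (α i) (δ i) t x : ℂ)),
    mult_eq_prod]
  exact Finset.prod_congr rfl fun i _ =>
    integral_exp_mul_greenOne (h.pos i) (h.skew i) ht (ξ i)

theorem integral_green_sub (h : Admissible α δ) {t : ℝ} (ht : 0 < t) (x : Space d) :
    ∫ y, green α δ t (x - y) = 1 := by
  rw [integral_sub_left_eq_self (green α δ t) volume x]
  have := integral_exp_mul_green h ht 0
  have h0 : mult α δ t 0 = 1 := by
    have : ∀ i, symbolOne (α i) (δ i) 0 = 0 := fun i => by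
      rw [← norm_eq_zero, norm_symbolOne, abs_zero, Real.zero_rpow (h.pos i).ne']
    simp [mult, symbol, this]
  rw [h0] at this
  simp only [inner_zero_right, Complex.ofReal_zero, mul_zero, Complex.exp_zero, one_mul] at this
  rw [integral_complex_ofReal] at this
  exact_mod_cast this

theorem integral_abs_green_sub (h : Admissible α δ) {t : ℝ} (ht : 0 < t) (x : Space d) :
    ∫ y, |green α δ t (x - y)| = greenMass α δ := by
  rw [integral_sub_left_eq_self (fun y => |green α δ t y|) volume x, integral_abs_green h ht]

theorem integrable_green_sub (h : Admissible α δ) {t : ℝ} (ht : 0 < t) (x : Space d) :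
    Integrable fun y => green α δ t (x - y) :=
  (integrable_green h ht).comp_sub_left x

theorem integral_exp_mul_green_sub (h : Admissible α δ) {t : ℝ} (ht : 0 < t) (x ξ : Space d) :
    ∫ y, Complex.exp (-(Complex.I * (inner ℝ y ξ : ℝ))) * (green α δ t (x - y) : ℂ) =
      Complex.exp (-(Complex.I * (inner ℝ x ξ : ℝ))) * mult α δ t ξ := by
  rw [← integral_exp_mul_green h ht, ← integral_const_mul,
    ← integral_sub_left_eq_self (fun y => Complex.exp (-(Complex.I * (inner ℝ x ξ : ℝ))) *
      (Complex.exp (Complex.I * (inner ℝ y ξ : ℝ)) * (green α δ t y : ℂ))) volume x]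
  congr 1
  ext y
  rw [← mul_assoc, ← Complex.exp_add, inner_sub_left]
  congr 2
  push_cast
  ring

/-- The character `ξ ↦ exp (-i ⟨x, ξ⟩)`. -/
def chr (x ξ : Space d) : ℂ := Complex.exp (-(Complex.I * (inner ℝ x ξ : ℝ)))

theorem norm_chr (x ξ : Space d) : ‖chr x ξ‖ = 1 := by
  rw [chr, Complex.norm_exp]
  simp

@[fun_prop]
theorem continuous_chr {X : Type*} [TopologicalSpace X] {f g : X → Space d} (hf : Continuous f)
    (hg : Continuous g) : Continuous fun z => chr (f z) (g z) := by
  unfold chr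
  fun_prop

/-- The Fourier transform of `y ↦ G_t(x - y) c`. -/
theorem fourierT_green_sub_mul (h : Admissible α δ) {t : ℝ} (ht : 0 < t) (x ξ : Space d) (c : ℝ) :
    fourierT (fun y => ((green α δ t (x - y) * c : ℝ) : ℂ)) ξ =
      c * (chr x ξ * mult α δ t ξ) := by
  rw [fourierT, chr, ← integral_exp_mul_green_sub h ht, ← integral_const_mul]
  congr 1
  ext y
  push_cast
  ring

end Green

/-! ### The Duhamel operator -/

section Duhamel

variable {d : ℕ} {α δ : Fin d → ℝ} {T : ℝ}

/-- A bounded measurable function on `[0,T] × ℝ^d` extends to one on `ℝ × ℝ^d`. -/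
theorem BoundedMeasurable.exists_extension (hT : 0 ≤ T) {v : ℝ → Space d → ℝ}
    (hv : BoundedMeasurable T v) :
    ∃ w : ℝ → Space d → ℝ, Measurable (fun p : ℝ × Space d => w p.1 p.2) ∧
      (∃ C, ∀ s y, |w s y| ≤ C) ∧ ∀ s ∈ Icc 0 T, w s = v s := by
  obtain ⟨hm, C, hC⟩ := hv
  refine ⟨fun s => v (projIcc 0 T hT s), ?_, ⟨C, fun s y => hC _ (projIcc 0 T hT s).2 y⟩,
    fun s hs => by simp only [projIcc_of_mem hT hs]⟩
  have hp : Measurable fun p : ℝ × Space d => (projIcc 0 T hT p.1, p.2) :=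
    ((continuous_projIcc (h := hT)).measurable.comp measurable_fst).prodMk measurable_snd
  exact hm.comp hp

theorem duhamel_congr {v w : ℝ → Space d → ℝ} {t : ℝ} (ht : t ∈ Icc 0 T)
    (h : ∀ s ∈ Icc 0 T, w s = v s) (x : Space d) : duhamel α δ v t x = duhamel α δ w t x := by
  refine intervalIntegral.integral_congr fun s hs => ?_
  rw [uIcc_of_le ht.1] at hs
  simp only [h s ⟨hs.1, hs.2.trans ht.2⟩]

theorem integrable_green_sub_mul (h : Admissible α δ) {t : ℝ} (ht : 0 < t) (x : Space d)
    {g : Space d → ℝ} (hg : AEStronglyMeasurable g) {C : ℝ} (hC : ∀ y, |g y| ≤ C) :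
    Integrable fun y => green α δ t (x - y) * g y :=
  (integrable_green_sub h ht x).mul_bdd (c := C) hg (ae_of_all _ hC)

theorem abs_integral_green_sub_mul_le (h : Admissible α δ) {t : ℝ} (ht : 0 < t) (x : Space d)
    {g : Space d → ℝ} {C : ℝ} (hC : ∀ y, |g y| ≤ C) :
    |∫ y, green α δ t (x - y) * g y| ≤ greenMass α δ * C := by
  rw [← integral_abs_green_sub h ht x, ← integral_mul_const, ← Real.norm_eq_abs]
  refine norm_integral_le_of_norm_le ((integrable_green_sub h ht x).abs.mul_const C)
    (ae_of_all _ fun y => ?_)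
  rw [norm_mul, Real.norm_eq_abs, Real.norm_eq_abs]
  exact mul_le_mul_of_nonneg_left (hC y) (abs_nonneg _)

theorem abs_duhamel_le (h : Admissible α δ) {v : ℝ → Space d → ℝ} {φ : ℝ → ℝ} {t : ℝ}
    (ht : 0 ≤ t) (hφ : Continuous φ) (hv : ∀ s ∈ Icc 0 t, ∀ y, |v s y| ≤ φ s) (x : Space d) :
    |duhamel α δ v t x| ≤ greenMass α δ * ∫ s in (0 : ℝ)..t, φ s := by
  rw [duhamel, ← intervalIntegral.integral_const_mul, ← Real.norm_eq_abs]
  refine intervalIntegral.norm_integral_le_of_norm_le ht ?_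
    ((hφ.const_mul (greenMass α δ)).intervalIntegrable _ _)
  have hne : ∀ᵐ s : ℝ, s ≠ t := by simp [ae_iff]
  filter_upwards [hne] with s hs1 hs2
  exact abs_integral_green_sub_mul_le h (sub_pos.mpr (lt_of_le_of_ne hs2.2 hs1)) x
    (hv s ⟨hs2.1.le, hs2.2⟩)

theorem stronglyMeasurable_integral_green_mul {w : ℝ → Space d → ℝ}
    (hw : Measurable (fun p : ℝ × Space d => w p.1 p.2)) (t : ℝ) (x : Space d) :
    StronglyMeasurable fun s => ∫ y, green α δ (t - s) (x - y) * w s y := by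
  refine StronglyMeasurable.integral_prod_right'
    (f := fun p : ℝ × Space d => green α δ (t - p.1) (x - p.2) * w p.1 p.2)
    (Measurable.stronglyMeasurable ?_)
  exact (measurable_green α δ (measurable_fst.const_sub t) (measurable_snd.const_sub x)).mul hw

theorem intervalIntegrable_integral_green_mul (h : Admissible α δ) {w : ℝ → Space d → ℝ}
    (hw : Measurable (fun p : ℝ × Space d => w p.1 p.2)) {C : ℝ} (hC : ∀ s y, |w s y| ≤ C)
    {t : ℝ} (ht : 0 ≤ t) (x : Space d) :
    IntervalIntegrable (fun s => ∫ y, green α δ (t - s) (x - y) * w s y) volume 0 t := by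
  refine (intervalIntegrable_const (c := greenMass α δ * C)).mono_fun
    (stronglyMeasurable_integral_green_mul hw t x).aestronglyMeasurable ?_
  rw [uIoc_of_le ht]
  have hne : ∀ᵐ s : ℝ, s ≠ t := by simp [ae_iff]
  filter_upwards [ae_restrict_mem measurableSet_Ioc, ae_restrict_of_ae hne] with s hs hs'
  refine le_trans ?_ (le_abs_self _)
  exact abs_integral_green_sub_mul_le h (sub_pos.mpr (lt_of_le_of_ne hs.2 hs')) x (hC s)

theorem duhamel_sub (h : Admissible α δ) {v w : ℝ → Space d → ℝ} (hv : BoundedMeasurable T v)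
    (hw : BoundedMeasurable T w) {t : ℝ} (ht : t ∈ Icc 0 T) (x : Space d) :
    duhamel α δ v t x - duhamel α δ w t x = duhamel α δ (fun s y => v s y - w s y) t x := by
  obtain ⟨v', hv'm, ⟨A, hA⟩, hv'⟩ := hv.exists_extension (ht.1.trans ht.2)
  obtain ⟨w', hw'm, ⟨B, hB⟩, hw'⟩ := hw.exists_extension (ht.1.trans ht.2)
  rw [duhamel_congr ht hv', duhamel_congr ht hw',
    duhamel_congr (v := fun s y => v s y - w s y) (w := fun s y => v' s y - w' s y) ht
      (fun s hs => by rw [hv' s hs, hw' s hs])]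
  rw [duhamel, duhamel, duhamel, ← intervalIntegral.integral_sub
    (intervalIntegrable_integral_green_mul h hv'm hA ht.1 x)
    (intervalIntegrable_integral_green_mul h hw'm hB ht.1 x)]
  refine intervalIntegral.integral_congr_ae ?_
  have hne : ∀ᵐ s : ℝ, s ≠ t := by simp [ae_iff]
  filter_upwards [hne] with s hs hs'
  rw [uIoc_of_le ht.1] at hs'
  have hts : 0 < t - s := sub_pos.mpr (lt_of_le_of_ne hs'.2 hs)
  rw [← integral_sub
    (integrable_green_sub_mul (g := v' s) h hts x
      (hv'm.comp measurable_prodMk_left).aestronglyMeasurable (hA s))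
    (integrable_green_sub_mul (g := w' s) h hts x
      (hw'm.comp measurable_prodMk_left).aestronglyMeasurable (hB s))]
  simp only [mul_sub]

/-- A bounded function dominated by its own time integral vanishes: iterating `n` times bounds it
by `A (L t) ^ n / n!`. -/
theorem eq_zero_of_abs_le_integral {D : ℝ → Space d → ℝ} {A L : ℝ}
    (hA : ∀ t ∈ Icc 0 T, ∀ x, |D t x| ≤ A)
    (step : ∀ φ : ℝ → ℝ, Continuous φ → ∀ t ∈ Icc 0 T, (∀ s ∈ Icc 0 t, ∀ y, |D s y| ≤ φ s) →
      ∀ x, |D t x| ≤ L * ∫ s in (0 : ℝ)..t, φ s) :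
    ∀ t ∈ Icc 0 T, ∀ x, D t x = 0 := by
  have key : ∀ n : ℕ, ∀ t ∈ Icc 0 T, ∀ x, |D t x| ≤ A * ((L * t) ^ n / n.factorial) := by
    intro n
    induction n with
    | zero => simpa using hA
    | succ n ih =>
      intro t ht x
      refine (step (fun s => A * ((L * s) ^ n / n.factorial)) (by fun_prop) t ht
        (fun s hs y => ih s ⟨hs.1, hs.2.trans ht.2⟩ y) x).trans_eq ?_
      have e : ∀ s : ℝ, A * ((L * s) ^ n / n.factorial) =
          A * L ^ n / n.factorial * s ^ n := fun s => by
        rw [mul_pow]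
        ring
      simp_rw [e]
      rw [intervalIntegral.integral_const_mul, integral_pow, Nat.factorial_succ]
      have hn : (n.factorial : ℝ) ≠ 0 := by positivity
      push_cast
      field_simp
      simp only [ne_eq, Nat.add_eq_zero_iff, one_ne_zero, and_false, not_false_eq_true, zero_pow,
        sub_zero]
      ring
  intro t ht x
  have lim := (FloorSemiring.tendsto_pow_div_factorial_atTop (L * t)).const_mul A
  rw [mul_zero] at lim
  exact abs_nonpos_iff.mp (ge_of_tendsto' lim fun n => key n t ht x)

end Duhamel

/-! ### The deterministic equation -/

section Deterministic

variable {d : ℕ} {α δ : Fin d → ℝ} {T : ℝ}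

/-- The ordinary differential equation `f' = b(f)`, `f(0) = 0`, has a global solution. -/
theorem exists_ode_solution {b : ℝ → ℝ} {L : ℝ≥0} (hb : LipschitzWith L b) (hT : 0 ≤ T) :
    ∃ f : ℝ → ℝ, Continuous f ∧ ∀ t ∈ Icc 0 T, f t = ∫ s in (0 : ℝ)..t, b (f s) := by
  -- The vector field is truncated at the a priori bound `R` given by Grönwall's lemma.
  set K : ℝ := L + 1 with hK_def
  have hK : 0 < K := by positivity
  set R : ℝ := |b 0| / K * (Real.exp (K * T) - 1) with hR_def
  have hR : 0 ≤ R := by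
    have : 1 ≤ Real.exp (K * T) := Real.one_le_exp (by positivity)
    have : 0 ≤ Real.exp (K * T) - 1 := by linarith
    positivity
  set c : ℝ → ℝ := fun u => max (-R) (min R u) with hc_def
  have hcL : LipschitzWith 1 c := (LipschitzWith.id.const_min R).const_max (-R)
  have hcR : ∀ u, |c u| ≤ R := fun u =>
    abs_le.mpr ⟨le_max_left _ _, max_le (by linarith) (min_le_left _ _)⟩
  have hcu : ∀ u, |c u| ≤ |u| := fun u => by
    rw [abs_le]
    constructor
    · rcases le_total R u with h | h
      · exact le_max_of_le_right (by rw [min_eq_left h]; linarith [abs_nonneg u])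
      · exact le_max_of_le_right (by rw [min_eq_right h]; exact neg_abs_le u)
    · exact max_le (by linarith [abs_nonneg u]) ((min_le_right _ _).trans (le_abs_self u))
  have hceq : ∀ u, |u| ≤ R → c u = u := fun u hu => by
    have := abs_le.mp hu
    rw [hc_def]
    simp only [min_eq_right this.2, max_eq_right this.1]
  have hb' : ∀ u, |b u| ≤ |b 0| + L * |u| := fun u => by
    have h1 := hb.dist_le_mul u 0
    rw [Real.dist_eq, Real.dist_eq, sub_zero] at h1
    have h2 := abs_add_le (b u - b 0) (b 0)
    rw [sub_add_cancel] at h2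
    linarith
  set M : ℝ≥0 := ‖b 0‖₊ + L * R.toNNReal with hM
  have hMc : (M : ℝ) = |b 0| + L * R := by simp [hM, hR]
  have hgM : ∀ u, |b (c u)| ≤ M := fun u => by
    rw [hMc]
    exact (hb' _).trans (add_le_add le_rfl (mul_le_mul_of_nonneg_left (hcR u) L.2))
  have pl : IsPicardLindelof (fun _ u => b (c u)) (⟨0, left_mem_Icc.mpr hT⟩ : Icc (0 : ℝ) T)
      (0 : ℝ) (M * T.toNNReal) 0 M (L * 1) :=
    { lipschitzOnWith := fun _ _ => (hb.comp hcL).lipschitzOnWith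
      continuousOn := fun _ _ => continuousOn_const
      norm_le := fun _ _ u _ => hgM u
      mul_max_le := by simp [hT] }
  obtain ⟨f, hf0, hf⟩ := pl.exists_eq_forall_mem_Icc_hasDerivWithinAt₀
  have hfc : ContinuousOn f (Icc 0 T) := fun t ht => (hf t ht).continuousWithinAt
  have hbound : ∀ t ∈ Icc 0 T, |f t| ≤ R := by
    intro t ht
    have h1 := norm_le_gronwallBound_of_norm_deriv_right_le (δ := 0) (K := K) (ε := |b 0|) hfc
      (fun s hs => (hf s ⟨hs.1, hs.2.le⟩).mono_of_mem_nhdsWithin (Icc_mem_nhdsGE_of_mem hs))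
      (by simp [hf0]) (fun s _ => by
        have h2 := hb' (c (f s))
        have h3 := mul_le_mul_of_nonneg_left (hcu (f s)) L.2
        rw [Real.norm_eq_abs, Real.norm_eq_abs, hK_def]
        have h4 := abs_nonneg (f s)
        change (L : ℝ) * _ ≤ L * _ at h3
        linarith) t ht
    refine h1.trans ?_
    simp only [gronwallBound_of_K_ne_0 hK.ne', sub_zero, zero_mul, zero_add]
    rw [hR_def]
    refine mul_le_mul_of_nonneg_left ?_ (by positivity)
    have : Real.exp (K * t) ≤ Real.exp (K * T) :=
      Real.exp_le_exp.mpr (mul_le_mul_of_nonneg_left ht.2 hK.le)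
    linarith
  refine ⟨IccExtend hT ((Icc 0 T).domRestrict f), hfc.domRestrict.Icc_extend', fun t ht => ?_⟩
  have hext : ∀ s ∈ Icc 0 T, IccExtend hT ((Icc 0 T).domRestrict f) s = f s := fun s hs =>
    IccExtend_of_mem hT _ hs
  have hsub : Icc 0 t ⊆ Icc 0 T := Icc_subset_Icc_right ht.2
  have hcomp : ContinuousOn (fun s => b (c (f s))) (Icc 0 t) :=
    (hb.continuous.comp hcL.continuous).comp_continuousOn (hfc.mono hsub)
  have ftc := intervalIntegral.integral_eq_sub_of_hasDeriv_right_of_le (f := f)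
    (f' := fun s => b (c (f s))) ht.1 (hfc.mono hsub)
    (fun s hs => (hf s ⟨hs.1.le, hs.2.le.trans ht.2⟩).mono_of_mem_nhdsWithin
      (mem_of_superset (Ioc_mem_nhdsGT (hs.2.trans_le ht.2))
        fun r hr => ⟨hs.1.le.trans hr.1.le, hr.2⟩))
    (ContinuousOn.intervalIntegrable (by rwa [uIcc_of_le ht.1]))
  rw [hext t ht]
  have hf0' : f 0 = 0 := hf0
  rw [hf0', sub_zero] at ftc
  rw [← ftc]
  refine intervalIntegral.integral_congr fun s hs => ?_
  rw [uIcc_of_le ht.1] at hs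
  simp only [hext s (hsub hs), hceq _ (hbound s (hsub hs))]

theorem boundedMeasurable_of_continuous {f : ℝ → ℝ} (hf : Continuous f) :
    BoundedMeasurable (d := d) T fun t _ => f t := by
  refine ⟨(hf.measurable.comp measurable_subtype_coe).comp measurable_fst, ?_⟩
  obtain ⟨C, hC⟩ := isCompact_Icc.exists_bound_of_continuousOn (s := Icc 0 T) hf.continuousOn
  exact ⟨C, fun t ht _ => hC t ht⟩

theorem duhamel_of_time (h : Admissible α δ) {g : ℝ → ℝ} {t : ℝ} (ht : 0 ≤ t) (x : Space d) :
    duhamel α δ (fun s _ => g s) t x = ∫ s in (0 : ℝ)..t, g s := by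
  refine intervalIntegral.integral_congr_ae ?_
  have hne : ∀ᵐ s : ℝ, s ≠ t := by simp [ae_iff]
  filter_upwards [hne] with s hs hs'
  rw [uIoc_of_le ht] at hs'
  rw [integral_mul_const, integral_green_sub h (sub_pos.mpr (lt_of_le_of_ne hs'.2 hs)), one_mul]

/-- The deterministic solution does not depend on the space variable. -/
theorem isDeterministicSolution_of_ode (h : Admissible α δ) {b f : ℝ → ℝ}
    (hf : Continuous f) (hode : ∀ t ∈ Icc 0 T, f t = ∫ s in (0 : ℝ)..t, b (f s)) :
    IsDeterministicSolution α δ b T fun t (_ : Space d) => f t where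
  bounded := boundedMeasurable_of_continuous hf
  eq t ht x := by
    rw [duhamel_of_time h ht.1]
    exact hode t ht

theorem BoundedMeasurable.comp {v : ℝ → Space d → ℝ} (hv : BoundedMeasurable T v) {b : ℝ → ℝ}
    (hb : Continuous b) : BoundedMeasurable T fun s y => b (v s y) := by
  obtain ⟨hm, C, hC⟩ := hv
  refine ⟨hb.measurable.comp hm, ?_⟩
  obtain ⟨B, hB⟩ := isCompact_Icc.exists_bound_of_continuousOn (s := Icc (-C) C) hb.continuousOn
  exact ⟨B, fun t ht x => hB _ (abs_le.mp (hC t ht x))⟩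

theorem IsDeterministicSolution.unique (h : Admissible α δ) {b : ℝ → ℝ} {L : ℝ≥0}
    (hb : LipschitzWith L b) {u v : ℝ → Space d → ℝ} (hu : IsDeterministicSolution α δ b T u)
    (hv : IsDeterministicSolution α δ b T v) : ∀ t ∈ Icc 0 T, ∀ x, v t x = u t x := by
  obtain ⟨A, hA⟩ := hu.bounded.2
  obtain ⟨B, hB⟩ := hv.bounded.2
  have key := eq_zero_of_abs_le_integral (T := T) (D := fun t x => v t x - u t x) (A := B + A)
    (L := greenMass α δ * L)
    (fun t ht x => (abs_sub _ _).trans (add_le_add (hB t ht x) (hA t ht x)))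
    (fun φ hφ t ht hle x => by
      rw [hv.eq t ht x, hu.eq t ht x,
        duhamel_sub h (hv.bounded.comp hb.continuous) (hu.bounded.comp hb.continuous) ht,
        mul_assoc, ← intervalIntegral.integral_const_mul]
      refine abs_duhamel_le h ht.1 (hφ.const_mul (L : ℝ)) (fun s hs y => ?_) x
      refine (hb.dist_le_mul _ _).trans (mul_le_mul_of_nonneg_left ?_ L.2)
      exact hle s hs y)
  exact fun t ht x => sub_eq_zero.mp (key t ht x)

end Deterministic

/-! ### Uniqueness for the skeleton equation -/

theorem BoundedMeasurable.mul {d : ℕ} {T : ℝ} {v w : ℝ → Space d → ℝ}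
    (hv : BoundedMeasurable T v) (hw : BoundedMeasurable T w) :
    BoundedMeasurable T fun s y => v s y * w s y := by
  obtain ⟨hvm, A, hA⟩ := hv
  obtain ⟨hwm, B, hB⟩ := hw
  refine ⟨hvm.mul hwm, A * B, fun t ht x => ?_⟩
  rw [abs_mul]
  exact mul_le_mul (hA t ht x) (hB t ht x) (abs_nonneg _) ((abs_nonneg _).trans (hA t ht x))

theorem IsSkeletonSolution.unique {d : ℕ} {α δ : Fin d → ℝ} {T : ℝ} (h : Admissible α δ)
    {μ : Measure (Space d)} [μ.HasTemperateGrowth] {σ b : ℝ → ℝ} {u₀ : ℝ → Space d → ℝ}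
    (hu₀ : BoundedMeasurable T u₀) (hb : Continuous (deriv b)) {k : ControlSpace μ T}
    {Z W : ℝ → Space d → ℝ} (hZ : IsSkeletonSolution α δ μ σ b T u₀ k Z)
    (hW : IsSkeletonSolution α δ μ σ b T u₀ k W) : ∀ t ∈ Icc 0 T, ∀ x, W t x = Z t x := by
  obtain ⟨A, hA⟩ := hZ.bounded.2
  obtain ⟨B, hB⟩ := hW.bounded.2
  have hc := hu₀.comp hb
  obtain ⟨M, hM⟩ := hc.2
  have key := eq_zero_of_abs_le_integral (T := T) (D := fun t x => W t x - Z t x) (A := B + A)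
    (L := greenMass α δ * |M|)
    (fun t ht x => (abs_sub _ _).trans (add_le_add (hB t ht x) (hA t ht x)))
    (fun φ hφ t ht hle x => by
      rw [hW.eq t ht x, hZ.eq t ht x, add_sub_add_left_eq_sub,
        duhamel_sub h (hc.mul hW.bounded) (hc.mul hZ.bounded) ht,
        mul_assoc, ← intervalIntegral.integral_const_mul]
      refine abs_duhamel_le h ht.1 (hφ.const_mul |M|) (fun s hs y => ?_) x
      rw [← mul_sub, abs_mul]
      exact mul_le_mul ((hM s ⟨hs.1, hs.2.trans ht.2⟩ y).trans (le_abs_self M)) (hle s hs y)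
        (abs_nonneg _) (abs_nonneg _))
  exact fun t ht x => sub_eq_zero.mp (key t ht x)

/-! ### The kernel `ℱ G_τ(x - ⋆)` as an element of `L²(μ)` -/

section Kernel

variable {d : ℕ} {α δ : Fin d → ℝ} {μ : Measure (Space d)} {η : ℝ}

/-- The integrability condition on the spectral measure. -/
def SpectralCondition (α : Fin d → ℝ) (η : ℝ) (μ : Measure (Space d)) : Prop :=
  Integrable (fun ξ : Space d => (1 + powSum α ξ) ^ (-η)) μ

/-- An integrable function that vanishes nowhere forces the measure to be `σ`-finite. -/
theorem SpectralCondition.sigmaFinite (hμ : SpectralCondition α η μ) : SigmaFinite μ := by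
  obtain ⟨t, -, h0, hs⟩ := hμ.aefinStronglyMeasurable.exists_set_sigmaFinite
  have h1 : ∀ ξ, (1 + powSum α ξ) ^ (-η) ≠ 0 := fun ξ =>
    (Real.rpow_pos_of_pos (by linarith [powSum_nonneg α ξ]) _).ne'
  have h2 : μ.restrict tᶜ = 0 := by
    rw [← ae_eq_bot, ← eventually_false_iff_eq_bot]
    filter_upwards [h0] with ξ hξ using h1 ξ hξ
  have h3 : μ.restrict t = μ := by
    rw [Measure.restrict_eq_self_of_ae_mem]
    rw [ae_iff]
    exact Measure.restrict_eq_zero.mp h2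
  rwa [h3] at hs

/-- The Fourier transform `exp (-i ⟨x, ξ⟩) exp (-τ Ψ(ξ))` of `y ↦ G_τ(x - y)`, extended by zero
to `τ ≤ 0`. -/
def ker (α δ : Fin d → ℝ) (τ : ℝ) (x ξ : Space d) : ℂ :=
  if 0 < τ then chr x ξ * mult α δ τ ξ else 0

theorem ker_of_pos {τ : ℝ} (hτ : 0 < τ) (x ξ : Space d) :
    ker α δ τ x ξ = chr x ξ * mult α δ τ ξ := if_pos hτ

theorem ker_of_nonpos {τ : ℝ} (hτ : τ ≤ 0) (x ξ : Space d) : ker α δ τ x ξ = 0 :=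
  if_neg (not_lt.mpr hτ)

theorem measurable_ker (h : Admissible α δ) {X : Type*} [MeasurableSpace X] {f : X → ℝ}
    {g k : X → Space d} (hf : Measurable f) (hg : Measurable g) (hk : Measurable k) :
    Measurable fun z => ker α δ (f z) (g z) (k z) := by
  unfold ker
  refine Measurable.ite (measurableSet_lt measurable_const hf) ?_ measurable_const
  have := (continuous_symbol h).measurable.comp hk
  simp only [Function.comp_def] at this
  unfold chr mult
  fun_prop

theorem measurable_ker_right (h : Admissible α δ) (τ : ℝ) (x : Space d) :
    Measurable (ker α δ τ x) :=
  measurable_ker h measurable_const measurable_const measurable_id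

theorem norm_ker_of_pos {τ : ℝ} (hτ : 0 < τ) (x ξ : Space d) :
    ‖ker α δ τ x ξ‖ = ‖mult α δ τ ξ‖ := by
  rw [ker_of_pos hτ, norm_mul, norm_chr, one_mul]

/-- Square integrability of the multiplier: `exp (-2 τ κ S)` is dominated by `(1 + S) ^ (-η)`. -/
theorem integrable_norm_mult_sq (h : Admissible α δ) (hη : 0 < η) (hμ : SpectralCondition α η μ)
    {τ : ℝ} (hτ : 0 < τ) : Integrable (fun ξ => ‖mult α δ τ ξ‖ ^ 2) μ := by
  obtain ⟨κ, hκ, hsym⟩ := exists_le_symbol_re h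
  obtain ⟨C, hC, hexp⟩ := exists_rpow_mul_exp_neg_le hη.le (by positivity : 0 < 2 * τ * κ)
  have hcont : Continuous (mult α δ τ) := continuous_mult h continuous_const continuous_id
  refine (Integrable.const_mul hμ (C * Real.exp (2 * τ * κ))).mono'
    (by fun_prop) (ae_of_all _ fun ξ => ?_)
  have hS := powSum_nonneg α ξ
  rw [norm_mult, Real.norm_of_nonneg (by positivity), ← Real.exp_nat_mul]
  have h1 := hexp (1 + powSum α ξ) (by linarith)
  have h2 : Real.exp (((2 : ℕ) : ℝ) * -(τ * (symbol α δ ξ).re)) ≤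
      Real.exp (2 * τ * κ) * Real.exp (-(2 * τ * κ * (1 + powSum α ξ))) := by
    rw [← Real.exp_add, Real.exp_le_exp]
    have := mul_le_mul_of_nonneg_left (hsym ξ) hτ.le
    push_cast
    linarith
  have hp : 0 < (1 + powSum α ξ) ^ η := by positivity
  have h3 : Real.exp (-(2 * τ * κ * (1 + powSum α ξ))) ≤ C * (1 + powSum α ξ) ^ (-η) := by
    rw [Real.rpow_neg (by linarith), ← div_eq_mul_inv, le_div_iff₀ hp]
    linarith
  refine h2.trans ((mul_le_mul_of_nonneg_left h3 (Real.exp_pos _).le).trans_eq ?_)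
  ring

theorem memLp_ker (h : Admissible α δ) (hη : 0 < η) (hμ : SpectralCondition α η μ)
    (τ : ℝ) (x : Space d) : MemLp (ker α δ τ x) 2 μ := by
  rw [memLp_two_iff_integrable_sq_norm (measurable_ker_right h τ x).aestronglyMeasurable]
  rcases lt_or_ge 0 τ with hτ | hτ
  · simp only [norm_ker_of_pos hτ]
    exact integrable_norm_mult_sq h hη hμ hτ
  · simp [ker_of_nonpos hτ]

open Classical in
/-- `ker` as an element of `L²(μ)`. -/
def kerLp (μ : Measure (Space d)) (α δ : Fin d → ℝ) (τ : ℝ) (x : Space d) : Lp ℂ 2 μ :=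
  if h : MemLp (ker α δ τ x) 2 μ then h.toLp else 0

theorem kerLp_eq (h : Admissible α δ) (hη : 0 < η) (hμ : SpectralCondition α η μ)
    (τ : ℝ) (x : Space d) : kerLp μ α δ τ x = (memLp_ker h hη hμ τ x).toLp :=
  dif_pos _

theorem coeFn_kerLp (h : Admissible α δ) (hη : 0 < η) (hμ : SpectralCondition α η μ)
    (τ : ℝ) (x : Space d) : kerLp μ α δ τ x =ᵐ[μ] ker α δ τ x := by
  rw [kerLp_eq h hη hμ]
  exact MemLp.coeFn_toLp _

theorem kerLp_of_nonpos {τ : ℝ} (hτ : τ ≤ 0) (x : Space d) :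
    kerLp μ α δ τ x = 0 := by
  classical
  rw [kerLp, dite_eq_right_iff]
  intro h
  rw [← Lp.toLp_coeFn (0 : Lp ℂ 2 μ) (Lp.memLp _), MemLp.toLp_eq_toLp_iff]
  filter_upwards [Lp.coeFn_zero ℂ 2 μ] with ξ hξ
  rw [hξ, ker_of_nonpos hτ, Pi.zero_apply]

theorem enorm_sq_toLp {E : Type*} [NormedAddCommGroup E] {X : Type*} [MeasurableSpace X]
    {ν : Measure X} {f : X → E} (hf : MemLp f 2 ν) :
    ‖hf.toLp‖ₑ ^ 2 = ∫⁻ ξ, ‖f ξ‖ₑ ^ 2 ∂ν := by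
  rw [Lp.enorm_toLp, eLpNorm_eq_lintegral_rpow_enorm_toReal (by norm_num) (by norm_num),
    ← ENNReal.rpow_natCast, ← ENNReal.rpow_mul]
  simp

theorem enorm_sq_kerLp_sub (h : Admissible α δ) (hη : 0 < η) (hμ : SpectralCondition α η μ)
    (τ τ' : ℝ) (x x' : Space d) : ‖kerLp μ α δ τ x - kerLp μ α δ τ' x'‖ₑ ^ 2 =
      ∫⁻ ξ, ‖ker α δ τ x ξ - ker α δ τ' x' ξ‖ₑ ^ 2 ∂μ := by
  rw [kerLp_eq h hη hμ, kerLp_eq h hη hμ, ← MemLp.toLp_sub, enorm_sq_toLp]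
  rfl

theorem inner_kerLp (h : Admissible α δ) (hη : 0 < η) (hμ : SpectralCondition α η μ)
    (τ : ℝ) (x : Space d) (k : Lp ℂ 2 μ) :
    inner ℝ (kerLp μ α δ τ x) k = ∫ ξ, inner ℝ (ker α δ τ x ξ) (k ξ) ∂μ := by
  rw [L2.inner_def]
  refine integral_congr_ae ?_
  filter_upwards [coeFn_kerLp h hη hμ τ x] with ξ hξ
  rw [hξ]

theorem continuousAt_kerLp (h : Admissible α δ) (hη : 0 < η) (hμ : SpectralCondition α η μ)
    {τ : ℝ} (hτ : 0 < τ) (x : Space d) :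
    ContinuousAt (fun p : ℝ × Space d => kerLp μ α δ p.1 p.2) (τ, x) := by
  rw [ContinuousAt, tendsto_iff_norm_sub_tendsto_zero]
  have key : Tendsto (fun p : ℝ × Space d =>
      ∫⁻ ξ, ‖ker α δ p.1 p.2 ξ - ker α δ τ x ξ‖ₑ ^ 2 ∂μ) (𝓝 (τ, x)) (𝓝 0) := by
    have hev : ∀ᶠ p : ℝ × Space d in 𝓝 (τ, x), τ / 2 < p.1 :=
      continuousAt_fst.eventually_const_lt (half_lt_self hτ)
    have h0 : ∫⁻ _ : Space d, (0 : ℝ≥0∞) ∂μ = 0 := lintegral_zero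
    rw [← h0]
    refine tendsto_lintegral_filter_of_dominated_convergence
      (fun ξ => ENNReal.ofReal (4 * ‖mult α δ (τ / 2) ξ‖ ^ 2)) ?_ ?_ ?_ ?_
    · refine Eventually.of_forall fun p => ?_
      exact (((measurable_ker_right h p.1 p.2).sub
        (measurable_ker_right h τ x)).enorm.pow_const 2)
    · filter_upwards [hev] with p hp
      refine ae_of_all _ fun ξ => ?_
      rw [← ofReal_norm, ← ENNReal.ofReal_pow (norm_nonneg _)]
      refine ENNReal.ofReal_le_ofReal ?_
      have h1 : ‖ker α δ p.1 p.2 ξ - ker α δ τ x ξ‖ ≤ 2 * ‖mult α δ (τ / 2) ξ‖ := by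
        refine (norm_sub_le _ _).trans ?_
        rw [norm_ker_of_pos (by linarith : 0 < p.1), norm_ker_of_pos hτ, two_mul]
        exact add_le_add (norm_mult_anti h hp.le ξ) (norm_mult_anti h (by linarith) ξ)
      calc _ ≤ (2 * ‖mult α δ (τ / 2) ξ‖) ^ 2 := pow_le_pow_left₀ (norm_nonneg _) h1 2
        _ = _ := by ring
    · have := (integrable_norm_mult_sq h hη hμ (half_pos hτ)).const_mul 4
      exact (this.lintegral_lt_top).ne
    · refine ae_of_all _ fun ξ => ?_
      have hc : ContinuousAt (fun p : ℝ × Space d => ker α δ p.1 p.2 ξ) (τ, x) := by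
        have hc' : ContinuousAt (fun p : ℝ × Space d => chr p.2 ξ * mult α δ p.1 ξ) (τ, x) := by
          exact Continuous.continuousAt ((continuous_chr (by fun_prop) (by fun_prop)).mul
            (continuous_mult h (by fun_prop) (by fun_prop)))
        refine hc'.congr ?_
        filter_upwards [hev] with p hp
        exact (ker_of_pos (by linarith) _ _).symm
      have h2 : Tendsto (fun p : ℝ × Space d => ‖ker α δ p.1 p.2 ξ - ker α δ τ x ξ‖ₑ ^ 2)
          (𝓝 (τ, x)) (𝓝 (‖ker α δ τ x ξ - ker α δ τ x ξ‖ₑ ^ 2)) :=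
        ((ENNReal.continuous_pow 2).tendsto _).comp
          ((continuous_enorm.tendsto _).comp (hc.tendsto.sub_const _))
      simpa using h2
  have hsq : ∀ p : ℝ × Space d, ‖kerLp μ α δ p.1 p.2 - kerLp μ α δ τ x‖ =
      Real.sqrt (∫⁻ ξ, ‖ker α δ p.1 p.2 ξ - ker α δ τ x ξ‖ₑ ^ 2 ∂μ).toReal := by
    intro p
    rw [← enorm_sq_kerLp_sub h hη hμ, ENNReal.toReal_pow, toReal_enorm,
      Real.sqrt_sq (norm_nonneg _)]
  simp_rw [hsq]
  have := (Real.continuous_sqrt.tendsto _).comp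
    ((ENNReal.tendsto_toReal ENNReal.zero_ne_top).comp key)
  simpa [Function.comp_def] using this

/-- The kernel is cut off at `τ ≤ 0`, where continuity is lost; it is the pointwise limit of kernels
whose time is kept above `1 / (n + 1)`, which are continuous, restricted to `τ > 0`. -/
theorem stronglyMeasurable_kerLp (h : Admissible α δ) (hη : 0 < η)
    (hμ : SpectralCondition α η μ) :
    StronglyMeasurable fun p : ℝ × Space d => kerLp μ α δ p.1 p.2 := by
  have hc : ∀ n : ℕ, Continuous fun p : ℝ × Space d =>
      kerLp μ α δ (max p.1 (1 / ((n : ℝ) + 1))) p.2 := fun n => by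
    rw [continuous_iff_continuousAt]
    intro p
    have hpos : 0 < max p.1 (1 / ((n : ℝ) + 1)) := lt_max_of_lt_right (by positivity)
    have h1 : ContinuousAt (fun q : ℝ × Space d => (max q.1 (1 / ((n : ℝ) + 1)), q.2)) p := by
      fun_prop
    exact ContinuousAt.comp (f := fun q : ℝ × Space d => (max q.1 (1 / ((n : ℝ) + 1)), q.2))
      (continuousAt_kerLp h hη hμ hpos p.2) h1
  have hset : MeasurableSet {p : ℝ × Space d | 0 < p.1} :=
    measurableSet_lt measurable_const measurable_fst
  refine stronglyMeasurable_of_tendsto atTop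
    (f := fun (n : ℕ) => {p : ℝ × Space d | 0 < p.1}.indicator fun p : ℝ × Space d =>
      kerLp μ α δ (max p.1 (1 / ((n : ℝ) + 1))) p.2)
    (fun n => (hc n).stronglyMeasurable.indicator hset) ?_
  rw [tendsto_pi_nhds]
  intro p
  rcases lt_or_ge 0 p.1 with hp | hp
  · refine tendsto_const_nhds.congr' ?_
    filter_upwards [tendsto_one_div_add_atTop_nhds_zero_nat.eventually_lt_const hp] with n hn
    rw [indicator_of_mem (by exact hp), max_eq_left hn.le]
  · rw [kerLp_of_nonpos hp]
    refine tendsto_const_nhds.congr fun n => ?_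
    rw [indicator_of_notMem (by exact not_lt.mpr hp)]

/-- A character has modulus one, so the norm of the kernel does not depend on the position. -/
theorem norm_kerLp_const (h : Admissible α δ) (hη : 0 < η) (hμ : SpectralCondition α η μ)
    (τ : ℝ) (x y : Space d) : ‖kerLp μ α δ τ x‖ = ‖kerLp μ α δ τ y‖ := by
  rw [kerLp_eq h hη hμ, kerLp_eq h hη hμ, Lp.norm_toLp, Lp.norm_toLp]
  congr 1
  refine eLpNorm_congr_norm_ae (ae_of_all _ fun ξ => ?_)
  rcases lt_or_ge 0 τ with hτ | hτ
  · rw [norm_ker_of_pos hτ, norm_ker_of_pos hτ]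
  · rw [ker_of_nonpos hτ, ker_of_nonpos hτ]

/-- The semigroup property `G_τ ∗ G_r = G_{τ + r}`, tested against an element of `L²(μ)`. -/
theorem integral_green_mul_inner_kerLp (h : Admissible α δ) (hη : 0 < η)
    (hμ : SpectralCondition α η μ) {τ r : ℝ} (hτ : 0 < τ) (hr : 0 < r) (x : Space d)
    (k : Lp ℂ 2 μ) :
    ∫ y, green α δ τ (x - y) * inner ℝ (kerLp μ α δ r y) k =
      inner ℝ (kerLp μ α δ (τ + r) x) k := by
  have := hμ.sigmaFinite
  have hk := (Lp.stronglyMeasurable k).measurable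
  have hg := integrable_green_sub h hτ x
  have hmk : Integrable (fun ξ => ‖mult α δ r ξ‖ * ‖k ξ‖) μ := by
    refine MemLp.integrable_mul (p := 2) (q := 2) ?_ (Lp.memLp k).norm
    have := (memLp_ker h hη hμ r x).norm
    simpa only [norm_ker_of_pos hr] using this
  have hF : Integrable (fun p : Space d × Space d => green α δ τ (x - p.1) *
      inner ℝ (ker α δ r p.1 p.2) (k p.2)) (volume.prod μ) := by
    refine (hg.mul_prod hmk).mono ?_ (ae_of_all _ fun p => ?_)
    · refine Measurable.aestronglyMeasurable ?_
      have h1 : Measurable fun p : Space d × Space d => green α δ τ (x - p.1) :=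
        measurable_green α δ measurable_const (measurable_fst.const_sub x)
      have h2 : Measurable fun p : Space d × Space d => ker α δ r p.1 p.2 :=
        measurable_ker h measurable_const measurable_fst measurable_snd
      exact h1.mul (h2.inner (hk.comp measurable_snd))
    · rw [norm_mul, norm_mul]
      refine mul_le_mul_of_nonneg_left ?_ (norm_nonneg _)
      refine (norm_inner_le_norm _ _).trans ?_
      rw [norm_ker_of_pos hr]
      exact le_abs_self _
  have e : ∀ y, green α δ τ (x - y) * inner ℝ (kerLp μ α δ r y) k =
      ∫ ξ, green α δ τ (x - y) * inner ℝ (ker α δ r y ξ) (k ξ) ∂μ := fun y => by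
    rw [inner_kerLp h hη hμ, integral_const_mul]
  simp_rw [e]
  rw [integral_integral_swap hF, inner_kerLp h hη hμ]
  congr 1
  ext ξ
  have hint : Integrable fun y : Space d =>
      Complex.exp (-(Complex.I * (inner ℝ y ξ : ℝ))) * (green α δ τ (x - y) : ℂ) := by
    refine hg.ofReal.bdd_mul (c := 1) (by fun_prop) (ae_of_all _ fun y => ?_)
    exact (norm_chr y ξ).le
  rw [ker_of_pos (by linarith), mult_add, ← mul_assoc, chr, ← integral_exp_mul_green_sub h hτ,
    ← integral_mul_const, real_inner_comm, ← integral_inner (hint.mul_const _)]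
  congr 1
  ext y
  rw [ker_of_pos hr, real_inner_comm, ← real_inner_smul_right, Complex.real_smul, chr]
  congr 1
  ring

end Kernel

/-! ### Mean-square increments of the kernel -/

theorem norm_exp_sub_one_le_rpow {z : ℂ} (hz : z.re ≤ 0) {β : ℝ} (hβ : 0 ≤ β) (hβ1 : β ≤ 1) :
    ‖Complex.exp z - 1‖ ≤ 2 * ‖z‖ ^ β := by
  rcases le_total ‖z‖ 1 with h | h
  · refine (Complex.norm_exp_sub_one_le h).trans (mul_le_mul_of_nonneg_left ?_ zero_le_two)
    simpa using Real.rpow_le_rpow_of_exponent_ge_of_imp (norm_nonneg z) h hβ1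
      (fun _ h0 => absurd h0 one_ne_zero)
  · have h1 : ‖Complex.exp z‖ ≤ 1 := by
      rw [Complex.norm_exp]
      exact Real.exp_le_one_iff.mpr hz
    have h2 : 1 ≤ ‖z‖ ^ β := Real.one_le_rpow h hβ
    have h3 := norm_sub_le (Complex.exp z) 1
    rw [norm_one] at h3
    linarith

theorem min_le_rpow_mul_rpow {a b η : ℝ} (ha : 0 ≤ a) (hb : 0 ≤ b) (hη : 0 ≤ η) (hη1 : η ≤ 1) :
    min a b ≤ a ^ (1 - η) * b ^ η := by
  set m := min a b
  have hm : 0 ≤ m := le_min ha hb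
  have h1 : m ^ (1 - η) ≤ a ^ (1 - η) :=
    Real.rpow_le_rpow hm (min_le_left a b) (by linarith)
  have h2 : m ^ η ≤ b ^ η := Real.rpow_le_rpow hm (min_le_right a b) hη
  calc m = m ^ (1 - η) * m ^ η := by
        rw [← Real.rpow_add' hm (by norm_num), sub_add_cancel, Real.rpow_one]
    _ ≤ _ := mul_le_mul h1 h2 (by positivity) (by positivity)

/-- Time integral of the squared multiplier, uniformly in `S = ∑ᵢ |ξᵢ| ^ αᵢ`. -/
theorem lintegral_exp_le {κ T S p t : ℝ} (hκ : 0 < κ) (hS : 0 ≤ S) (hp : 0 ≤ p) (hpt : p ≤ t)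
    (htT : t ≤ T) :
    ∫⁻ s in Ico p t, ENNReal.ofReal (Real.exp (-(2 * κ * (t - s) * S))) ≤
      ENNReal.ofReal (min (t - p) (Real.exp (2 * κ * T) / (2 * κ) / (1 + S))) := by
  rw [ENNReal.ofReal_min, le_min_iff]
  constructor
  · calc _ ≤ ∫⁻ s in Ico p t, 1 := by
          refine setLIntegral_mono measurable_const fun s hs => ?_
          rw [← ENNReal.ofReal_one]
          refine ENNReal.ofReal_le_ofReal (Real.exp_le_one_iff.mpr (neg_nonpos.mpr ?_))
          have := sub_pos.mpr hs.2
          positivity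
      _ = _ := by simp
  · set lam := 2 * κ * (1 + S) with hlam
    have hl : 0 < lam := by positivity
    have hval : ∫ s in p..t, Real.exp (2 * κ * T) * Real.exp (lam * (s - t)) =
        Real.exp (2 * κ * T) * ((1 - Real.exp (lam * (p - t))) / lam) := by
      rw [intervalIntegral.integral_const_mul]
      congr 1
      have hd : ∀ s ∈ uIcc p t, HasDerivAt (fun s => Real.exp (lam * (s - t)) / lam)
          (Real.exp (lam * (s - t))) s := by
        intro s _
        have h1 : HasDerivAt (fun s => lam * (s - t)) lam s := by
          simpa using ((hasDerivAt_id s).sub_const t).const_mul lam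
        refine (h1.exp.div_const lam).congr_deriv ?_
        field_simp
      rw [intervalIntegral.integral_eq_sub_of_hasDerivAt hd
        (Continuous.intervalIntegrable (by fun_prop) _ _), sub_self, mul_zero, Real.exp_zero,
        sub_div]
    calc _ ≤ ∫⁻ s in Ico p t,
          ENNReal.ofReal (Real.exp (2 * κ * T) * Real.exp (lam * (s - t))) := by
          refine setLIntegral_mono (by fun_prop) fun s hs => ENNReal.ofReal_le_ofReal ?_
          rw [← Real.exp_add, Real.exp_le_exp, hlam]
          have : t - s ≤ T := by linarith [hs.1]
          nlinarith
      _ = ENNReal.ofReal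
          (∫ s in Ico p t, Real.exp (2 * κ * T) * Real.exp (lam * (s - t))) := by
          rw [ofReal_integral_eq_lintegral_ofReal]
          · exact (Continuous.integrableOn_Icc (by fun_prop)).mono_set Ico_subset_Icc_self
          · exact ae_of_all _ fun s => by positivity
      _ ≤ _ := by
          refine ENNReal.ofReal_le_ofReal ?_
          rw [integral_Ico_eq_integral_Ioc, ← intervalIntegral.integral_of_le hpt, hval, div_div,
            ← hlam, mul_div_assoc']
          refine div_le_div_of_nonneg_right ?_ hl.le
          refine mul_le_of_le_one_right (Real.exp_pos _).le ?_
          linarith [Real.exp_pos (lam * (p - t))]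

section Increments

variable {d : ℕ} {α δ : Fin d → ℝ} {μ : Measure (Space d)} {η T : ℝ}

theorem norm_mult_sq_le {κ : ℝ} (hsym : ∀ ξ, κ * powSum α ξ ≤ (symbol α δ ξ).re) {τ : ℝ}
    (hτ : 0 ≤ τ) (ξ : Space d) :
    ‖mult α δ τ ξ‖ ^ 2 ≤ Real.exp (-(2 * κ * τ * powSum α ξ)) := by
  rw [norm_mult, ← Real.exp_nat_mul, Real.exp_le_exp]
  have := mul_le_mul_of_nonneg_left (hsym ξ) hτ
  push_cast
  linarith

theorem rpow_mul_inv_le {u : ℝ} (hu : 0 ≤ u) (hη1 : η ≤ 1) :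
    u ^ (1 - η) * (1 + u)⁻¹ ≤ (1 + u) ^ (-η) := by
  have h1 : u ^ (1 - η) ≤ (1 + u) ^ (1 - η) :=
    Real.rpow_le_rpow hu (by linarith) (by linarith)
  have hpos : 0 < 1 + u := by linarith
  calc _ ≤ (1 + u) ^ (1 - η) * (1 + u)⁻¹ :=
        mul_le_mul_of_nonneg_right h1 (by positivity)
    _ = (1 + u) ^ (-η) := by
        rw [← Real.rpow_neg_one (1 + u), ← Real.rpow_add hpos]
        congr 1
        ring

/-- Time increments of the kernel at a fixed frequency: for `s < t'` the factor
`|exp (-(t - t') Ψ) - 1|²` is at most `4 ((t - t') S) ^ (1 - η)`, and for `t' ≤ s < t` only the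
kernel at time `t` is present; `S = powSum α ξ` bounds the symbol `Ψ`, and the time integral gains
the factor `1 / (1 + S)`. -/
theorem exists_lintegral_ker_time_le (h : Admissible α δ) (hη : 0 < η) (hη1 : η ≤ 1) :
    ∃ C, 0 ≤ C ∧ ∀ t' t, 0 ≤ t' → t' ≤ t → t ≤ T → ∀ x ξ : Space d,
      ∫⁻ s in Icc 0 T, ‖ker α δ (t - s) x ξ - ker α δ (t' - s) x ξ‖ₑ ^ 2 ≤
        ENNReal.ofReal (C * (t - t') ^ (1 - η) * (1 + powSum α ξ) ^ (-η)) := by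
  obtain ⟨κ, hκ, hsym⟩ := exists_le_symbol_re h
  set A := Real.exp (2 * κ * T) / (2 * κ) with hA
  have hA0 : 0 < A := by positivity
  refine ⟨A ^ η + 4 * A, by positivity, fun t' t ht' htt htT x ξ => ?_⟩
  set S := powSum α ξ with hS_def
  have hS : 0 ≤ S := powSum_nonneg α ξ
  set e : ℝ → ℝ → ℝ≥0∞ := fun t s => ENNReal.ofReal (Real.exp (-(2 * κ * (t - s) * S))) with he
  have hem : ∀ t, Measurable (e t) := fun t => by
    rw [he]
    fun_prop
  set c := 4 * ((t - t') * S) ^ (1 - η) with hc_def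
  have hτ : 0 ≤ t - t' := sub_nonneg.mpr htt
  have hc : 0 ≤ c := by positivity
  have hpt : ∀ s ∈ Icc 0 T, ‖ker α δ (t - s) x ξ - ker α δ (t' - s) x ξ‖ₑ ^ 2 ≤
      (Ico t' t).indicator (e t) s +
        (Ico 0 t').indicator (fun s => ENNReal.ofReal c * e t' s) s := by
    intro s hs
    have hsq : ∀ z : ℂ, ‖z‖ₑ ^ 2 = ENNReal.ofReal (‖z‖ ^ 2) := fun z => by
      rw [← ofReal_norm, ← ENNReal.ofReal_pow (norm_nonneg _)]
    rcases lt_or_ge s t' with h1 | h1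
    · have h2 : 0 < t' - s := sub_pos.mpr h1
      have h3 : 0 < t - s := by linarith
      rw [indicator_of_notMem (fun hh => absurd hh.1 (not_le.mpr h1)), zero_add,
        indicator_of_mem (by exact ⟨hs.1, h1⟩), he]
      simp only
      rw [← ENNReal.ofReal_mul hc, hsq]
      refine ENNReal.ofReal_le_ofReal ?_
      have hsplit : ker α δ (t - s) x ξ - ker α δ (t' - s) x ξ =
          chr x ξ * mult α δ (t' - s) ξ * (mult α δ (t - t') ξ - 1) := by
        rw [ker_of_pos h3, ker_of_pos h2, show t - s = (t' - s) + (t - t') by ring, mult_add]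
        ring
      have hexp : ‖mult α δ (t - t') ξ - 1‖ ≤ 2 * ((t - t') * S) ^ ((1 - η) / 2) := by
        refine (norm_exp_sub_one_le_rpow (β := (1 - η) / 2) ?_ (by linarith)
          (by linarith)).trans ?_
        · rw [Complex.neg_re, Complex.re_ofReal_mul]
          exact neg_nonpos.mpr (mul_nonneg hτ (symbol_re_nonneg h ξ))
        · refine mul_le_mul_of_nonneg_left (Real.rpow_le_rpow (norm_nonneg _) ?_ (by linarith))
            zero_le_two
          rw [norm_neg, norm_mul, Complex.norm_real, Real.norm_of_nonneg hτ]
          exact mul_le_mul_of_nonneg_left (norm_symbol_le α δ ξ) hτ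
      have hexp2 : ‖mult α δ (t - t') ξ - 1‖ ^ 2 ≤ c := by
        refine (pow_le_pow_left₀ (norm_nonneg _) hexp 2).trans_eq ?_
        rw [mul_pow, ← Real.rpow_natCast (((t - t') * S) ^ ((1 - η) / 2)),
          ← Real.rpow_mul (by positivity), hc_def]
        norm_num
      rw [hsplit, norm_mul, norm_mul, norm_chr, one_mul, mul_pow, mul_comm]
      exact mul_le_mul hexp2 (norm_mult_sq_le hsym h2.le ξ) (by positivity) hc
    · rw [ker_of_nonpos (by linarith : t' - s ≤ 0), sub_zero]
      rcases lt_or_ge s t with h2 | h2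
      · refine le_trans ?_ le_self_add
        rw [indicator_of_mem (by exact ⟨h1, h2⟩), hsq, norm_ker_of_pos (by linarith)]
        exact ENNReal.ofReal_le_ofReal (norm_mult_sq_le hsym (by linarith) ξ)
      · rw [ker_of_nonpos (by linarith)]
        simp
  calc _ ≤ ∫⁻ s in Icc 0 T, ((Ico t' t).indicator (e t) s +
        (Ico 0 t').indicator (fun s => ENNReal.ofReal c * e t' s) s) := by
        refine setLIntegral_mono ?_ hpt
        exact ((hem t).indicator measurableSet_Ico).add
          (((hem t').const_mul _).indicator measurableSet_Ico)
    _ ≤ ∫⁻ s, ((Ico t' t).indicator (e t) s +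
        (Ico 0 t').indicator (fun s => ENNReal.ofReal c * e t' s) s) :=
        setLIntegral_le_lintegral _ _
    _ = (∫⁻ s in Ico t' t, e t s) + ENNReal.ofReal c * ∫⁻ s in Ico 0 t', e t' s := by
        rw [lintegral_add_left ((hem t).indicator measurableSet_Ico),
          lintegral_indicator measurableSet_Ico, lintegral_indicator measurableSet_Ico,
          lintegral_const_mul _ (hem t')]
    _ ≤ ENNReal.ofReal ((t - t') ^ (1 - η) * (A / (1 + S)) ^ η) +
        ENNReal.ofReal c * ENNReal.ofReal (A / (1 + S)) := by
        refine add_le_add ?_ (mul_le_mul_right ?_ _)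
        · refine (lintegral_exp_le hκ hS ht' htt htT).trans (ENNReal.ofReal_le_ofReal ?_)
          exact min_le_rpow_mul_rpow hτ (by positivity) hη.le hη1
        · exact (lintegral_exp_le hκ hS le_rfl ht' (htt.trans htT)).trans
            (ENNReal.ofReal_le_ofReal (min_le_right _ _))
    _ ≤ _ := by
        rw [← ENNReal.ofReal_mul hc, ← ENNReal.ofReal_add (by positivity) (by positivity)]
        refine ENNReal.ofReal_le_ofReal ?_
        have e1 : (A / (1 + S)) ^ η = A ^ η * (1 + S) ^ (-η) := by
          rw [Real.div_rpow hA0.le (by positivity), Real.rpow_neg (by positivity),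
            div_eq_mul_inv]
        have e2 := rpow_mul_inv_le hS hη1
        have e3 : c * (A / (1 + S)) =
            4 * A * (t - t') ^ (1 - η) * (S ^ (1 - η) * (1 + S)⁻¹) := by
          rw [hc_def, Real.mul_rpow hτ hS]
          ring
        have e4 : 0 ≤ 4 * A * (t - t') ^ (1 - η) := by positivity
        rw [e1, e3]
        have := mul_le_mul_of_nonneg_left e2 e4
        linarith

/-- The Euclidean norm is controlled by `(1 + ∑ᵢ |ξᵢ| ^ αᵢ) ^ (1 / a)` for `a ≤ minᵢ αᵢ`. -/
theorem norm_le_powSum_rpow {a : ℝ} (ha : 0 < a) (haα : ∀ i, a ≤ α i) (ξ : Space d) :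
    ‖ξ‖ ≤ d * (1 + powSum α ξ) ^ (1 / a) := by
  have h1 : ‖ξ‖ ≤ ∑ i, |ξ i| := by
    have hsq : ‖ξ‖ ^ 2 ≤ (∑ i, |ξ i|) ^ 2 := by
      rw [EuclideanSpace.norm_sq_eq]
      refine (Finset.sum_le_sum fun i _ => le_rfl).trans
        (Finset.sum_sq_le_sq_sum_of_nonneg fun i _ => abs_nonneg _)
    exact le_of_sq_le_sq hsq (Finset.sum_nonneg fun i _ => abs_nonneg _)
  have hS := powSum_nonneg α ξ
  have h2 : ∀ i, |ξ i| ≤ (1 + powSum α ξ) ^ (1 / a) := fun i => by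
    have hi : 0 < α i := ha.trans_le (haα i)
    have h3 : |ξ i| ^ α i ≤ 1 + powSum α ξ := by
      have : |ξ i| ^ α i ≤ powSum α ξ :=
        Finset.single_le_sum (f := fun i => |ξ i| ^ α i) (fun j _ => by positivity)
          (Finset.mem_univ i)
      linarith
    calc |ξ i| = (|ξ i| ^ α i) ^ (1 / α i) := by
          rw [← Real.rpow_mul (abs_nonneg _), mul_one_div_cancel hi.ne', Real.rpow_one]
      _ ≤ (1 + powSum α ξ) ^ (1 / α i) := Real.rpow_le_rpow (by positivity) h3 (by positivity)
      _ ≤ _ := Real.rpow_le_rpow_of_exponent_le (by linarith)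
          (one_div_le_one_div_of_le ha (haα i))
  calc _ ≤ _ := h1
    _ ≤ ∑ _i : Fin d, (1 + powSum α ξ) ^ (1 / a) := Finset.sum_le_sum fun i _ => h2 i
    _ = _ := by simp

/-- Space increments of the kernel at a fixed frequency: they come from the character only, and the
time integral gains the factor `1 / (1 + S)`, `S = powSum α ξ`. -/
theorem exists_lintegral_ker_space_le (h : Admissible α δ) (hη : 0 < η) (hη1 : η ≤ 1)
    {a : ℝ} (ha : 0 < a) (ha2 : a ≤ 2) (haα : ∀ i, a ≤ α i) :
    ∃ C, 0 ≤ C ∧ ∀ t, 0 ≤ t → t ≤ T → ∀ x y ξ : Space d,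
      ∫⁻ s in Icc 0 T, ‖ker α δ (t - s) x ξ - ker α δ (t - s) y ξ‖ₑ ^ 2 ≤
        ENNReal.ofReal (C * ‖x - y‖ ^ (a * (1 - η)) * (1 + powSum α ξ) ^ (-η)) := by
  obtain ⟨κ, hκ, hsym⟩ := exists_le_symbol_re h
  set A := Real.exp (2 * κ * T) / (2 * κ) with hA
  have hA0 : 0 < A := by positivity
  refine ⟨4 * (d : ℝ) ^ (a * (1 - η)) * A, by positivity, fun t ht htT x y ξ => ?_⟩
  set S := powSum α ξ with hS_def
  have hS : 0 ≤ S := powSum_nonneg α ξ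
  set e : ℝ → ℝ≥0∞ := fun s => ENNReal.ofReal (Real.exp (-(2 * κ * (t - s) * S))) with he
  have hem : Measurable e := by
    rw [he]
    fun_prop
  have hη0 : 0 ≤ a * (1 - η) := mul_nonneg ha.le (by linarith)
  set c := 4 * (‖x - y‖ * ‖ξ‖) ^ (a * (1 - η)) with hc_def
  have hc : 0 ≤ c := by positivity
  have hchr : ‖chr x ξ - chr y ξ‖ ^ 2 ≤ c := by
    have h1 : chr x ξ - chr y ξ =
        chr y ξ * (Complex.exp (-(Complex.I * (inner ℝ (x - y) ξ : ℝ))) - 1) := by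
      rw [mul_sub, mul_one, chr, chr, ← Complex.exp_add, inner_sub_left]
      congr 2
      push_cast
      ring
    have h2 : ‖chr x ξ - chr y ξ‖ ≤ 2 * (‖x - y‖ * ‖ξ‖) ^ (a * (1 - η) / 2) := by
      rw [h1, norm_mul, norm_chr, one_mul]
      refine (norm_exp_sub_one_le_rpow (β := a * (1 - η) / 2) (by simp) (by linarith)
        (by nlinarith)).trans ?_
      refine mul_le_mul_of_nonneg_left (Real.rpow_le_rpow (norm_nonneg _) ?_ (by linarith))
        zero_le_two
      rw [norm_neg, norm_mul, Complex.norm_I, one_mul, Complex.norm_real]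
      exact norm_inner_le_norm _ _
    refine (pow_le_pow_left₀ (norm_nonneg _) h2 2).trans_eq ?_
    rw [mul_pow, ← Real.rpow_natCast ((‖x - y‖ * ‖ξ‖) ^ (a * (1 - η) / 2)),
      ← Real.rpow_mul (by positivity), hc_def]
    norm_num
  have hpt : ∀ s ∈ Icc 0 T, ‖ker α δ (t - s) x ξ - ker α δ (t - s) y ξ‖ₑ ^ 2 ≤
      (Ico 0 t).indicator (fun s => ENNReal.ofReal c * e s) s := by
    intro s hs
    rcases lt_or_ge s t with h1 | h1
    · have h2 : 0 < t - s := sub_pos.mpr h1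
      rw [indicator_of_mem (by exact ⟨hs.1, h1⟩), he]
      simp only
      rw [← ENNReal.ofReal_mul hc, ← ofReal_norm, ← ENNReal.ofReal_pow (norm_nonneg _)]
      refine ENNReal.ofReal_le_ofReal ?_
      rw [ker_of_pos h2, ker_of_pos h2, ← sub_mul, norm_mul, mul_pow]
      exact mul_le_mul hchr (norm_mult_sq_le hsym h2.le ξ) (by positivity) hc
    · rw [ker_of_nonpos (by linarith), ker_of_nonpos (by linarith)]
      simp
  have hSη : ‖ξ‖ ^ (a * (1 - η)) * (1 + S)⁻¹ ≤ (d : ℝ) ^ (a * (1 - η)) * (1 + S) ^ (-η) := by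
    have h1 : ‖ξ‖ ^ (a * (1 - η)) ≤ (d : ℝ) ^ (a * (1 - η)) * (1 + S) ^ (1 - η) := by
      refine (Real.rpow_le_rpow (norm_nonneg _) (norm_le_powSum_rpow ha haα ξ) hη0).trans_eq ?_
      rw [Real.mul_rpow (by positivity) (by positivity), ← Real.rpow_mul (by positivity)]
      congr 2
      field_simp
    refine (mul_le_mul_of_nonneg_right h1 (by positivity)).trans_eq ?_
    rw [mul_assoc, ← Real.rpow_neg_one (1 + S), ← Real.rpow_add (by positivity)]
    congr 2
    ring
  calc _ ≤ ∫⁻ s in Icc 0 T, (Ico 0 t).indicator (fun s => ENNReal.ofReal c * e s) s :=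
        setLIntegral_mono ((hem.const_mul _).indicator measurableSet_Ico) hpt
    _ ≤ ∫⁻ s, (Ico 0 t).indicator (fun s => ENNReal.ofReal c * e s) s :=
        setLIntegral_le_lintegral _ _
    _ = ENNReal.ofReal c * ∫⁻ s in Ico 0 t, e s := by
        rw [lintegral_indicator measurableSet_Ico, lintegral_const_mul _ hem]
    _ ≤ ENNReal.ofReal c * ENNReal.ofReal (A / (1 + S)) := by
        refine mul_le_mul_right ?_ _
        exact (lintegral_exp_le hκ hS le_rfl ht htT).trans
          (ENNReal.ofReal_le_ofReal (min_le_right _ _))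
    _ ≤ _ := by
        rw [← ENNReal.ofReal_mul hc]
        refine ENNReal.ofReal_le_ofReal ?_
        have e3 : c * (A / (1 + S)) =
            4 * A * ‖x - y‖ ^ (a * (1 - η)) * (‖ξ‖ ^ (a * (1 - η)) * (1 + S)⁻¹) := by
          rw [hc_def, Real.mul_rpow (norm_nonneg _) (norm_nonneg _)]
          ring
        have e4 : 0 ≤ 4 * A * ‖x - y‖ ^ (a * (1 - η)) := by positivity
        rw [e3]
        have := mul_le_mul_of_nonneg_left hSη e4
        linarith

/-- The norm of `L²(μ)` is computed frequency by frequency, so that Tonelli's theorem reduces the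
mean-square increments of the kernel to those at a fixed frequency. -/
theorem lintegral_enorm_sq_kerLp_sub (h : Admissible α δ) (hη : 0 < η)
    (hμ : SpectralCondition α η μ) (t t' : ℝ) (x x' : Space d) :
    ∫⁻ s in Icc 0 T, ‖kerLp μ α δ (t - s) x - kerLp μ α δ (t' - s) x'‖ₑ ^ 2 =
      ∫⁻ ξ, (∫⁻ s in Icc 0 T, ‖ker α δ (t - s) x ξ - ker α δ (t' - s) x' ξ‖ₑ ^ 2) ∂μ := by
  have := hμ.sigmaFinite
  simp_rw [enorm_sq_kerLp_sub h hη hμ]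
  refine lintegral_lintegral_swap (Measurable.aemeasurable ?_)
  have h1 : ∀ (t : ℝ) (x : Space d), Measurable fun p : ℝ × Space d => ker α δ (t - p.1) x p.2 :=
    fun t x => measurable_ker h (measurable_fst.const_sub t) measurable_const measurable_snd
  exact ((h1 t x).sub (h1 t' x')).enorm.pow_const 2

theorem lintegral_const_mul_powSum_le (hμ : SpectralCondition α η μ) {F : Space d → ℝ≥0∞} {C : ℝ}
    (hC : 0 ≤ C) (hF : ∀ ξ, F ξ ≤ ENNReal.ofReal (C * (1 + powSum α ξ) ^ (-η))) :
    ∫⁻ ξ, F ξ ∂μ ≤ ENNReal.ofReal (C * ∫ ξ, (1 + powSum α ξ) ^ (-η) ∂μ) := by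
  rw [← integral_const_mul, ofReal_integral_eq_lintegral_ofReal (hμ.const_mul C)
    (ae_of_all _ fun ξ => ?_)]
  · exact lintegral_mono hF
  · have := powSum_nonneg α ξ
    positivity

/-- Mean-square time increments of the kernel. -/
theorem exists_lintegral_kerLp_time_le (h : Admissible α δ) (hη : 0 < η) (hη1 : η ≤ 1)
    (hμ : SpectralCondition α η μ) :
    ∃ C, 0 ≤ C ∧ ∀ t' t, 0 ≤ t' → t' ≤ t → t ≤ T → ∀ x : Space d,
      ∫⁻ s in Icc 0 T, ‖kerLp μ α δ (t - s) x - kerLp μ α δ (t' - s) x‖ₑ ^ 2 ≤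
        ENNReal.ofReal (C * (t - t') ^ (1 - η)) := by
  obtain ⟨C, hC, hle⟩ := exists_lintegral_ker_time_le (T := T) h hη hη1
  set A := ∫ ξ, (1 + powSum α ξ) ^ (-η) ∂μ with hA
  have hA0 : 0 ≤ A := integral_nonneg fun ξ => by
    have := powSum_nonneg α ξ
    positivity
  refine ⟨C * A, by positivity, fun t' t ht' htt htT x => ?_⟩
  rw [lintegral_enorm_sq_kerLp_sub h hη hμ]
  have hτ : 0 ≤ t - t' := sub_nonneg.mpr htt
  refine (lintegral_const_mul_powSum_le hμ (by positivity)
    (hle t' t ht' htt htT x)).trans_eq ?_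
  rw [mul_right_comm]

/-- Mean-square space increments of the kernel. -/
theorem exists_lintegral_kerLp_space_le (h : Admissible α δ) (hη : 0 < η) (hη1 : η ≤ 1)
    (hμ : SpectralCondition α η μ) {a : ℝ} (ha : 0 < a) (ha2 : a ≤ 2) (haα : ∀ i, a ≤ α i) :
    ∃ C, 0 ≤ C ∧ ∀ t, 0 ≤ t → t ≤ T → ∀ x y : Space d,
      ∫⁻ s in Icc 0 T, ‖kerLp μ α δ (t - s) x - kerLp μ α δ (t - s) y‖ₑ ^ 2 ≤
        ENNReal.ofReal (C * ‖x - y‖ ^ (a * (1 - η))) := by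
  obtain ⟨C, hC, hle⟩ := exists_lintegral_ker_space_le (T := T) h hη hη1 ha ha2 haα
  set A := ∫ ξ, (1 + powSum α ξ) ^ (-η) ∂μ with hA
  have hA0 : 0 ≤ A := integral_nonneg fun ξ => by
    have := powSum_nonneg α ξ
    positivity
  refine ⟨C * A, by positivity, fun t ht htT x y => ?_⟩
  rw [lintegral_enorm_sq_kerLp_sub h hη hμ]
  refine (lintegral_const_mul_powSum_le hμ (by positivity) (hle t ht htT x y)).trans_eq ?_
  rw [mul_right_comm]

end Increments

/-! ### The functionals `h ↦ ∫₀ᵗ g(s) ⟨G_{t-s}(x - ⋆), h(s)⟩ ds` -/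

theorem norm_toLp_le_sqrt {X E : Type*} [MeasurableSpace X] [NormedAddCommGroup E]
    {ν : Measure X} {f : X → E} (hf : MemLp f 2 ν) {B : ℝ} (hB : 0 ≤ B)
    (h : ∫⁻ s, ‖f s‖ₑ ^ 2 ∂ν ≤ ENNReal.ofReal B) : ‖hf.toLp‖ ≤ Real.sqrt B := by
  refine Real.le_sqrt_of_sq_le ?_
  rw [← enorm_sq_toLp hf, ← ofReal_norm, ← ENNReal.ofReal_pow (norm_nonneg _),
    ENNReal.ofReal_le_ofReal_iff hB] at h
  exact h

section Functional

variable {d : ℕ} {α δ : Fin d → ℝ} {μ : Measure (Space d)} {η T : ℝ}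

theorem stronglyMeasurable_kerLp_sub (h : Admissible α δ) (hη : 0 < η)
    (hμ : SpectralCondition α η μ) (t : ℝ) (x : Space d) :
    StronglyMeasurable fun s => kerLp μ α δ (t - s) x :=
  (stronglyMeasurable_kerLp h hη hμ).comp_measurable
    ((measurable_id.const_sub t).prodMk measurable_const)

/-- For `t ∈ [0,T]` the kernel is square integrable in time. -/
theorem memLp_kerLp_sub (h : Admissible α δ) (hη : 0 < η) (hη1 : η ≤ 1)
    (hμ : SpectralCondition α η μ) {t : ℝ} (ht : t ∈ Icc 0 T) (x : Space d) :
    MemLp (fun s => kerLp μ α δ (t - s) x) 2 (volume.restrict (Icc 0 T)) := by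
  obtain ⟨C, -, hle⟩ := exists_lintegral_kerLp_time_le (T := T) h hη hη1 hμ
  refine ⟨(stronglyMeasurable_kerLp_sub h hη hμ t x).aestronglyMeasurable, ?_⟩
  rw [eLpNorm_lt_top_iff_lintegral_rpow_enorm_lt_top (by norm_num) (by norm_num)]
  have h1 := hle 0 t le_rfl ht.1 ht.2 x
  refine lt_of_le_of_lt (le_of_eq ?_) (h1.trans_lt ENNReal.ofReal_lt_top)
  refine setLIntegral_congr_fun measurableSet_Icc fun s hs => ?_
  rw [kerLp_of_nonpos (by linarith [hs.1] : (0 : ℝ) - s ≤ 0), sub_zero, ENNReal.toReal_ofNat,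
    ENNReal.rpow_ofNat]

variable [μ.HasTemperateGrowth]

/-- A control seen as an `L²(μ)`-valued function. -/
theorem stronglyMeasurable_control (k : ControlSpace μ T) :
    StronglyMeasurable fun s => ((k s : CovSpace μ) : Lp ℂ 2 μ) :=
  continuous_subtype_val.comp_stronglyMeasurable (Lp.stronglyMeasurable k)

theorem memLp_control (k : ControlSpace μ T) :
    MemLp (fun s => ((k s : CovSpace μ) : Lp ℂ 2 μ)) 2 (volume.restrict (Icc 0 T)) := by
  refine MemLp.of_le (Lp.memLp k) (stronglyMeasurable_control k).aestronglyMeasurable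
    (ae_of_all _ fun s => le_of_eq ?_)
  rfl

theorem integrableOn_inner_kerLp (h : Admissible α δ) (hη : 0 < η) (hη1 : η ≤ 1)
    (hμ : SpectralCondition α η μ) {t : ℝ} (ht : t ∈ Icc 0 T) (x : Space d)
    (k : ControlSpace μ T) :
    IntegrableOn (fun s => inner ℝ (kerLp μ α δ (t - s) x) (k s : Lp ℂ 2 μ)) (Icc 0 T) := by
  have h1 := memLp_kerLp_sub h hη hη1 hμ ht x
  have h2 := memLp_control k
  refine (h1.norm.integrable_mul (p := 2) (q := 2) h2.norm).mono
    ((stronglyMeasurable_kerLp_sub h hη hμ t x).inner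
      (stronglyMeasurable_control k)).aestronglyMeasurable (ae_of_all _ fun s => ?_)
  refine (norm_inner_le_norm _ _).trans ?_
  exact le_abs_self _

theorem intervalIntegral_eq_setIntegral_of_kerLp {t : ℝ} (ht : t ∈ Icc 0 T) (x : Space d)
    (g : ℝ → ℝ) (k : ControlSpace μ T) :
    ∫ s in (0 : ℝ)..t, g s * inner ℝ (kerLp μ α δ (t - s) x) (k s : Lp ℂ 2 μ) =
      ∫ s in Ioc 0 T, g s * inner ℝ (kerLp μ α δ (t - s) x) (k s : Lp ℂ 2 μ) := by
  rw [intervalIntegral.integral_of_le ht.1]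
  refine (setIntegral_eq_of_subset_of_forall_sdiff_eq_zero measurableSet_Ioc
    (Ioc_subset_Ioc_right ht.2) fun s hs => ?_).symm
  have : t - s ≤ 0 := by
    by_contra hcon
    exact hs.2 ⟨hs.1.1, by linarith⟩
  rw [kerLp_of_nonpos this, inner_zero_left, mul_zero]

/-- The functionals are continuous and Hölder continuous in `(t, x)`, uniformly on balls, with the
limiting exponents `(1 - η) / 2` in time and `a (1 - η) / 2` in space. -/
theorem exists_functional (h : Admissible α δ) (hη : 0 < η) (hη1 : η ≤ 1)
    (hμ : SpectralCondition α η μ) {a : ℝ} (ha : 0 < a) (ha2 : a ≤ 2) (haα : ∀ i, a ≤ α i)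
    {g : ℝ → ℝ} (hg : Continuous g) :
    ∃ (Λ : ℝ → Space d → ControlSpace μ T →L[ℝ] ℝ) (C : ℝ), 0 ≤ C ∧
      (∀ t ∈ Icc 0 T, ∀ x k, Λ t x k =
        ∫ s in (0 : ℝ)..t, g s * inner ℝ (kerLp μ α δ (t - s) x) (k s : Lp ℂ 2 μ)) ∧
      (∀ t' t, 0 ≤ t' → t' ≤ t → t ≤ T → ∀ x k,
        |Λ t x k - Λ t' x k| ≤ C * (t - t') ^ ((1 - η) / 2) * ‖k‖) ∧
      ∀ t ∈ Icc 0 T, ∀ x y k, |Λ t x k - Λ t y k| ≤ C * ‖x - y‖ ^ (a * (1 - η) / 2) * ‖k‖ := by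
  classical
  set ν : Measure ℝ := volume.restrict (Icc 0 T) with hν
  obtain ⟨C₁, hC₁, hle₁⟩ := exists_lintegral_kerLp_time_le (T := T) h hη hη1 hμ
  obtain ⟨C₂, hC₂, hle₂⟩ := exists_lintegral_kerLp_space_le (T := T) h hη hη1 hμ ha ha2 haα
  obtain ⟨M₀, hM₀⟩ := isCompact_Icc.exists_bound_of_continuousOn (s := Icc 0 T) hg.continuousOn
  set M := max M₀ 0 with hM_def
  have hM0 : 0 ≤ M := le_max_right _ _
  have hM : ∀ s ∈ Icc 0 T, ‖g s‖ ≤ M := fun s hs => (hM₀ s hs).trans (le_max_left _ _)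
  have hmem : ∀ t ∈ Icc 0 T, ∀ x,
      MemLp (fun s => g s • kerLp μ α δ (t - s) x) 2 ν := by
    intro t ht x
    refine (memLp_kerLp_sub h hη hη1 hμ ht x).of_le_mul (c := M)
      (hg.stronglyMeasurable.smul
        (stronglyMeasurable_kerLp_sub h hη hμ t x)).aestronglyMeasurable ?_
    filter_upwards [ae_restrict_mem measurableSet_Icc] with s hs
    rw [norm_smul]
    exact mul_le_mul_of_nonneg_right (hM s hs) (norm_nonneg _)
  set V : ℝ → Space d → Lp (Lp ℂ 2 μ) 2 ν := fun t x =>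
    if ht : t ∈ Icc 0 T then (hmem t ht x).toLp else 0 with hV
  have hVeq : ∀ t (ht : t ∈ Icc 0 T) x, V t x = (hmem t ht x).toLp := fun t ht x => by
    rw [hV]
    exact dif_pos ht
  set ι : ControlSpace μ T →L[ℝ] Lp (Lp ℂ 2 μ) 2 ν := (covSubspace μ).subtypeL.compLpL 2 ν with hι
  have hιn : ∀ k, ‖ι k‖ ≤ ‖k‖ := by
    intro k
    refine Lp.norm_le_norm_of_ae_le ?_
    filter_upwards [ContinuousLinearMap.coeFn_compLpL (covSubspace μ).subtypeL k] with s hs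
    rw [hι, hs]
    exact le_rfl
  have hdiff : ∀ t (_ : t ∈ Icc 0 T) t' (_ : t' ∈ Icc 0 T) x x', ∀ B : ℝ, 0 ≤ B →
      ∫⁻ s in Icc 0 T, ‖kerLp μ α δ (t - s) x - kerLp μ α δ (t' - s) x'‖ₑ ^ 2 ≤
        ENNReal.ofReal B → ‖V t x - V t' x'‖ ≤ Real.sqrt (M ^ 2 * B) := by
    intro t ht t' ht' x x' B hB hle
    rw [hVeq t ht, hVeq t' ht', ← MemLp.toLp_sub]
    refine norm_toLp_le_sqrt _ (by positivity) ?_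
    rw [ENNReal.ofReal_mul (by positivity)]
    refine le_trans ?_ (mul_le_mul_right hle _)
    rw [← lintegral_const_mul' _ _ ENNReal.ofReal_ne_top]
    refine setLIntegral_mono' measurableSet_Icc fun s hs => ?_
    rw [Pi.sub_apply, ← smul_sub, enorm_smul, mul_pow]
    refine mul_le_mul_left ?_ _
    rw [← ofReal_norm, ← ENNReal.ofReal_pow (norm_nonneg _)]
    exact ENNReal.ofReal_le_ofReal (pow_le_pow_left₀ (norm_nonneg _) (hM s hs) 2)
  have hΛ : ∀ (v w : Lp (Lp ℂ 2 μ) 2 ν) (B : ℝ), ‖v - w‖ ≤ B → ∀ k,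
      |(innerSL ℝ v).comp ι k - (innerSL ℝ w).comp ι k| ≤ B * ‖k‖ := by
    intro v w B hB k
    have : (innerSL ℝ v).comp ι k - (innerSL ℝ w).comp ι k = inner ℝ (v - w) (ι k) := by
      simp [inner_sub_left]
    rw [this]
    exact (norm_inner_le_norm (𝕜 := ℝ) _ _).trans
      (mul_le_mul hB (hιn k) (norm_nonneg _) ((norm_nonneg _).trans hB))
  refine ⟨fun t x => (innerSL ℝ (V t x)).comp ι, M * Real.sqrt C₁ + M * Real.sqrt C₂,
    by positivity, fun t ht x k => ?_, fun t' t ht' htt htT x k => ?_, fun t ht x y k => ?_⟩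
  · rw [ContinuousLinearMap.comp_apply, innerSL_apply_apply, L2.inner_def,
      intervalIntegral_eq_setIntegral_of_kerLp ht, ← integral_Icc_eq_integral_Ioc]
    refine integral_congr_ae ?_
    have h1 : V t x =ᵐ[ν] fun s => g s • kerLp μ α δ (t - s) x := by
      rw [hVeq t ht]
      exact MemLp.coeFn_toLp _
    filter_upwards [h1, ContinuousLinearMap.coeFn_compLpL (covSubspace μ).subtypeL k]
      with s hs1 hs2
    rw [hι, hs1, hs2, real_inner_smul_left]
    rfl
  · have hτ : 0 ≤ t - t' := sub_nonneg.mpr htt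
    refine hΛ _ _ _ ((hdiff t ⟨ht'.trans htt, htT⟩ t' ⟨ht', htt.trans htT⟩ x x
      _ (by positivity) (hle₁ t' t ht' htt htT x)).trans ?_) k
    rw [Real.sqrt_mul (by positivity), Real.sqrt_sq hM0, Real.sqrt_mul hC₁,
      Real.sqrt_eq_rpow ((t - t') ^ (1 - η)), ← Real.rpow_mul hτ, ← mul_assoc, mul_one_div]
    refine mul_le_mul_of_nonneg_right ?_ (by positivity)
    exact le_add_of_nonneg_right (by positivity)
  · refine hΛ _ _ _ ((hdiff t ht t ht x y _ (by positivity)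
      (hle₂ t ht.1 ht.2 x y)).trans ?_) k
    rw [Real.sqrt_mul (by positivity), Real.sqrt_sq hM0, Real.sqrt_mul hC₂,
      Real.sqrt_eq_rpow (‖x - y‖ ^ (a * (1 - η))), ← Real.rpow_mul (norm_nonneg _), ← mul_assoc,
      mul_one_div]
    refine mul_le_mul_of_nonneg_right ?_ (by positivity)
    exact le_add_of_nonneg_left (by positivity)

end Functional

/-! ### The explicit solution of the skeleton equation -/

/-- Integration by parts against a primitive, by Fubini's theorem on the triangle. -/
theorem integral_deriv_mul_primitive {φ φ' J : ℝ → ℝ} {t : ℝ} (ht : 0 ≤ t)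
    (hφ : ∀ s, HasDerivAt φ (φ' s) s) (hφ' : Continuous φ')
    (hJ : IntegrableOn J (Ioc 0 t)) :
    ∫ s in (0 : ℝ)..t, φ' s * ∫ r in (0 : ℝ)..s, J r =
      ∫ r in (0 : ℝ)..t, (φ t - φ r) * J r := by
  rw [intervalIntegral.integral_of_le ht, intervalIntegral.integral_of_le ht]
  have hprod : Integrable (fun p : ℝ × ℝ => φ' p.1 * J p.2)
      ((volume.restrict (Ioc 0 t)).prod (volume.restrict (Ioc 0 t))) :=
    Integrable.mul_prod ((hφ'.integrableOn_Icc).mono_set Ioc_subset_Icc_self) hJ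
  have htri : MeasurableSet {p : ℝ × ℝ | p.2 ≤ p.1} :=
    measurableSet_le measurable_snd measurable_fst
  have hswap := integral_integral_swap (f := fun s r =>
    {p : ℝ × ℝ | p.2 ≤ p.1}.indicator (fun p : ℝ × ℝ => φ' p.1 * J p.2) (s, r))
    (hprod.indicator htri)
  have e1 : ∀ s ∈ Ioc 0 t, φ' s * ∫ r in (0 : ℝ)..s, J r = ∫ r in Ioc 0 t,
      {p : ℝ × ℝ | p.2 ≤ p.1}.indicator (fun p : ℝ × ℝ => φ' p.1 * J p.2) (s, r) := by
    intro s hs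
    have : ∀ r, {p : ℝ × ℝ | p.2 ≤ p.1}.indicator (fun p : ℝ × ℝ => φ' p.1 * J p.2) (s, r) =
        (Iic s).indicator (fun r => φ' s * J r) r := fun r => by
      simp only [indicator, mem_ofPred_eq, mem_Iic]
    simp_rw [this]
    rw [setIntegral_indicator measurableSet_Iic, Ioc_inter_Iic, min_eq_right hs.2,
      integral_const_mul, intervalIntegral.integral_of_le hs.1.le]
  have e2 : ∀ r ∈ Ioc 0 t, (φ t - φ r) * J r = ∫ s in Ioc 0 t,
      {p : ℝ × ℝ | p.2 ≤ p.1}.indicator (fun p : ℝ × ℝ => φ' p.1 * J p.2) (s, r) := by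
    intro r hr
    have : ∀ s, {p : ℝ × ℝ | p.2 ≤ p.1}.indicator (fun p : ℝ × ℝ => φ' p.1 * J p.2) (s, r) =
        (Ici r).indicator (fun s => φ' s * J r) s := fun s => by
      simp only [indicator, mem_ofPred_eq, mem_Ici]
    simp_rw [this]
    have hset : Ioc 0 t ∩ Ici r = Icc r t := by
      ext s
      simp only [mem_inter_iff, mem_Ioc, mem_Ici, mem_Icc]
      constructor
      · rintro ⟨⟨-, h2⟩, h3⟩
        exact ⟨h3, h2⟩
      · rintro ⟨h1, h2⟩
        exact ⟨⟨hr.1.trans_le h1, h2⟩, h1⟩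
    rw [setIntegral_indicator measurableSet_Ici, hset, integral_mul_const,
      integral_Icc_eq_integral_Ioc, ← intervalIntegral.integral_of_le hr.2,
      intervalIntegral.integral_eq_sub_of_hasDerivAt (fun s _ => hφ s)
        (hφ'.intervalIntegrable _ _)]
  rw [setIntegral_congr_fun measurableSet_Ioc e1, setIntegral_congr_fun measurableSet_Ioc e2]
  exact hswap

section Skeleton

variable {d : ℕ} {α δ : Fin d → ℝ} {μ : Measure (Space d)} {η T : ℝ}

/-- `y ↦ G_τ(x - y) c` defines an element of `ℋ`. -/
theorem hasCovNorm_green_sub_mul (h : Admissible α δ) (hη : 0 < η)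
    (hμ : SpectralCondition α η μ) {τ : ℝ} (hτ : 0 < τ) (x : Space d) (c : ℝ) :
    HasCovNorm μ fun y => green α δ τ (x - y) * c := by
  refine ⟨(integrable_green_sub h hτ x).mul_const c, ?_⟩
  have : (fourierT fun y => ((green α δ τ (x - y) * c : ℝ) : ℂ)) =
      fun ξ => (c : ℂ) * ker α δ τ x ξ := by
    ext ξ
    rw [fourierT_green_sub_mul h hτ, ker_of_pos hτ]
  rw [this]
  exact (memLp_ker h hη hμ τ x).const_mul (c : ℂ)

theorem covPairing_green_sub_mul [μ.HasTemperateGrowth] (h : Admissible α δ) (hη : 0 < η)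
    (hμ : SpectralCondition α η μ) {τ : ℝ} (hτ : 0 < τ) (x : Space d) (c : ℝ) (k : CovSpace μ) :
    covPairing μ (fun y => green α δ τ (x - y) * c) k =
      c * inner ℝ (kerLp μ α δ τ x) (k : Lp ℂ 2 μ) := by
  have hf := hasCovNorm_green_sub_mul h hη hμ hτ x c
  rw [covPairing, dif_pos hf, ← real_inner_smul_left, kerLp_eq h hη hμ, ← MemLp.toLp_const_smul]
  congr 1
  refine MemLp.toLp_congr _ _ (ae_of_all _ fun ξ => ?_)
  rw [fourierT_green_sub_mul h hτ, Pi.smul_apply, ker_of_pos hτ, Complex.real_smul]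

/-- The operator `G_{t-s} ∗` carries the functional at time `s` to the same integral over `[0, s]`
with the kernel at time `t`, by the semigroup property. -/
theorem integral_green_mul_functional [μ.HasTemperateGrowth] (h : Admissible α δ) (hη : 0 < η)
    (hη1 : η ≤ 1) (hμ : SpectralCondition α η μ) {g : ℝ → ℝ} (hg : Continuous g)
    {s t : ℝ} (hs : 0 ≤ s) (hst : s < t) (htT : t ≤ T) (x : Space d) (k : ControlSpace μ T) :
    ∫ y, green α δ (t - s) (x - y) *
        ∫ r in (0 : ℝ)..s, g r * inner ℝ (kerLp μ α δ (s - r) y) (k r : Lp ℂ 2 μ) =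
      ∫ r in (0 : ℝ)..s, g r * inner ℝ (kerLp μ α δ (t - r) x) (k r : Lp ℂ 2 μ) := by
  have hts : 0 < t - s := sub_pos.mpr hst
  have hG := integrable_green_sub h hts x
  have hsub : Ioc 0 s ⊆ Icc 0 T := fun r hr => ⟨hr.1.le, hr.2.trans (hst.le.trans htT)⟩
  have hdom : Integrable (fun r => g r * (‖kerLp μ α δ (s - r) (0 : Space d)‖ *
      ‖(k r : Lp ℂ 2 μ)‖)) (volume.restrict (Ioc 0 s)) := by
    have h1 : IntegrableOn (fun r => ‖kerLp μ α δ (s - r) (0 : Space d)‖ *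
        ‖(k r : Lp ℂ 2 μ)‖) (Icc 0 T) :=
      (memLp_kerLp_sub h hη hη1 hμ ⟨hs, hst.le.trans htT⟩ 0).norm.integrable_mul (p := 2) (q := 2)
        (memLp_control k).norm
    have h2 := h1.continuousOn_mul hg.continuousOn isCompact_Icc
    exact IntegrableOn.mono_set h2 hsub
  have hF : Integrable (fun p : Space d × ℝ => green α δ (t - s) (x - p.1) *
      (g p.2 * inner ℝ (kerLp μ α δ (s - p.2) p.1) (k p.2 : Lp ℂ 2 μ)))
      (volume.prod (volume.restrict (Ioc 0 s))) := by
    refine (hG.mul_prod hdom).mono ?_ (ae_of_all _ fun p => ?_)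
    · refine StronglyMeasurable.aestronglyMeasurable ?_
      have m1 : Measurable fun p : Space d × ℝ => green α δ (t - s) (x - p.1) :=
        measurable_green α δ measurable_const (measurable_fst.const_sub x)
      have m2 : StronglyMeasurable fun p : Space d × ℝ => kerLp μ α δ (s - p.2) p.1 :=
        (stronglyMeasurable_kerLp h hη hμ).comp_measurable
          ((measurable_snd.const_sub s).prodMk measurable_fst)
      have m3 : StronglyMeasurable fun p : Space d × ℝ => (k p.2 : Lp ℂ 2 μ) :=
        (stronglyMeasurable_control k).comp_measurable measurable_snd
      have m4 : StronglyMeasurable fun p : Space d × ℝ => g p.2 :=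
        hg.stronglyMeasurable.comp_measurable measurable_snd
      exact m1.stronglyMeasurable.mul (m4.mul (m2.inner m3))
    · rw [norm_mul, norm_mul, norm_mul, norm_mul]
      refine mul_le_mul_of_nonneg_left (mul_le_mul_of_nonneg_left ?_ (norm_nonneg _))
        (norm_nonneg _)
      refine (norm_inner_le_norm _ _).trans ?_
      rw [norm_kerLp_const h hη hμ (s - p.2) p.1 0, norm_mul, norm_norm, norm_norm]
  simp_rw [intervalIntegral.integral_of_le hs, ← integral_const_mul]
  rw [integral_integral_swap hF]
  refine integral_congr_ae ?_
  have hne : ∀ᵐ r : ℝ ∂(volume.restrict (Ioc 0 s)), r ≠ s :=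
    ae_restrict_of_ae (by simp [ae_iff])
  filter_upwards [hne, ae_restrict_mem measurableSet_Ioc] with r hr hr'
  have hsr : 0 < s - r := sub_pos.mpr (lt_of_le_of_ne hr'.2 hr)
  have h1 := integral_green_mul_inner_kerLp h hη hμ hts hsr x (k r : Lp ℂ 2 μ)
  rw [show t - s + (s - r) = t - r by ring] at h1
  rw [← h1, ← integral_const_mul]
  congr 1
  ext y
  ring

end Skeleton

section SkeletonSolution

variable {d : ℕ} {α δ : Fin d → ℝ} {μ : Measure (Space d)} {η T : ℝ} [μ.HasTemperateGrowth]

theorem measurable_functional (h : Admissible α δ) (hη : 0 < η) (hμ : SpectralCondition α η μ)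
    {g : ℝ → ℝ} (hg : Continuous g) (k : ControlSpace μ T) :
    Measurable fun p : Icc (0 : ℝ) T × Space d =>
      ∫ s in (0 : ℝ)..p.1, g s * inner ℝ (kerLp μ α δ (p.1 - s) p.2) (k s : Lp ℂ 2 μ) := by
  simp_rw [intervalIntegral_eq_setIntegral_of_kerLp (Subtype.coe_prop _)]
  refine StronglyMeasurable.measurable (StronglyMeasurable.integral_prod_right'
    (f := fun q : (Icc (0 : ℝ) T × Space d) × ℝ =>
      g q.2 * inner ℝ (kerLp μ α δ (q.1.1 - q.2) q.1.2) (k q.2 : Lp ℂ 2 μ)) ?_)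
  have m1 : StronglyMeasurable fun q : (Icc (0 : ℝ) T × Space d) × ℝ =>
      kerLp μ α δ (q.1.1 - q.2) q.1.2 :=
    (stronglyMeasurable_kerLp h hη hμ).comp_measurable
      (((measurable_subtype_coe.comp (measurable_fst.comp measurable_fst)).sub
        measurable_snd).prodMk (measurable_snd.comp measurable_fst))
  have m2 : StronglyMeasurable fun q : (Icc (0 : ℝ) T × Space d) × ℝ => (k q.2 : Lp ℂ 2 μ) :=
    (stronglyMeasurable_control k).comp_measurable measurable_snd
  exact (hg.stronglyMeasurable.comp_measurable measurable_snd).mul (m1.inner m2)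

/-- Variation of constants: since `u⁰(t, x) = f(t)` does not depend on `x`, the skeleton equation
is solved by `exp (∫₀ᵗ b'(f)) ∫₀ᵗ exp (-∫₀ˢ b'(f)) σ(f(s)) ⟨G_{t-s}(x - ⋆), k(s)⟩ ds`. -/
theorem isSkeletonSolution_exp_mul (h : Admissible α δ) (hη : 0 < η) (hη1 : η ≤ 1)
    (hμ : SpectralCondition α η μ) {σ b f A : ℝ → ℝ} (hσ : Continuous σ)
    (hb : Continuous (deriv b)) (hf : Continuous f) (hA : ∀ s, HasDerivAt A (deriv b (f s)) s)
    (k : ControlSpace μ T) {Λ : ℝ → Space d → ℝ} (hΛ : ∀ t ∈ Icc 0 T, ∀ x, Λ t x =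
      ∫ s in (0 : ℝ)..t, Real.exp (-A s) * σ (f s) *
        inner ℝ (kerLp μ α δ (t - s) x) (k s : Lp ℂ 2 μ))
    {B : ℝ} (hB : ∀ t ∈ Icc 0 T, ∀ x, |Λ t x| ≤ B) :
    IsSkeletonSolution α δ μ σ b T (fun t _ => f t) k
      fun t x => Real.exp (A t) * Λ t x := by
  have hAc : Continuous A := continuous_iff_continuousAt.mpr fun s => (hA s).continuousAt
  have hgc : Continuous fun s => Real.exp (-A s) * σ (f s) := by fun_prop
  have hσf : Continuous fun s => σ (f s) := hσ.comp hf
  have hne : ∀ t : ℝ, ∀ᵐ s : ℝ, s ≠ t := fun t => by simp [ae_iff]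
  -- away from the diagonal the pairing is an inner product with the `L²(μ)`-valued kernel
  have hpair : ∀ t x, ∀ s < t, covPairing μ (kernelFun α δ σ (fun t _ => f t) t x s) (k s) =
      σ (f s) * inner ℝ (kerLp μ α δ (t - s) x) (k s : Lp ℂ 2 μ) := fun t x s hs =>
    covPairing_green_sub_mul h hη hμ (sub_pos.mpr hs) x (σ (f s)) (k s)
  have hint : ∀ t ∈ Icc 0 T, ∀ x, ∀ g : ℝ → ℝ, Continuous g → IntegrableOn
      (fun s => g s * inner ℝ (kerLp μ α δ (t - s) x) (k s : Lp ℂ 2 μ)) (Ioc 0 t) := by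
    intro t ht x g hg
    refine IntegrableOn.mono_set (t := Icc 0 T) ?_
      (fun r hr => ⟨hr.1.le, hr.2.trans ht.2⟩)
    exact (integrableOn_inner_kerLp h hη hη1 hμ ht x k).continuousOn_mul hg.continuousOn
      isCompact_Icc
  have hcongr : ∀ t ∈ Icc 0 T, ∀ x, ∀ᵐ s : ℝ, s ∈ uIoc 0 t →
      covPairing μ (kernelFun α δ σ (fun t _ => f t) t x s) (k s) =
        σ (f s) * inner ℝ (kerLp μ α δ (t - s) x) (k s : Lp ℂ 2 μ) := by
    intro t ht x
    filter_upwards [hne t] with s hs hs'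
    rw [uIoc_of_le ht.1] at hs'
    exact hpair t x s (lt_of_le_of_ne hs'.2 hs)
  refine ⟨⟨?_, ?_⟩, fun t ht x => ae_of_all _ fun s hs => ?_, fun t ht x => ?_, fun t ht x => ?_⟩
  · have e : (fun p : Icc (0 : ℝ) T × Space d => Λ p.1 p.2) = fun p => _ :=
      funext fun p => hΛ p.1 p.1.2 p.2
    refine Measurable.mul ?_ ?_
    · exact (Real.continuous_exp.comp hAc).measurable.comp
        (measurable_subtype_coe.comp measurable_fst)
    · rw [e]
      exact measurable_functional h hη hμ hgc k
  · obtain ⟨M, hM⟩ := isCompact_Icc.exists_bound_of_continuousOn (s := Icc 0 T)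
      (Real.continuous_exp.comp hAc).continuousOn
    refine ⟨M * B, fun t ht x => ?_⟩
    rw [abs_mul]
    exact mul_le_mul (hM t ht) (hB t ht x) (abs_nonneg _) ((norm_nonneg _).trans (hM t ht))
  · exact hasCovNorm_green_sub_mul h hη hμ (sub_pos.mpr hs.2) x (σ (f s))
  · have h1 : IntervalIntegrable (fun s => σ (f s) *
        inner ℝ (kerLp μ α δ (t - s) x) (k s : Lp ℂ 2 μ)) volume 0 t :=
      (intervalIntegrable_iff_integrableOn_Ioc_of_le ht.1).mpr (hint t ht x _ hσf)
    refine h1.congr_ae ?_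
    refine (ae_restrict_iff' measurableSet_uIoc).mpr ?_
    filter_upwards [hcongr t ht x] with s hs hs'
    exact (hs hs').symm
  · have hφ : ∀ s, HasDerivAt (fun s => Real.exp (A s)) (Real.exp (A s) * deriv b (f s)) s :=
      fun s => (hA s).exp
    have hφ' : Continuous fun s => Real.exp (A s) * deriv b (f s) := by fun_prop
    have hduh : duhamel α δ (fun s y => deriv b (f s) * (Real.exp (A s) * Λ s y)) t x =
        ∫ s in (0 : ℝ)..t, Real.exp (A s) * deriv b (f s) * ∫ r in (0 : ℝ)..s,
          Real.exp (-A r) * σ (f r) * inner ℝ (kerLp μ α δ (t - r) x) (k r : Lp ℂ 2 μ) := by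
      refine intervalIntegral.integral_congr_ae ?_
      filter_upwards [hne t] with s hs hs'
      rw [uIoc_of_le ht.1] at hs'
      rw [← integral_green_mul_functional h hη hη1 hμ hgc hs'.1.le (lt_of_le_of_ne hs'.2 hs) ht.2,
        ← integral_const_mul]
      congr 1
      ext y
      rw [hΛ s ⟨hs'.1.le, hs'.2.trans ht.2⟩]
      ring
    rw [hduh, integral_deriv_mul_primitive ht.1 hφ hφ' (hint t ht x _ hgc),
      intervalIntegral.integral_congr_ae (hcongr t ht x), ← intervalIntegral.integral_add,
      hΛ t ht, ← intervalIntegral.integral_const_mul]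
    · refine intervalIntegral.integral_congr fun s _ => ?_
      have : Real.exp (A s) * Real.exp (-A s) = 1 := by rw [← Real.exp_add]; simp
      linear_combination (σ (f s) * inner ℝ (kerLp μ α δ (t - s) x) (k s : Lp ℂ 2 μ)) * this
    · exact (intervalIntegrable_iff_integrableOn_Ioc_of_le ht.1).mpr (hint t ht x _ hσf)
    · refine (intervalIntegrable_iff_integrableOn_Ioc_of_le ht.1).mpr ?_
      have h2 := hint t ht x (fun s => (Real.exp (A t) - Real.exp (A s)) *
        (Real.exp (-A s) * σ (f s))) (by fun_prop)
      simpa only [mul_assoc] using h2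

end SkeletonSolution

/-! ### From weak convergence to convergence in the Hölder space -/

section HolderGauge

variable {d : ℕ} {T : ℝ} {K : Set (Space d)} {β₁ β₂ b₁ b₂ : ℝ}

theorem rpow_le_mul_rpow {x β b ε : ℝ} (hx : 0 ≤ x) (hβ : 0 ≤ β) (hb : β < b) (hε : 0 < ε)
    (h : x ≤ ε ^ (1 / (b - β))) : x ^ b ≤ ε * x ^ β := by
  have hbβ : 0 < b - β := sub_pos.mpr hb
  calc x ^ b = x ^ (b - β) * x ^ β := by
        rw [← Real.rpow_add_of_nonneg hx hbβ.le hβ, sub_add_cancel]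
    _ ≤ ε * x ^ β := by
        refine mul_le_mul_of_nonneg_right ?_ (Real.rpow_nonneg hx _)
        refine (Real.rpow_le_rpow hx h hbβ.le).trans_eq ?_
        rw [← Real.rpow_mul hε.le, one_div_mul_cancel hbβ.ne', Real.rpow_one]

/-- The gap between the exponents makes the stronger gauge negligible near the diagonal. -/
theorem exists_holderGauge_le_mul (hβ₁ : 0 ≤ β₁) (hb₁ : β₁ < b₁) (hβ₂ : 0 ≤ β₂) (hb₂ : β₂ < b₂)
    {ε : ℝ} (hε : 0 < ε) : ∃ ρ > 0, ∀ p q : Icc (0 : ℝ) T × K,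
      |(p.1 : ℝ) - q.1| + ‖(p.2 : Space d) - q.2‖ < ρ →
        holderGauge b₁ b₂ p q ≤ ε * holderGauge β₁ β₂ p q := by
  refine ⟨min (ε ^ (1 / (b₁ - β₁))) (ε ^ (1 / (b₂ - β₂))),
    lt_min (Real.rpow_pos_of_pos hε _) (Real.rpow_pos_of_pos hε _), fun p q h => ?_⟩
  obtain ⟨h1, h2⟩ := lt_min_iff.mp h
  have hx := abs_nonneg ((p.1 : ℝ) - q.1)
  have hy := norm_nonneg ((p.2 : Space d) - q.2)
  unfold holderGauge
  rw [mul_add]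
  exact add_le_add (rpow_le_mul_rpow hx hβ₁ hb₁ hε (by linarith))
    (rpow_le_mul_rpow hy hβ₂ hb₂ hε (by linarith))

theorem exists_le_holderGauge (hβ₁ : 0 ≤ β₁) (hβ₂ : 0 ≤ β₂) {ρ : ℝ} (hρ : 0 < ρ) :
    ∃ m > 0, ∀ p q : Icc (0 : ℝ) T × K,
      ρ ≤ |(p.1 : ℝ) - q.1| + ‖(p.2 : Space d) - q.2‖ → m ≤ holderGauge β₁ β₂ p q := by
  refine ⟨min ((ρ / 2) ^ β₁) ((ρ / 2) ^ β₂), lt_min (Real.rpow_pos_of_pos (half_pos hρ) _)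
    (Real.rpow_pos_of_pos (half_pos hρ) _), fun p q h => ?_⟩
  have hx := abs_nonneg ((p.1 : ℝ) - q.1)
  have hy := norm_nonneg ((p.2 : Space d) - q.2)
  unfold holderGauge
  rcases le_total (ρ / 2) |(p.1 : ℝ) - q.1| with h1 | h1
  · refine (min_le_left _ _).trans ((Real.rpow_le_rpow (half_pos hρ).le h1 hβ₁).trans ?_)
    exact le_add_of_nonneg_right (Real.rpow_nonneg hy _)
  · have h2 : ρ / 2 ≤ ‖(p.2 : Space d) - q.2‖ := by linarith
    refine (min_le_right _ _).trans
      ((Real.rpow_le_rpow (half_pos hρ).le h2 hβ₂).trans ?_)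
    exact le_add_of_nonneg_left (Real.rpow_nonneg hx _)

theorem holderQuot_le {f : Icc (0 : ℝ) T × K → ℝ} {p q : Icc (0 : ℝ) T × K} {D ε : ℝ}
    (hD : 0 ≤ D) (hε : 0 ≤ ε) (hf : |f p - f q| ≤ D * holderGauge b₁ b₂ p q)
    (h : holderGauge b₁ b₂ p q ≤ ε * holderGauge β₁ β₂ p q) : holderQuot β₁ β₂ f p q ≤ ε * D := by
  refine div_le_of_le_mul₀ (holderGauge_nonneg p q) (mul_nonneg hε hD) (hf.trans ?_)
  calc D * holderGauge b₁ b₂ p q ≤ D * (ε * holderGauge β₁ β₂ p q) :=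
        mul_le_mul_of_nonneg_left h hD
    _ = ε * D * holderGauge β₁ β₂ p q := by ring

/-- Interpolation between the supremum norm and a stronger Hölder seminorm. -/
theorem exists_holderQuot_le (hβ₁ : 0 ≤ β₁) (hb₁ : β₁ < b₁) (hβ₂ : 0 ≤ β₂) (hb₂ : β₂ < b₂)
    {ε : ℝ} (hε : 0 < ε) : ∃ A : ℝ, 0 ≤ A ∧ ∀ (f : Icc (0 : ℝ) T × K → ℝ) (D S : ℝ), 0 ≤ D → 0 ≤ S →
      (∀ p q, |f p - f q| ≤ D * holderGauge b₁ b₂ p q) → (∀ p, |f p| ≤ S) →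
      ∀ p q, holderQuot β₁ β₂ f p q ≤ ε * D + A * S := by
  obtain ⟨ρ, hρ, hnear⟩ := exists_holderGauge_le_mul (T := T) (K := K) hβ₁ hb₁ hβ₂ hb₂ hε
  obtain ⟨m, hm, hfar⟩ := exists_le_holderGauge (T := T) (K := K) hβ₁ hβ₂ hρ
  refine ⟨2 / m, by positivity, fun f D S hD hS hf hfS p q => ?_⟩
  rcases lt_or_ge (|(p.1 : ℝ) - q.1| + ‖(p.2 : Space d) - q.2‖) ρ with h | h
  · exact (holderQuot_le hD hε.le (hf p q) (hnear p q h)).trans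
      (le_add_of_nonneg_right (by positivity))
  · have h1 : |f p - f q| ≤ 2 * S := by
      have := abs_sub (f p) (f q)
      linarith [hfS p, hfS q]
    have h2 : holderQuot β₁ β₂ f p q ≤ 2 * S / m :=
      div_le_div₀ (by positivity) h1 hm (hfar p q h)
    refine h2.trans ?_
    rw [mul_div_right_comm]
    exact le_add_of_nonneg_left (by positivity)

theorem isLittleHolder_of_abs_sub_le (hβ₁ : 0 ≤ β₁) (hb₁ : β₁ < b₁) (hβ₂ : 0 ≤ β₂)
    (hb₂ : β₂ < b₂) {f : Icc (0 : ℝ) T × K → ℝ} {D S : ℝ} (hD : 0 ≤ D) (hS : 0 ≤ S)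
    (hf : ∀ p q, |f p - f q| ≤ D * holderGauge b₁ b₂ p q) (hfS : ∀ p, |f p| ≤ S) :
    IsLittleHolder β₁ β₂ f := by
  refine ⟨⟨S, hfS⟩, ?_, fun ε hε => ?_⟩
  · obtain ⟨A, -, hA⟩ := exists_holderQuot_le (T := T) (K := K) hβ₁ hb₁ hβ₂ hb₂ one_pos
    exact ⟨1 * D + A * S, fun p q _ => hA f D S hD hS hf hfS p q⟩
  · obtain ⟨ρ, hρ, hnear⟩ := exists_holderGauge_le_mul (T := T) (K := K) hβ₁ hb₁ hβ₂ hb₂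
      (ε := ε / (D + 1)) (by positivity)
    refine ⟨ρ, hρ, fun p q _ h => ?_⟩
    refine (holderQuot_le hD (by positivity) (hf p q) (hnear p q h)).trans ?_
    rw [div_mul_eq_mul_div, div_le_iff₀ (by positivity)]
    nlinarith

theorem holderNorm_le {f : Icc (0 : ℝ) T × K → ℝ} {S Q : ℝ} (hS : 0 ≤ S) (hQ : 0 ≤ Q)
    (hfS : ∀ p, |f p| ≤ S) (hfQ : ∀ p q, holderQuot β₁ β₂ f p q ≤ Q) :
    holderNorm β₁ β₂ f ≤ S + Q :=
  add_le_add (Real.iSup_le hfS hS) (Real.iSup_le (fun _ => hfQ _ _) hQ)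

theorem tendsto_holderGauge (hb₁ : 0 < b₁) (hb₂ : 0 < b₂) (p : Icc (0 : ℝ) T × K) :
    Tendsto (fun q => holderGauge b₁ b₂ q p) (𝓝 p) (𝓝 0) := by
  have hc : Continuous fun q : Icc (0 : ℝ) T × K => holderGauge b₁ b₂ q p := by
    unfold holderGauge
    refine Continuous.add ?_ ?_
    · exact Continuous.rpow_const (by fun_prop) fun _ => Or.inr hb₁.le
    · exact Continuous.rpow_const (by fun_prop) fun _ => Or.inr hb₂.le
  have h0 : holderGauge b₁ b₂ p p = 0 := by
    simp [holderGauge, Real.zero_rpow hb₁.ne', Real.zero_rpow hb₂.ne']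
  simpa only [h0] using hc.tendsto p

end HolderGauge

section WeakTopology

variable {d : ℕ} {T : ℝ} {K : Set (Space d)} {β₁ β₂ b₁ b₂ : ℝ}
  {E : Type*} [NormedAddCommGroup E] [InnerProductSpace ℝ E]

theorem continuous_toWeakSpace_symm_apply (φ : E →L[ℝ] ℝ) :
    Continuous fun w : WeakSpace ℝ E => φ ((toWeakSpace ℝ E).symm w) :=
  WeakBilin.eval_continuous (topDualPairing ℝ E).flip φ

/-- The closed balls of a Hilbert space are weakly compact. -/
theorem isCompact_weak_ball [CompleteSpace E] (N : ℝ) :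
    IsCompact {w : WeakSpace ℝ E | ‖(toWeakSpace ℝ E).symm w‖ ≤ N} := by
  set Ψ : WeakDual ℝ E → WeakSpace ℝ E := fun φ =>
    toWeakSpace ℝ E ((InnerProductSpace.toDual ℝ E).symm (WeakDual.toStrongDual φ)) with hΨ
  have hc : Continuous Ψ := by
    refine WeakBilin.continuous_of_continuous_eval _ fun y => ?_
    have : (fun φ => (topDualPairing ℝ E).flip (Ψ φ) y) = fun φ : WeakDual ℝ E =>
        φ ((InnerProductSpace.toDual ℝ E).symm y) := by
      funext φ
      change y ((InnerProductSpace.toDual ℝ E).symm (WeakDual.toStrongDual φ)) = _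
      rw [← InnerProductSpace.toDual_symm_apply (y := y), real_inner_comm,
        InnerProductSpace.toDual_symm_apply]
      rfl
    rw [this]
    exact WeakDual.eval_continuous _
  have himage : {w : WeakSpace ℝ E | ‖(toWeakSpace ℝ E).symm w‖ ≤ N} =
      Ψ '' (WeakDual.toStrongDual ⁻¹' Metric.closedBall 0 N) := by
    ext w
    simp only [mem_ofPred_eq, mem_image, mem_preimage, mem_closedBall_zero_iff]
    constructor
    · intro hw
      refine ⟨StrongDual.toWeakDual (InnerProductSpace.toDual ℝ E ((toWeakSpace ℝ E).symm w)),
        ?_, ?_⟩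
      · simpa using hw
      · simp [hΨ]
    · rintro ⟨φ, hφ, rfl⟩
      simpa [hΨ] using hφ
  rw [himage]
  exact (WeakDual.isCompact_closedBall 0 N).image hc

/-- A family of functionals which is Hölder continuous in its parameters, uniformly on balls, with
exponents larger than `β₁`, `β₂`, maps weakly convergent bounded nets to nets converging in the
Hölder space: weak convergence is uniform on the compact parameter set, and the gap between the
exponents turns uniform convergence into convergence of the Hölder seminorm. -/
theorem exists_holderSpace_map [CompleteSpace E] (hK : IsCompact K) (hβ₁ : 0 < β₁) (hb₁ : β₁ < b₁)
    (hβ₂ : 0 < β₂) (hb₂ : β₂ < b₂) (F : Icc (0 : ℝ) T × K → E →L[ℝ] ℝ) {B C : ℝ} (hB : 0 ≤ B)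
    (hC : 0 ≤ C) (hFB : ∀ p k, |F p k| ≤ B * ‖k‖)
    (hFC : ∀ p q k, |F p k - F q k| ≤ C * holderGauge b₁ b₂ p q * ‖k‖) :
    ∃ Φ : E → HolderSpace T K β₁ β₂, (∀ k p, (Φ k).val p = F p k) ∧ ∀ N : ℝ,
      ContinuousOn (fun w : WeakSpace ℝ E => Φ ((toWeakSpace ℝ E).symm w))
        {w | ‖(toWeakSpace ℝ E).symm w‖ ≤ N} ∧ IsCompact (Φ '' {k | ‖k‖ ≤ N}) := by
  have : CompactSpace K := isCompact_iff_compactSpace.mp hK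
  have hmem : ∀ k, IsLittleHolder β₁ β₂ fun p => F p k := fun k =>
    isLittleHolder_of_abs_sub_le hβ₁.le hb₁ hβ₂.le hb₂ (D := C * ‖k‖) (S := B * ‖k‖)
      (by positivity) (by positivity) (fun p q => (hFC p q k).trans_eq (by ring))
      (fun p => hFB p k)
  set Φ : E → HolderSpace T K β₁ β₂ := fun k => ⟨fun p => F p k, hmem k⟩ with hΦ
  have hval : ∀ k p, (Φ k).val p = F p k := fun k p => rfl
  have hcont : ∀ N : ℝ, ContinuousOn (fun w : WeakSpace ℝ E => Φ ((toWeakSpace ℝ E).symm w))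
      {w | ‖(toWeakSpace ℝ E).symm w‖ ≤ N} := by
    intro N w₀ hw₀
    have hN : 0 ≤ N := (norm_nonneg _).trans hw₀
    set D : ℝ := C * (2 * N) with hD
    have hD0 : 0 ≤ D := by positivity
    have hdiff : ∀ w : WeakSpace ℝ E, ‖(toWeakSpace ℝ E).symm w‖ ≤ N → ∀ p q,
        |F p ((toWeakSpace ℝ E).symm w - (toWeakSpace ℝ E).symm w₀) -
          F q ((toWeakSpace ℝ E).symm w - (toWeakSpace ℝ E).symm w₀)| ≤
            D * holderGauge b₁ b₂ p q := by
      intro w hw p q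
      have hkN : ‖(toWeakSpace ℝ E).symm w - (toWeakSpace ℝ E).symm w₀‖ ≤ 2 * N := by
        refine (norm_sub_le _ _).trans ?_
        have : ‖(toWeakSpace ℝ E).symm w₀‖ ≤ N := hw₀
        linarith
      refine (hFC p q _).trans ?_
      rw [hD, mul_right_comm]
      exact mul_le_mul_of_nonneg_right (mul_le_mul_of_nonneg_left hkN hC)
        (holderGauge_nonneg p q)
    -- weak convergence is uniform in the parameter
    have hunif : ∀ ε > 0, ∀ᶠ w : WeakSpace ℝ E in 𝓝[{w | ‖(toWeakSpace ℝ E).symm w‖ ≤ N}] w₀,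
        ∀ p, |F p ((toWeakSpace ℝ E).symm w - (toWeakSpace ℝ E).symm w₀)| ≤ ε := by
      intro ε hε
      have hU : ∀ p : Icc (0 : ℝ) T × K,
          {q | D * holderGauge b₁ b₂ q p < ε / 2} ∈ 𝓝 p := by
        intro p
        have h1 := (tendsto_holderGauge (hβ₁.trans hb₁) (hβ₂.trans hb₂) p).const_mul D
        rw [mul_zero] at h1
        exact h1.eventually (gt_mem_nhds (half_pos hε))
      obtain ⟨s, -, hs⟩ := isCompact_univ.elim_nhds_subcover _ fun p _ => hU p
      have hfin : ∀ᶠ w : WeakSpace ℝ E in 𝓝[{w | ‖(toWeakSpace ℝ E).symm w‖ ≤ N}] w₀,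
          ∀ p ∈ s, |F p ((toWeakSpace ℝ E).symm w - (toWeakSpace ℝ E).symm w₀)| < ε / 2 := by
        refine (Filter.eventually_all_finset s).mpr fun p _ => mem_nhdsWithin_of_mem_nhds ?_
        have h1 := Metric.tendsto_nhds.mp
          ((continuous_toWeakSpace_symm_apply (F p)).tendsto w₀) (ε / 2) (half_pos hε)
        filter_upwards [h1] with w hw
        rwa [map_sub]
      filter_upwards [hfin, self_mem_nhdsWithin] with w hw hwN p
      have hp := hs (mem_univ p)
      rw [mem_iUnion₂] at hp
      obtain ⟨q, hq, hpq⟩ := hp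
      set k := (toWeakSpace ℝ E).symm w - (toWeakSpace ℝ E).symm w₀ with hk
      have h1 : |F p k - F q k| ≤ D * holderGauge b₁ b₂ p q := hdiff w hwN p q
      have h2 : D * holderGauge b₁ b₂ p q < ε / 2 := hpq
      have h3 := hw q hq
      have h4 := abs_add_le (F p k - F q k) (F q k)
      rw [sub_add_cancel] at h4
      linarith
    refine Metric.tendsto_nhds.mpr fun ε hε => ?_
    obtain ⟨A, hA0, hA⟩ := exists_holderQuot_le (T := T) (K := K) hβ₁.le hb₁ hβ₂.le hb₂
      (ε := ε / (4 * (D + 1))) (by positivity)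
    filter_upwards [hunif (ε / (4 * (A + 1))) (by positivity), self_mem_nhdsWithin] with w hw hwN
    set k := (toWeakSpace ℝ E).symm w - (toWeakSpace ℝ E).symm w₀ with hk
    have hfun : (Φ ((toWeakSpace ℝ E).symm w) - Φ ((toWeakSpace ℝ E).symm w₀)).val =
        fun p => F p k := by
      funext p
      exact (map_sub (F p) _ _).symm
    rw [dist_eq_norm]
    change holderNorm β₁ β₂ _ < ε
    rw [hfun]
    have hS : 0 ≤ ε / (4 * (A + 1)) := by positivity
    refine (holderNorm_le hS (by positivity) hw
      (hA (fun p => F p k) D _ hD0 hS (hdiff w hwN) hw)).trans_lt ?_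
    have e1 : ε / (4 * (D + 1)) * D ≤ ε / 4 := by
      rw [div_mul_eq_mul_div, div_le_div_iff₀ (by positivity) (by positivity)]
      nlinarith
    have e2 : (1 + A) * (ε / (4 * (A + 1))) = ε / 4 := by
      field_simp
      ring
    linarith
  refine ⟨Φ, hval, fun N => ⟨hcont N, ?_⟩⟩
  have h1 := (isCompact_weak_ball (E := E) N).image_of_continuousOn (hcont N)
  convert h1 using 1
  ext f
  constructor
  · rintro ⟨k, hk, rfl⟩
    exact ⟨toWeakSpace ℝ E k, by simpa using hk, by simp⟩
  · rintro ⟨w, hw, rfl⟩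
    exact ⟨_, hw, rfl⟩

end WeakTopology

section WeakTopology

variable {d : ℕ} {T : ℝ} {K : Set (Space d)} {β₁ β₂ b₁ b₂ : ℝ}
  {E : Type*} [NormedAddCommGroup E] [InnerProductSpace ℝ E]

/-- A Lipschitz factor in time does not affect the Hölder continuity of a family of functionals. -/
theorem abs_mul_sub_mul_le (hT : 0 ≤ T) (hb₁ : 0 ≤ b₁) (hb₁' : b₁ ≤ 1) {m : ℝ → ℝ}
    {Λ : ℝ → Space d → E →L[ℝ] ℝ} {M L B C : ℝ} (hm : ∀ t ∈ Icc 0 T, |m t| ≤ M)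
    (hmL : ∀ s ∈ Icc 0 T, ∀ t ∈ Icc 0 T, |m t - m s| ≤ L * |t - s|) (hL : 0 ≤ L) (hB : 0 ≤ B)
    (hΛB : ∀ t ∈ Icc 0 T, ∀ x k, |Λ t x k| ≤ B * ‖k‖)
    (hΛt : ∀ s t, 0 ≤ s → s ≤ t → t ≤ T → ∀ x k,
      |Λ t x k - Λ s x k| ≤ C * (t - s) ^ b₁ * ‖k‖)
    (hΛx : ∀ t ∈ Icc 0 T, ∀ x y k, |Λ t x k - Λ t y k| ≤ C * ‖x - y‖ ^ b₂ * ‖k‖)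
    (p q : Icc (0 : ℝ) T × K) (k : E) :
    |m p.1 * Λ p.1 p.2 k - m q.1 * Λ q.1 q.2 k| ≤
      (M * C + L * T ^ (1 - b₁) * B) * holderGauge b₁ b₂ p q * ‖k‖ := by
  obtain ⟨⟨t, ht⟩, ⟨x, hx⟩⟩ := p
  obtain ⟨⟨s, hs⟩, ⟨y, hy⟩⟩ := q
  simp only [holderGauge]
  have hM : 0 ≤ M := (abs_nonneg _).trans (hm t ht)
  have ht' : |Λ t x k - Λ s x k| ≤ C * |t - s| ^ b₁ * ‖k‖ := by
    rcases le_total s t with h | h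
    · rw [abs_of_nonneg (sub_nonneg.mpr h)]
      exact hΛt s t hs.1 h ht.2 x k
    · rw [abs_sub_comm, abs_sub_comm t s, abs_of_nonneg (sub_nonneg.mpr h)]
      exact hΛt t s ht.1 h hs.2 x k
  have hts : |t - s| ≤ T ^ (1 - b₁) * |t - s| ^ b₁ := by
    have h1 : |t - s| ≤ T := abs_le.mpr ⟨by linarith [ht.1, hs.2], by linarith [ht.2, hs.1]⟩
    calc |t - s| = |t - s| ^ (1 - b₁) * |t - s| ^ b₁ := by
          rw [← Real.rpow_add_of_nonneg (abs_nonneg _) (by linarith) hb₁, sub_add_cancel,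
            Real.rpow_one]
      _ ≤ T ^ (1 - b₁) * |t - s| ^ b₁ := by gcongr
  have e : m t * Λ t x k - m s * Λ s y k =
      (m t - m s) * Λ t x k + m s * (Λ t x k - Λ s x k) + m s * (Λ s x k - Λ s y k) := by ring
  have h1 : |(m t - m s) * Λ t x k| ≤ (L * (T ^ (1 - b₁) * |t - s| ^ b₁)) * (B * ‖k‖) := by
    rw [abs_mul]
    exact mul_le_mul ((hmL s hs t ht).trans (mul_le_mul_of_nonneg_left hts hL)) (hΛB t ht x k)
      (abs_nonneg _) (by positivity)
  have h2 : |m s * (Λ t x k - Λ s x k)| ≤ M * (C * |t - s| ^ b₁ * ‖k‖) := by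
    rw [abs_mul]
    exact mul_le_mul (hm s hs) ht' (abs_nonneg _) hM
  have h3 : |m s * (Λ s x k - Λ s y k)| ≤ M * (C * ‖x - y‖ ^ b₂ * ‖k‖) := by
    rw [abs_mul]
    exact mul_le_mul (hm s hs) (hΛx s hs x y k) (abs_nonneg _) hM
  have h4 : 0 ≤ L * T ^ (1 - b₁) * B * ‖x - y‖ ^ b₂ * ‖k‖ := by positivity
  rw [e]
  refine (abs_add_three _ _ _).trans ((add_le_add_three h1 h2 h3).trans ?_)
  linarith

end WeakTopology

/-! ### The standing assumptions -/

theorem completeSpace_covSpace {d : ℕ} (μ : Measure (Space d)) [μ.HasTemperateGrowth] :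
    CompleteSpace (CovSpace μ) :=
  (Submodule.isClosed_topologicalClosure _).completeSpace_coe

set_option synthInstance.maxHeartbeats 200000 in
theorem completeSpace_controlSpace {d : ℕ} (μ : Measure (Space d)) [μ.HasTemperateGrowth]
    (T : ℝ) : CompleteSpace (ControlSpace μ T) :=
  have := completeSpace_covSpace μ
  inferInstance

/-- As `αᵢ ≠ 1`, one of `αᵢ` and `2 - αᵢ` is smaller than one. -/
theorem admissible_of_le_min {d : ℕ} {α δ : Fin d → ℝ}
    (hα : ∀ i, 0 < α i ∧ α i ≤ 2 ∧ α i ≠ 1) (hδ : ∀ i, |δ i| ≤ min (α i) (2 - α i)) :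
    Admissible α δ := by
  refine ⟨fun i => (hα i).1, fun i => (hα i).2.1, fun i => ?_⟩
  have h1 := (hδ i).trans (min_le_left _ _)
  have h2 := (hδ i).trans (min_le_right _ _)
  rcases lt_or_gt_of_ne (hα i).2.2 with h | h <;> linarith

end FracHeat
end

theorem mainTheorem2 {d : ℕ} (hd : 0 < d) (α δ : Fin d → ℝ)
    (hα : ∀ i, 0 < α i ∧ α i ≤ 2 ∧ α i ≠ 1)
    (hδ : ∀ i, |δ i| ≤ min (α i) (2 - α i))
    (Γ μ : Measure (FracHeat.Space d)) [Γ.HasTemperateGrowth] [μ.HasTemperateGrowth]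
    (hμ : FracHeat.IsSpectralMeasure Γ μ)
    (σ b : ℝ → ℝ)
    (hC : ∃ L : ℝ≥0, LipschitzWith L σ ∧ LipschitzWith L b)
    (η : ℝ) (hη : 0 < η) (hη' : η ≤ 1)
    (hH : Integrable (fun ξ : FracHeat.Space d => 1 / (1 + ∑ i, |ξ i| ^ α i) ^ η) μ)
    (hD : Differentiable ℝ b ∧ ∃ L' : ℝ≥0, LipschitzWith L' (deriv b))
    (T : ℝ) (hT : 0 < T) :
    ∃ u₀ : ℝ → FracHeat.Space d → ℝ,
      FracHeat.IsDeterministicSolution α δ b T u₀ ∧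
      (∀ v, FracHeat.IsDeterministicSolution α δ b T v →
        ∀ t ∈ Icc 0 T, ∀ x, v t x = u₀ t x) ∧
      ∃ Z : FracHeat.ControlSpace μ T → ℝ → FracHeat.Space d → ℝ,
        (∀ h, FracHeat.IsSkeletonSolution α δ μ σ b T u₀ h (Z h) ∧
          ∀ W, FracHeat.IsSkeletonSolution α δ μ σ b T u₀ h W →
            ∀ t ∈ Icc 0 T, ∀ x, W t x = Z h t x) ∧
        ∀ (K : Set (FracHeat.Space d)) (_ : IsCompact K) (β₁ β₂ : ℝ)
          (_ : 0 < β₁) (_ : β₁ < (1 - η) / 2)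
          (_ : 0 < β₂) (_ : β₂ < (⨅ i, α i) * (1 - η) / 2),
          ∃ Φ : FracHeat.ControlSpace μ T → FracHeat.HolderSpace T K β₁ β₂,
            (∀ h (t : Icc (0 : ℝ) T) (x : K), (Φ h).val (t, x) = Z h t x) ∧
            ∀ N : ℝ, 0 < N →
              ContinuousOn
                (fun w : WeakSpace ℝ (FracHeat.ControlSpace μ T) =>
                  Φ ((toWeakSpace ℝ (FracHeat.ControlSpace μ T)).symm w))
                (FracHeat.weakBall μ T N) ∧
              IsCompact (Φ '' {h | ‖h‖ ≤ N}) := by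
  have hadm : FracHeat.Admissible α δ := FracHeat.admissible_of_le_min hα hδ
  have hsp : FracHeat.SpectralCondition α η μ := by
    refine hH.congr (ae_of_all _ fun ξ => ?_)
    simp only [one_div]
    have hS : 0 ≤ ∑ i, |ξ i| ^ α i := FracHeat.powSum_nonneg α ξ
    exact (Real.rpow_neg (by linarith) η).symm
  obtain ⟨L, hσ, hb⟩ := hC
  obtain ⟨-, L', hb'⟩ := hD
  have : Nonempty (Fin d) := ⟨⟨0, hd⟩⟩
  set a : ℝ := ⨅ i, α i with ha_def
  have haα : ∀ i, a ≤ α i := fun i => ciInf_le (finite_range α).bddBelow i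
  obtain ⟨i₀, hi₀⟩ := exists_eq_ciInf_of_finite (f := α)
  have ha : 0 < a := by rw [ha_def, ← hi₀]; exact hadm.pos i₀
  have ha2 : a ≤ 2 := (haα i₀).trans (hadm.le_two i₀)
  obtain ⟨f, hf, hode⟩ := FracHeat.exists_ode_solution hb hT.le
  have hu := FracHeat.isDeterministicSolution_of_ode (T := T) hadm hf hode
  have hc : Continuous fun s => deriv b (f s) := hb'.continuous.comp hf
  set A : ℝ → ℝ := fun t => ∫ s in (0 : ℝ)..t, deriv b (f s) with hA_def
  have hA : ∀ s, HasDerivAt A (deriv b (f s)) s := fun s =>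
    (hc.integral_hasStrictDerivAt 0 s).hasDerivAt
  have hAc : Continuous A := continuous_iff_continuousAt.mpr fun s => (hA s).continuousAt
  have hg : Continuous fun s => Real.exp (-A s) * σ (f s) :=
    (Real.continuous_exp.comp hAc.neg).mul (hσ.continuous.comp hf)
  obtain ⟨Λ, C, hC0, hΛ, hΛt, hΛx⟩ :=
    FracHeat.exists_functional (T := T) hadm hη hη' hsp ha ha2 haα hg
  have hη1 : 0 ≤ (1 - η) / 2 := by linarith
  -- the functionals vanish at time zero, so the time increments from `0` bound them
  have hΛB : ∀ t ∈ Icc 0 T, ∀ x k, |Λ t x k| ≤ C * T ^ ((1 - η) / 2) * ‖k‖ := by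
    intro t ht x k
    have h0 : Λ 0 x k = 0 := by
      rw [hΛ 0 ⟨le_rfl, hT.le⟩, intervalIntegral.integral_same]
    have h1 := hΛt 0 t le_rfl ht.1 ht.2 x k
    rw [h0, sub_zero, sub_zero] at h1
    refine h1.trans ?_
    have := ht.1
    have := ht.2
    gcongr
  have hZ : ∀ k, FracHeat.IsSkeletonSolution α δ μ σ b T (fun t _ => f t) k
      fun t x => Real.exp (A t) * Λ t x k := fun k =>
    FracHeat.isSkeletonSolution_exp_mul hadm hη hη' hsp hσ.continuous hb'.continuous hf hA k
      (fun t ht x => hΛ t ht x k) (fun t ht x => hΛB t ht x k)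
  refine ⟨fun t _ => f t, hu, fun v hv => hu.unique hadm hb hv,
    fun k t x => Real.exp (A t) * Λ t x k,
    fun k => ⟨hZ k, fun W hW => (hZ k).unique hadm hu.bounded hb'.continuous hW⟩, ?_⟩
  intro K hK β₁ β₂ hβ₁ hb₁ hβ₂ hb₂
  -- the factor `exp (A t)` is bounded by `M` and Lipschitz with constant `M'` on `[0, T]`
  have hexp : ∀ s, HasDerivAt (fun s => Real.exp (A s)) (Real.exp (A s) * deriv b (f s)) s :=
    fun s => (hA s).exp
  obtain ⟨M, hM⟩ := isCompact_Icc.exists_bound_of_continuousOn (s := Icc 0 T)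
    (Real.continuous_exp.comp hAc).continuousOn
  obtain ⟨M', hM'⟩ := isCompact_Icc.exists_bound_of_continuousOn (s := Icc 0 T)
    ((Real.continuous_exp.comp hAc).mul hc).continuousOn
  have h0T : (0 : ℝ) ∈ Icc 0 T := ⟨le_rfl, hT.le⟩
  have hM0 : 0 ≤ M := (norm_nonneg _).trans (hM 0 h0T)
  have hM0' : 0 ≤ M' := (norm_nonneg _).trans (hM' 0 h0T)
  have hlip : ∀ s ∈ Icc 0 T, ∀ t ∈ Icc 0 T, |Real.exp (A t) - Real.exp (A s)| ≤ M' * |t - s| :=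
    fun s hs t ht => (convex_Icc 0 T).norm_image_sub_le_of_norm_hasDerivWithin_le
      (fun r _ => (hexp r).hasDerivWithinAt) hM' hs ht
  have := FracHeat.completeSpace_controlSpace μ T
  obtain ⟨Φ, hΦ, hΦN⟩ := FracHeat.exists_holderSpace_map (E := FracHeat.ControlSpace μ T)
    (T := T) hK hβ₁ hb₁ hβ₂ hb₂ (fun p => Real.exp (A p.1) • Λ p.1 p.2)
    (B := M * (C * T ^ ((1 - η) / 2)))
    (C := M * C + M' * T ^ (1 - (1 - η) / 2) * (C * T ^ ((1 - η) / 2)))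
    (by positivity) (by positivity)
    (fun p k => by
      change |Real.exp (A p.1) * Λ p.1 p.2 k| ≤ _
      rw [abs_mul, mul_assoc]
      exact mul_le_mul (hM p.1 p.1.2) (hΛB p.1 p.1.2 p.2 k) (abs_nonneg _) hM0)
    (FracHeat.abs_mul_sub_mul_le (E := FracHeat.ControlSpace μ T) hT.le hη1 (by linarith) hM hlip
      hM0' (by positivity) hΛB hΛt hΛx)
  exact ⟨Φ, fun k t x => hΦ k (t, x), fun N _ => hΦN N⟩
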